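/- **Definitions.** A $\mathbb{Q}$-Hodge structure of weight $n$ is a finite-dimensional $\mathbb{Q}$-vector space $V$ with a decomposition $V_{\mathbb C}=V\otimes_{\mathbb Q}\mathbb{C}=\bigoplus_{p+q=n,\;p,q\ge 0}V^{p,q}$ such that $\overline{V^{p,q}}=V^{q,p}$; morphisms are $\mathbb{Q}$-linear maps whose complexifications respect the decompositions. A polarization is a bilinear form $Q\colon V\times V\to\mathbb{Q}$, extended $\mathbb{C}$-bilinearly to $V_{\mathbb C}$, with $Q(v,u)=(-1)^nQ(u,v)$, with $Q(V^{p,q},V^{r,s})=0$ unless $(p,q)=(s,r)$, and with $\sqrt{-1}^{\,p-q}Q(u,\overline u)>0$ for $0\ne u\in V^{p,q}$. A morphism $f$ of polarized Hodge structures is orthogonal if $Q(f(u),f(v))=Q(u,v)$ for all $u,v\in V$. A Hodge structure $V$ of weight $2$ has no nontrivial quotient of weight $0$ if every Hodge structure $W$ of weight $0$ for which there is a surjective morphism from $V$ onto the Tate twist $W(-1)$ (that is, $W$ placed in bidegree $(1,1)$) is zero. An abelian Cousin group is a connected finite-dimensional complex Lie group $G$ on which every holomorphic function is constant, with a left-invariant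 Hermitian metric $h$ and its maximal compact subgroup $K$, subject to the following condition. Put $T=T_1K\subseteq T_1G$, $H=T\cap\sqrt{-1}\,T$, and let $F$ be the orthogonal complement of $H$ in $T$ with respect to $\mathrm{Re}\,h$. Let $g$ be the left-invariant pseudo-Riemannian metric on $K$ given on $T=H\oplus F$ by $g|_H=-\mathrm{Re}\,h$, $g|_F=\mathrm{Re}\,h$, $H\perp F$. Then the action $\int_0^1 g(\dot\gamma,\dot\gamma)\,dt$ of every closed geodesic $\gamma\colon\mathbb{R}/\mathbb{Z}\to K$ of $(K,g)$ is required to be rational. A morphism of abelian Cousin groups $G\to G'$ is a holomorphic group homomorphism $f$ (it maps $K$ to $K'$, and $df$ maps $T$ to $T'$ and maps $H$ to $H'$ complex linearly) with $df(F)\subseteq F'$; it is isometric if moreover $g'(df(u),df(v))=g(u,v)$ for all $u,v\in T$. An isogeny is a surjective morphism with finite kernel. "Up to isogeny" means localization of the category at the isogenies in it. **Proposition.** 1. The category of polarized $\mathbb{Q}$-Hodge structures of weight $2$ without nontrivial quotients of weight $0$, with orthogonal morphisms, is equivalent to the category of abelian Cousin groups with isometric morphisms, up to isogeny. 2. The category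 of polarized $\mathbb{Q}$-Hodge structures of weight $2$ without nontrivial quotients of weight $0$, with all morphisms of Hodge structures, is equivalent to the category of abelian Cousin groups with all their morphisms, up to isogeny. -/

import Mathlib

open CategoryTheory TensorProduct
open scoped Manifold ContDiff Pointwise ComplexOrder

/-! ### Rational Hodge structures -/

/-- Complex conjugation `z ⊗ v ↦ z̄ ⊗ v` on `ℂ ⊗ V`, for a rational vector space `V`. -/
noncomputable def complexConj (V : Type) [AddCommGroup V] [Module ℚ V] :
    ℂ ⊗[ℚ] V →ₗ[ℚ] ℂ ⊗[ℚ] V :=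
  LinearMap.rTensor V (Complex.conjAe.toLinearMap.restrictScalars ℚ)

/-- A `ℚ`-Hodge structure of weight `n`. The summand `V^{p,q}` is `piece (p, q)`; it is zero unless
`p + q = n`. -/
structure RatHodgeStructure (n : ℕ) where
  V : Type
  [addCommGroup : AddCommGroup V]
  [module : Module ℚ V]
  [finiteDimensional : FiniteDimensional ℚ V]
  piece : ℕ × ℕ → Submodule ℂ (ℂ ⊗[ℚ] V)
  piece_eq_bot : ∀ p q : ℕ, p + q ≠ n → piece (p, q) = ⊥
  isInternal : DirectSum.IsInternal piece
  conj_mem : ∀ p q : ℕ, ∀ x ∈ piece (p, q), complexConj V x ∈ piece (q, p)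

attribute [instance] RatHodgeStructure.addCommGroup RatHodgeStructure.module
  RatHodgeStructure.finiteDimensional

namespace RatHodgeStructure

/-- The bigrading of the Tate twist `W(-1)`: its `(p + 1, q + 1)` summand is `W^{p,q}`. -/
noncomputable def twistPiece {n : ℕ} (W : RatHodgeStructure n) : ℕ × ℕ → Submodule ℂ (ℂ ⊗[ℚ] W.V)
  | (p + 1, q + 1) => W.piece (p, q)
  | _ => ⊥

theorem twistPiece_isInternal {n : ℕ} (W : RatHodgeStructure n) :
    DirectSum.IsInternal W.twistPiece := by
  have hW := (DirectSum.isInternal_submodule_iff_iSupIndep_and_iSup_eq_top _).1 W.isInternal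
  rw [DirectSum.isInternal_submodule_iff_iSupIndep_and_iSup_eq_top]
  refine ⟨?_, ?_⟩
  · rintro ⟨p | p, q | q⟩
    · exact disjoint_bot_left
    · exact disjoint_bot_left
    · exact disjoint_bot_left
    · refine (hW.1 (p, q)).mono_right ?_
      refine iSup₂_le ?_
      rintro ⟨r | r, s | s⟩ h
      · exact bot_le
      · exact bot_le
      · exact bot_le
      · refine le_iSup₂_of_le (r, s) ?_ le_rfl
        rintro h'
        apply h
        simp only [Prod.mk.injEq] at h' ⊢
        omega
  · rw [eq_top_iff, ← hW.2]
    refine iSup_le ?_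
    rintro ⟨p, q⟩
    exact le_iSup_of_le (p + 1, q + 1) le_rfl

/-- The Tate twist `W(-1)`, through which a Hodge structure of weight `n` is regarded as one of
weight `n + 2`. -/
noncomputable def tateTwist {n : ℕ} (W : RatHodgeStructure n) : RatHodgeStructure (n + 2) where
  V := W.V
  piece := W.twistPiece
  piece_eq_bot := by
    rintro (_ | p) (_ | q) h
    · rfl
    · rfl
    · rfl
    · exact W.piece_eq_bot p q (by omega)
  isInternal := W.twistPiece_isInternal
  conj_mem := by
    rintro (_ | p) (_ | q) x hx
    · exact (Submodule.mem_bot ℂ).2 (by rw [(Submodule.mem_bot ℂ).1 hx, map_zero])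
    · exact (Submodule.mem_bot ℂ).2 (by rw [(Submodule.mem_bot ℂ).1 hx, map_zero])
    · exact (Submodule.mem_bot ℂ).2 (by rw [(Submodule.mem_bot ℂ).1 hx, map_zero])
    · exact W.conj_mem p q x hx

/-- A morphism of `ℚ`-Hodge structures of the same weight. -/
@[ext]
structure Hom {n : ℕ} (X Y : RatHodgeStructure n) where
  toLinearMap : X.V →ₗ[ℚ] Y.V
  map_piece : ∀ p q : ℕ, ∀ x ∈ X.piece (p, q), toLinearMap.baseChange ℂ x ∈ Y.piece (p, q)

/-- `X`, of weight 2, has no nontrivial quotient of weight 0: every surjective morphism from `X`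
onto (the Tate twist of) a Hodge structure of weight 0 has zero target. -/
def NoWeightZeroQuotient (X : RatHodgeStructure 2) : Prop :=
  ∀ (W : RatHodgeStructure 0) (f : Hom X W.tateTwist),
    Function.Surjective f.toLinearMap → Subsingleton W.V

end RatHodgeStructure

/-- A polarized `ℚ`-Hodge structure of weight `n`; the form `Q` is extended to `ℂ ⊗ V` complex
bilinearly. -/
structure PolHodgeStructure (n : ℕ) extends RatHodgeStructure n where
  Q : LinearMap.BilinForm ℚ V
  symm : ∀ u v : V, Q v u = (-1) ^ n * Q u v
  orthogonal : ∀ p q r s : ℕ, (p, q) ≠ (s, r) →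
    ∀ u ∈ piece (p, q), ∀ v ∈ piece (r, s), Q.baseChange ℂ u v = 0
  pos : ∀ p q : ℕ, ∀ u ∈ piece (p, q), u ≠ 0 →
    0 < Complex.I ^ ((p : ℤ) - (q : ℤ)) * Q.baseChange ℂ u (complexConj V u)

/-- Polarized Hodge structures, with all morphisms of the underlying Hodge structures. -/
instance PolHodgeStructure.category (n : ℕ) : Category (PolHodgeStructure n) where
  Hom X Y := RatHodgeStructure.Hom X.toRatHodgeStructure Y.toRatHodgeStructure
  id X := ⟨LinearMap.id, fun p q x hx => by simpa using hx⟩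
  comp f g := ⟨g.toLinearMap ∘ₗ f.toLinearMap, fun p q x hx => by
    rw [LinearMap.baseChange_comp]
    exact g.map_piece p q _ (f.map_piece p q x hx)⟩

/-- The orthogonal morphisms, that is, those which preserve the polarizations. -/
def PolHodgeStructure.orthogonalMaps (n : ℕ) : MorphismProperty (PolHodgeStructure n) :=
  fun X Y f => ∀ u v : X.V,
    Y.Q (RatHodgeStructure.Hom.toLinearMap f u) (RatHodgeStructure.Hom.toLinearMap f v) = X.Q u v

instance (n : ℕ) : (PolHodgeStructure.orthogonalMaps n).IsMultiplicative where
  id_mem _ := fun _ _ => rfl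
  comp_mem _ _ hf hg := fun u v => (hg _ _).trans (hf u v)

/-- The polarized Hodge structures of weight 2 without nontrivial quotients of weight 0. -/
def PolHodgeStructure.noWeightZeroQuotient : ObjectProperty (PolHodgeStructure 2) :=
  fun X => X.toRatHodgeStructure.NoWeightZeroQuotient

/-! ### CR Hermitian structures induced on real subspaces -/

section CR

variable {U : Type} [AddCommGroup U] [Module ℂ U]

/-- The distinguished complex subspace `H = V ∩ iV` of a real subspace `V`. -/
def crComplex (V : Submodule ℝ U) : Submodule ℝ U := V ⊓ Complex.I • V

/-- The real part of a Hermitian inner product, as a real bilinear form. -/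
def reForm (h : InnerProductSpace.Core ℂ U) : LinearMap.BilinForm ℝ U :=
  LinearMap.mk₂ ℝ (fun x y => (h.inner x y).re)
    (fun x y z => by simp [h.add_left])
    (fun c x y => by
      have := h.smul_left x y (c : ℂ)
      rw [show c • x = (c : ℂ) • x from (Complex.coe_smul c x).symm, this]
      simp)
    (fun x y z => by
      rw [← h.conj_inner_symm x (y + z), ← h.conj_inner_symm x y, ← h.conj_inner_symm x z,
        h.add_left]
      simp)
    (fun c x y => by
      rw [show c • y = (c : ℂ) • y from (Complex.coe_smul c y).symm,
        ← h.conj_inner_symm x ((c : ℂ) • y), ← h.conj_inner_symm x y, h.smul_left]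
      simp)

/-- The distinguished cocomplex subspace `F` of `V`: the orthogonal complement of `H` in `V`. -/
def crCocomplex (h : InnerProductSpace.Core ℂ U) (V : Submodule ℝ U) : Submodule ℝ U :=
  V ⊓ (reForm h).orthogonal (crComplex V)

theorem isCompl_crComplex [FiniteDimensional ℂ U] (h : InnerProductSpace.Core ℂ U)
    (V : Submodule ℝ U) :
    IsCompl (crComplex V) ((reForm h).orthogonal (crComplex V)) := by
  have : FiniteDimensional ℝ U := FiniteDimensional.complexToReal U
  have hs : (reForm h).IsRefl := by
    intro x y hxy
    change (h.inner y x).re = 0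
    rw [← h.conj_inner_symm, Complex.conj_re]
    exact hxy
  rw [LinearMap.BilinForm.isCompl_orthogonal_iff_disjoint hs, Submodule.disjoint_def]
  intro x hx hx'
  have h0 : (h.inner x x).re = 0 := hx' x hx
  apply h.definite
  refine Complex.ext h0 ?_
  exact Complex.conj_eq_iff_im.1 (h.conj_inner_symm x x)

/-- The CR Hermitian form induced on `V` by a Hermitian inner product `h`: it is `-Re h` on `H`,
`Re h` on `F`, and `H ⟂ F`. It is written on all of `U`, where it is to be evaluated on vectors of
`V`, for which `P` is the projection onto `H` along `F`. -/
noncomputable def crForm [FiniteDimensional ℂ U] (h : InnerProductSpace.Core ℂ U)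
    (V : Submodule ℝ U) : LinearMap.BilinForm ℝ U :=
  let P : U →ₗ[ℝ] U := Submodule.projection _ _ (isCompl_crComplex h V)
  (reForm h).compl₁₂ (LinearMap.id - P) (LinearMap.id - P) - (reForm h).compl₁₂ P P

end CR

/-! ### Curves in subgroups of complex Lie groups

Here `G` is a complex Lie group modelled on `E`; Mathlib's tangent space at each point of `G` is
`E`. -/

section Curves

variable (E : Type) [NormedAddCommGroup E] [NormedSpace ℂ E]
  {G : Type} [Group G] [TopologicalSpace G] [ChartedSpace E G]

/-- Every holomorphic function on `G` is constant. -/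
def HolomorphicConstant (G : Type) [TopologicalSpace G] [ChartedSpace E G] : Prop :=
  ∀ f : G → ℂ, MDifferentiable 𝓘(ℂ, E) 𝓘(ℂ, ℂ) f → ∃ c : ℂ, ∀ x, f x = c

/-- The velocity of a curve at time `t`, moved to the tangent space at `1` by left translation. -/
noncomputable def leftVelocity (γ : ℝ → G) (t : ℝ) : E :=
  (mfderiv 𝓘(ℝ, ℝ) 𝓘(ℝ, E) (fun s => (γ t)⁻¹ * γ s) t : ℝ →L[ℝ] E) 1

/-- The tangent space at `1` of a subgroup `K`: the velocities at `1` of smooth curves in `K`. -/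
noncomputable def tangentAtOne (K : Subgroup G) : Submodule ℝ E :=
  Submodule.span ℝ {v | ∃ γ : ℝ → G, ContMDiff 𝓘(ℝ, ℝ) 𝓘(ℝ, E) ∞ γ ∧ (∀ t, γ t ∈ K) ∧
    γ 0 = 1 ∧ v = (mfderiv 𝓘(ℝ, ℝ) 𝓘(ℝ, E) γ 0 : ℝ →L[ℝ] E) 1}

/-- The action, on `[a, b]`, of a curve, for the left-invariant pseudo-Riemannian metric with
value `g` at `1`. -/
noncomputable def curveAction (g : LinearMap.BilinForm ℝ E) (a b : ℝ) (γ : ℝ → G) : ℝ :=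
  ∫ t in a..b, g (leftVelocity E γ t) (leftVelocity E γ t)

/-- Geodesics of `K` with the left-invariant pseudo-Riemannian metric `g`: the smooth curves in
`K` which on every interval are critical points of the action, among the curves in `K` with the
same endpoints. -/
def IsGeodesicIn (K : Subgroup G) (g : LinearMap.BilinForm ℝ E) (γ : ℝ → G) : Prop :=
  ContMDiff 𝓘(ℝ, ℝ) 𝓘(ℝ, E) ∞ γ ∧ (∀ t, γ t ∈ K) ∧
    ∀ a b : ℝ, a < b → ∀ Γ : ℝ × ℝ → G, ContMDiff 𝓘(ℝ, ℝ × ℝ) 𝓘(ℝ, E) ∞ Γ →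
      (∀ s t, Γ (s, t) ∈ K) → (∀ t, Γ (0, t) = γ t) →
      (∀ s, Γ (s, a) = γ a) → (∀ s, Γ (s, b) = γ b) →
      HasDerivAt (fun s => curveAction E g a b fun t => Γ (s, t)) 0 0

/-- `K` with the left-invariant pseudo-Riemannian metric `g` is polarized: the action of every
closed geodesic is rational. -/
def IsPolarizedIn (K : Subgroup G) (g : LinearMap.BilinForm ℝ E) : Prop :=
  ∀ γ : ℝ → G, IsGeodesicIn E K g γ → (∀ t, γ (t + 1) = γ t) →
    ∃ q : ℚ, curveAction E g 0 1 γ = q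

end Curves

/-! ### Abelian Cousin groups -/

/-- An abelian Cousin group: a connected complex Lie group `G` on which every holomorphic function
is constant, with a left-invariant Hermitian metric (given by its value at `1`), such that the
induced CR Hermitian structure on the maximal compact subgroup `K` is polarized. -/
structure AbelianCousinGroup where
  E : Type
  [normedAddCommGroup : NormedAddCommGroup E]
  [normedSpace : NormedSpace ℂ E]
  [finiteDimensional : FiniteDimensional ℂ E]
  G : Type
  [group : Group G]
  [topologicalSpace : TopologicalSpace G]
  [chartedSpace : ChartedSpace E G]
  [lieGroup : LieGroup 𝓘(ℂ, E) ω G]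
  [t2Space : T2Space G]
  [connectedSpace : ConnectedSpace G]
  holomorphicConstant : HolomorphicConstant E G
  K : Subgroup G
  maximal_compact : Maximal (fun L : Subgroup G => IsCompact (L : Set G)) K
  metric : InnerProductSpace.Core ℂ E
  polarized : IsPolarizedIn E K (crForm metric (tangentAtOne E K))

namespace AbelianCousinGroup

attribute [instance] normedAddCommGroup normedSpace finiteDimensional group topologicalSpace
  chartedSpace lieGroup t2Space connectedSpace

/-- The tangent space at `1` of the maximal compact subgroup. -/
noncomputable def T (X : AbelianCousinGroup) : Submodule ℝ X.E := tangentAtOne X.E X.K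

/-- The differential at `1` of a map `f` with `f 1 = 1`. -/
noncomputable def differential (X Y : AbelianCousinGroup) (f : X.G → Y.G) : X.E →L[ℂ] Y.E :=
  mfderiv 𝓘(ℂ, X.E) 𝓘(ℂ, Y.E) f 1

/-- A morphism: a holomorphic group homomorphism whose restriction to the maximal compact
subgroups respects the induced bi-CR structures. Compatibility with the distinguished complex
subspaces `H` and with their complex structures holds for every holomorphic homomorphism, so only
the distinguished cocomplex subspaces `F` are mentioned. -/
@[ext]
structure Hom (X Y : AbelianCousinGroup) where
  toMonoidHom : X.G →* Y.G
  contMDiff : ContMDiff 𝓘(ℂ, X.E) 𝓘(ℂ, Y.E) ω toMonoidHom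
  map_compact : ∀ x ∈ X.K, toMonoidHom x ∈ Y.K
  map_cocomplex : ∀ v ∈ crCocomplex X.metric X.T,
    differential X Y toMonoidHom v ∈ crCocomplex Y.metric Y.T

theorem differential_id (X : AbelianCousinGroup) (v : X.E) :
    differential X X (MonoidHom.id X.G) v = v := by
  change (mfderiv 𝓘(ℂ, X.E) 𝓘(ℂ, X.E) (id : X.G → X.G) 1) v = v
  rw [mfderiv_id]
  rfl

theorem differential_comp {X Y Z : AbelianCousinGroup} (f : Hom X Y) (g : Hom Y Z) (v : X.E) :
    differential X Z (g.toMonoidHom.comp f.toMonoidHom) v =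
      differential Y Z g.toMonoidHom (differential X Y f.toMonoidHom v) := by
  have hf : MDifferentiableAt 𝓘(ℂ, X.E) 𝓘(ℂ, Y.E) f.toMonoidHom 1 :=
    f.contMDiff.mdifferentiable (by simp) 1
  have hg : MDifferentiable 𝓘(ℂ, Y.E) 𝓘(ℂ, Z.E) g.toMonoidHom :=
    g.contMDiff.mdifferentiable (by simp)
  have key : ∀ y : Y.G, y = 1 → ∀ w : Y.E,
      (mfderiv 𝓘(ℂ, Y.E) 𝓘(ℂ, Z.E) g.toMonoidHom y : Y.E →L[ℂ] Z.E) w =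
        differential Y Z g.toMonoidHom w := by
    rintro y rfl w
    rfl
  have hc := mfderiv_comp (1 : X.G) (hg (f.toMonoidHom 1)) hf
  have := DFunLike.congr_fun hc v
  exact this.trans (key _ (map_one f.toMonoidHom) _)

/-- Abelian Cousin groups, with the homomorphisms respecting the induced bi-CR structures. -/
instance category : Category AbelianCousinGroup where
  Hom X Y := Hom X Y
  id X := ⟨MonoidHom.id X.G, contMDiff_id, fun _ hx => hx, fun v hv => by
    rw [differential_id]
    exact hv⟩
  comp {X Y Z} f g := ⟨g.toMonoidHom.comp f.toMonoidHom, g.contMDiff.comp f.contMDiff,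
    fun x hx => g.map_compact _ (f.map_compact x hx), fun v hv => by
      rw [differential_comp]
      exact g.map_cocomplex _ (f.map_cocomplex v hv)⟩

/-- The homomorphism underlying a morphism. -/
def hom {X Y : AbelianCousinGroup} (f : X ⟶ Y) : X.G →* Y.G := Hom.toMonoidHom f

/-- The morphisms whose restrictions to the maximal compact subgroups also preserve the induced
CR Hermitian forms. -/
def isometric : MorphismProperty AbelianCousinGroup :=
  fun X Y f => ∀ u ∈ X.T, ∀ v ∈ X.T,
    crForm Y.metric Y.T (differential X Y (hom f) u) (differential X Y (hom f) v) =
      crForm X.metric X.T u v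

theorem differential_mem {X Y : AbelianCousinGroup} (f : Hom X Y) {v : X.E} (hv : v ∈ X.T) :
    differential X Y f.toMonoidHom v ∈ Y.T := by
  let D : X.E →ₗ[ℝ] Y.E := (differential X Y f.toMonoidHom).toLinearMap.restrictScalars ℝ
  change D v ∈ Y.T
  suffices h : X.T ≤ Y.T.comap D from h hv
  refine Submodule.span_le.2 ?_
  rintro _ ⟨γ, hγ, hK, h1, rfl⟩
  have hf : ContMDiff 𝓘(ℝ, X.E) 𝓘(ℝ, Y.E) ∞ f.toMonoidHom := fun x =>
    ⟨(f.contMDiff x).1, ((f.contMDiff x).2.restrict_scalars ℝ).of_le (by simp)⟩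
  have hd : HasMFDerivAt 𝓘(ℂ, X.E) 𝓘(ℂ, Y.E) f.toMonoidHom 1
      (differential X Y f.toMonoidHom) :=
    (f.contMDiff.mdifferentiable (by simp) 1).hasMFDerivAt
  have hd' : ∀ x : X.G, x = 1 → HasMFDerivAt 𝓘(ℝ, X.E) 𝓘(ℝ, Y.E) f.toMonoidHom x
      ((differential X Y f.toMonoidHom).restrictScalars ℝ) := by
    rintro x rfl
    exact ⟨hd.1, hd.2.restrictScalars ℝ⟩
  have hγ' := (hγ.mdifferentiable (by simp) 0).hasMFDerivAt
  have hc := (HasMFDerivAt.comp (0 : ℝ) (hd' _ h1) hγ').mfderiv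
  refine Submodule.subset_span ⟨f.toMonoidHom ∘ γ, hf.comp hγ, fun t => f.map_compact _ (hK t),
    by simp [h1], ?_⟩
  exact (DFunLike.congr_fun hc (1 : ℝ)).symm

instance : isometric.IsMultiplicative where
  id_mem X := fun u _ v _ => by
    change crForm X.metric X.T (differential X X (MonoidHom.id X.G) u)
      (differential X X (MonoidHom.id X.G) v) = _
    rw [differential_id, differential_id]
  comp_mem {X Y Z} f g hf hg := fun u hu v hv => by
    change crForm Z.metric Z.T
      (differential X Z ((Hom.toMonoidHom g).comp (Hom.toMonoidHom f)) u)
      (differential X Z ((Hom.toMonoidHom g).comp (Hom.toMonoidHom f)) v) = _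
    rw [differential_comp, differential_comp]
    exact (hg _ (differential_mem f hu) _ (differential_mem f hv)).trans (hf u hu v hv)

/-- Isogenies: surjective morphisms with finite kernel. -/
def isogeny : MorphismProperty AbelianCousinGroup :=
  fun _ _ f => Function.Surjective (hom f) ∧ Finite (hom f).ker

end AbelianCousinGroup

/-! ### Restriction of scalars from complex to real manifolds -/

section
variable {E : Type} [NormedAddCommGroup E] [NormedSpace ℂ E]
  {G : Type} [TopologicalSpace G] [ChartedSpace E G]
  {E' : Type} [NormedAddCommGroup E'] [NormedSpace ℂ E']
  {G' : Type} [TopologicalSpace G'] [ChartedSpace E' G']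

/-! An abelian Cousin group is a piece of linear algebra. Its adjoint representation is a
holomorphic map to a vector space, hence constant, so one-parameter subgroups are central. They
combine into an exponential homomorphism `E → G`, a holomorphic covering with discrete kernel Λ. The
maximal compact subgroup is the image of ℝΛ, and T = ℝΛ. The invariant metric g on this torus is
flat: its geodesics lift to straight lines, or at least have their action, so the actions of closed
geodesics are the numbers g(v, v) with v in Λ (`IsExp.isPolarizedIn_core`). The group with its
metric is therefore a triple (E, Λ, h) with g(v, v) rational on Λ.

Put V = ℚΛ, so that V_ℝ = T. The natural map φ : V_ℂ → E is onto. Declare V^{0,2} to be its kernel,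
V^{2,0} the conjugate of V^{0,2} (which φ identifies with H), and V^{1,1} the complexification of F;
then T = H ⊕ F becomes a Hodge decomposition (`CRDatum.isInternal`). The restriction of g to V is a
polarization, because g is negative on H, positive on F and invariant under i on H. A quotient of
weight 0 would give a rational linear form on V killing V^{0,2}, that is, a complex linear form l on
E which is integral on Λ after scaling. Then exp(2πi l) descends to G and must be constant, so l = 0
(`IsExp.noWeightZeroQuotient`).

Conversely, given a polarized Hodge structure take E = V_ℂ / V^{0,2}, a lattice Λ in V, and the
Hermitian product on E read off from Q. A holomorphic function on E / Λ lifts to a Λ-periodic entire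
function. It is bounded on translates of T, hence invariant under H by Liouville. No nonzero
integral form kills H, as there is no quotient of weight 0, so Fourier analysis on T / Λ makes the
function constant on T, and it is constant on E = T + iT by the identity theorem
(`eq_of_differentiable_of_periodic`).

A morphism of Hodge structures induces a complex linear map L of tangent spaces preserving F but
only the rational spans of the lattices. Some multiple ML preserves the lattices and integrates to a
homomorphism, so the morphism is a fraction with denominator the isogeny M. Multiplying the metric
of the source by M² makes this isogeny an isometry, and the numerator too when the given morphism is
orthogonal (`exists_isogeny_of_hodge`). The functor to Hodge structures is faithful, essentially
surjective and inverts isogenies. Together with the fractions this identifies its target with the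
localization (`nonempty_localization_equivalence`), in both versions of the statement. -/

theorem ContMDiffAt.complexToReal {f : G → G'} {n : WithTop ℕ∞} {x : G}
    (hf : ContMDiffAt 𝓘(ℂ, E) 𝓘(ℂ, E') n f x) : ContMDiffAt 𝓘(ℝ, E) 𝓘(ℝ, E') n f x :=
  ⟨hf.1, hf.2.restrict_scalars ℝ⟩

theorem HasMFDerivAt.complexToReal {f : G → G'} {x : G} {L : E →L[ℂ] E'}
    (hf : HasMFDerivAt 𝓘(ℂ, E) 𝓘(ℂ, E') f x L) :
    HasMFDerivAt 𝓘(ℝ, E) 𝓘(ℝ, E') f x (L.restrictScalars ℝ) :=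
  ⟨hf.1, hf.2.restrictScalars ℝ⟩

theorem HasMFDerivAt.realToComplex {f : G → G'} {x : G} {L : E →L[ℂ] E'}
    (hf : HasMFDerivAt 𝓘(ℝ, E) 𝓘(ℝ, E') f x (L.restrictScalars ℝ)) :
    HasMFDerivAt 𝓘(ℂ, E) 𝓘(ℂ, E') f x L :=
  ⟨hf.1, by
    have h : HasFDerivAt _ _ _ := hf.2.hasFDerivAt (by simp)
    exact (hasFDerivAt_of_restrictScalars ℝ h rfl).hasFDerivWithinAt⟩

theorem IsManifold.complexToReal {n : WithTop ℕ∞} [h : IsManifold 𝓘(ℂ, E) n G] :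
    IsManifold 𝓘(ℝ, E) n G := by
  refine isManifold_of_contDiffOn _ _ _ fun e e' he he' => ?_
  have := (contDiffGroupoid n 𝓘(ℂ, E)).compatible he he'
  rw [contDiffGroupoid, mem_groupoid_of_pregroupoid] at this
  exact this.1.restrict_scalars ℝ

theorem LieGroup.complexToReal {n : WithTop ℕ∞} [Group G] [h : LieGroup 𝓘(ℂ, E) n G] :
    LieGroup 𝓘(ℝ, E) n G where
  toIsManifold := IsManifold.complexToReal
  contMDiff_mul x :=
    have := h.contMDiff_mul x
    ⟨this.1, this.2.restrict_scalars ℝ⟩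
  contMDiff_inv x := (h.contMDiff_inv x).complexToReal
end

/-! ### Differentials of products and translations on a Lie group -/

section
variable {𝕜 : Type} [RCLike 𝕜] {E : Type} [NormedAddCommGroup E] [NormedSpace 𝕜 E]
  {G : Type} [TopologicalSpace G] [ChartedSpace E G] [Group G]
  {F : Type} [NormedAddCommGroup F] [NormedSpace 𝕜 F]
  {M : Type} [TopologicalSpace M] [ChartedSpace F M]

/-- Both partial maps at `(1, 1)` are the identity, since `1` is neutral, and the differential is
the sum of the partial differentials. -/
theorem hasMFDerivAt_mul_one [LieGroup 𝓘(𝕜, E) 1 G] :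
    HasMFDerivAt (𝓘(𝕜, E).prod 𝓘(𝕜, E)) 𝓘(𝕜, E) (fun p : G × G => p.1 * p.2) (1, 1)
      (ContinuousLinearMap.fst 𝕜 E E + ContinuousLinearMap.snd 𝕜 E E) := by
  have hd : MDifferentiableAt (𝓘(𝕜, E).prod 𝓘(𝕜, E)) 𝓘(𝕜, E) (fun p : G × G => p.1 * p.2) (1, 1) :=
    (contMDiff_mul 𝓘(𝕜, E) 1).mdifferentiable (by simp) _
  have h := hd.hasMFDerivAt
  refine h.congr_mfderiv ?_
  apply ContinuousLinearMap.ext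
  intro (v : E × E)
  have h2 := mfderiv_prod_eq_add_apply hd (v := v)
  refine Eq.trans h2 ?_
  have e1 : (fun z : G => (z, (1:G)).1 * (z, (1:G)).2) = id := by ext; simp
  have e2 : (fun z : G => ((1:G), z).1 * ((1:G), z).2) = id := by ext; simp
  simp only [] at e1 e2 ⊢
  rw [e1, e2, mfderiv_id]
  rfl

theorem HasMFDerivAt.mul_of_eq_one [LieGroup 𝓘(𝕜, E) 1 G] {f g : M → G} {x : M} {f' g' : F →L[𝕜] E}
    (hf : HasMFDerivAt 𝓘(𝕜, F) 𝓘(𝕜, E) f x f') (hg : HasMFDerivAt 𝓘(𝕜, F) 𝓘(𝕜, E) g x g')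
    (hfx : f x = 1) (hgx : g x = 1) :
    HasMFDerivAt 𝓘(𝕜, F) 𝓘(𝕜, E) (fun y => f y * g y) x (f' + g') := by
  have h : HasMFDerivAt (𝓘(𝕜, E).prod 𝓘(𝕜, E)) 𝓘(𝕜, E) (fun p : G × G => p.1 * p.2) (f x, g x)
      (ContinuousLinearMap.fst 𝕜 E E + ContinuousLinearMap.snd 𝕜 E E) := by
    rw [hfx, hgx]
    exact hasMFDerivAt_mul_one
  exact h.comp x (hf.prodMk hg)

variable (𝕜 E) in
/-- The differential at `1` of the left translation by `g`. -/
noncomputable def leftDifferential (g : G) : E →L[𝕜] E :=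
  mfderiv 𝓘(𝕜, E) 𝓘(𝕜, E) (fun x : G => g * x) 1

theorem hasMFDerivAt_mul_left_one [LieGroup 𝓘(𝕜, E) 1 G] (g : G) :
    HasMFDerivAt 𝓘(𝕜, E) 𝓘(𝕜, E) (fun x : G => g * x) 1 (leftDifferential 𝕜 E g) :=
  ((contMDiff_mul_left (n := 1)).mdifferentiable (by simp) _).hasMFDerivAt

theorem leftDifferential_one : leftDifferential 𝕜 E (1 : G) = ContinuousLinearMap.id 𝕜 E := by
  have e : (fun x : G => 1 * x) = id := by ext; simp
  rw [leftDifferential, e, mfderiv_id]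
  rfl

/-- The derivative of a homomorphism to a Lie group is determined by the derivative at `0`. -/
theorem HasMFDerivAt.translate [LieGroup 𝓘(𝕜, E) 1 G] {p : F → G} (hp : ∀ x y, p (x + y) =
    p x * p y)
   {L : F →L[𝕜] E} (h : HasMFDerivAt 𝓘(𝕜, F) 𝓘(𝕜, E) p 0 L) (x : F) :
    HasMFDerivAt 𝓘(𝕜, F) 𝓘(𝕜, E) p x
      (leftDifferential 𝕜 E (p x) ∘L L) := by
  have h1 : p 0 = 1 := by simpa using hp 0 0
  have hd : HasMFDerivAt 𝓘(𝕜, E) 𝓘(𝕜, E) (fun g : G => p x * g) (p (x + -x))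
      (leftDifferential 𝕜 E (p x)) := by
    rw [add_neg_cancel, h1]
    exact hasMFDerivAt_mul_left_one _
  have ht : HasMFDerivAt 𝓘(𝕜, F) 𝓘(𝕜, F) (fun y => y + -x) x (ContinuousLinearMap.id 𝕜 F) :=
    ((hasFDerivAt_id x).add_const (-x)).hasMFDerivAt
  have h' : HasMFDerivAt 𝓘(𝕜, F) 𝓘(𝕜, E) p (x + -x) L := by
    rw [add_neg_cancel]; exact h
  have := hd.comp x (h'.comp x ht)
  convert this using 1
  · ext y
    simp [← hp]
  · rfl
end

/-! ### One-parameter subgroups -/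

section
variable {E : Type} [NormedAddCommGroup E] [NormedSpace ℝ E] [CompleteSpace E]
  {G : Type} [TopologicalSpace G] [ChartedSpace E G] [Group G] [LieGroup 𝓘(ℝ, E) 3 G] [T2Space G]

omit [CompleteSpace E] [T2Space G] in
theorem isMIntegralCurve_of_hom {γ : ℝ → G} {v : E} (hγ : ∀ s t, γ (s + t) = γ s * γ t)
    (h : HasMFDerivAt 𝓘(ℝ, ℝ) 𝓘(ℝ, E) γ 0 ((1 : ℝ →L[ℝ] ℝ).smulRight v)) :
    IsMIntegralCurve γ (mulInvariantVectorField (I := 𝓘(ℝ, E)) (G := G) v) := by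
  have : LieGroup 𝓘(ℝ, E) 1 G := LieGroup.of_le (n := 3) (by norm_num)
  intro t
  refine (h.translate hγ t).congr_mfderiv ?_
  apply ContinuousLinearMap.ext_ring
  change leftDifferential ℝ E (γ t) ((1 : ℝ) • v) = (1 : ℝ) • leftDifferential ℝ E (γ t) v
  rw [one_smul, one_smul]

omit [CompleteSpace E] [T2Space G] in
theorem contMDiff_mulInvariantVectorField_one (v : E) :
   ContMDiff 𝓘(ℝ, E) 𝓘(ℝ, E).tangent 1 (fun g : G => (⟨g, mulInvariantVectorField (I := 𝓘(ℝ, E))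
       (G := G) v g⟩ : TangentBundle 𝓘(ℝ, E) G)) := by
  have : LieGroup 𝓘(ℝ, E) (minSmoothness ℝ 3) G := by simpa using ‹LieGroup 𝓘(ℝ, E) 3 G›
  exact (contMDiff_mulInvariantVectorField (I := 𝓘(ℝ, E)) (G := G) v).of_le (by simp)

omit [CompleteSpace E] in
-- Both homomorphisms are integral curves of the same left-invariant vector field with the same
-- starting point.
theorem hom_eq_of_hasMFDerivAt {γ γ' : ℝ → G} {v : E} (hγ : ∀ s t, γ (s + t) = γ s * γ t)
    (hγ' : ∀ s t, γ' (s + t) = γ' s * γ' t)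
    (h : HasMFDerivAt 𝓘(ℝ, ℝ) 𝓘(ℝ, E) γ 0 ((1 : ℝ →L[ℝ] ℝ).smulRight v))
    (h' : HasMFDerivAt 𝓘(ℝ, ℝ) 𝓘(ℝ, E) γ' 0 ((1 : ℝ →L[ℝ] ℝ).smulRight v)) : γ = γ' := by
  have h1 : γ 0 = 1 := by simpa using hγ 0 0
  have h1' : γ' 0 = 1 := by simpa using hγ' 0 0
  have : IsManifold 𝓘(ℝ, E) 1 G := IsManifold.of_le (n := 3) (by norm_num)
  exact isMIntegralCurve_Ioo_eq_of_contMDiff_boundaryless (t₀ := 0)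
      (contMDiff_mulInvariantVectorField_one v)
    (isMIntegralCurve_of_hom hγ h) (isMIntegralCurve_of_hom hγ' h') (h1.trans h1'.symm)

omit [CompleteSpace E] [T2Space G] in
theorem IsMIntegralCurveOn.mul_left_invariant {γ : ℝ → G} {v : E} {s : Set ℝ} (g : G)
    (h : IsMIntegralCurveOn γ (mulInvariantVectorField (I := 𝓘(ℝ, E)) (G := G) v) s) :
    IsMIntegralCurveOn (fun t => g * γ t) (mulInvariantVectorField (I := 𝓘(ℝ, E)) (G := G) v) s :=
        by
  have : LieGroup 𝓘(ℝ, E) 1 G := LieGroup.of_le (n := 3) (by norm_num)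
  have hd (g x : G) : MDifferentiableAt 𝓘(ℝ, E) 𝓘(ℝ, E) (fun x : G => g * x) x :=
    (contMDiff_mul_left (n := 1)).mdifferentiable (by simp) _
  intro t ht
  refine ((hd g (γ t)).hasMFDerivAt.comp_hasMFDerivWithinAt t (h t ht)).congr_mfderiv ?_
  apply ContinuousLinearMap.ext_ring
  have e : (fun x : G => g * γ t * x) = (fun x => g * x) ∘ (fun x => γ t * x) := by
    ext; simp [mul_assoc]
  let A : E →L[ℝ] E := mfderiv 𝓘(ℝ, E) 𝓘(ℝ, E) (fun x : G => g * x) (γ t)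
  have hA : HasMFDerivAt 𝓘(ℝ, E) 𝓘(ℝ, E) (fun x : G => g * x) (γ t * 1) A := by
    rw [mul_one]
    exact (hd g (γ t)).hasMFDerivAt
  have h2 : leftDifferential ℝ E (g * γ t) = A ∘L leftDifferential ℝ E (γ t) := by
    have := hA.comp (1 : G) (hasMFDerivAt_mul_left_one (𝕜 := ℝ) (γ t))
    rw [← e] at this
    exact this.mfderiv
  change A ((1 : ℝ) • leftDifferential ℝ E (γ t) v) = (1 : ℝ) • leftDifferential ℝ E (g * γ t) v
  rw [one_smul, one_smul, h2]
  rfl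

/-- A local integral curve at `1`, defined for times in `(-ε, ε)`, is carried by left translations
to every point with the same `ε`, so the left-invariant field is complete. Uniqueness of integral
curves, applied to a time shift and to a left translate, makes the global curve through `1` a
homomorphism. -/
theorem exists_hom_hasMFDerivAt (v : E) : ∃ γ : ℝ → G, (∀ s t, γ (s + t) = γ s * γ t) ∧
    HasMFDerivAt 𝓘(ℝ, ℝ) 𝓘(ℝ, E) γ 0 ((1 : ℝ →L[ℝ] ℝ).smulRight v) := by
  have : IsManifold 𝓘(ℝ, E) 1 G := IsManifold.of_le (n := 3) (by norm_num)
  have : LieGroup 𝓘(ℝ, E) 1 G := LieGroup.of_le (n := 3) (by norm_num)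
  have hv := contMDiff_mulInvariantVectorField_one (G := G) v
  obtain ⟨γ₀, h0, h1⟩ := exists_isMIntegralCurveAt_of_contMDiffAt_boundaryless (t₀ := 0) (hv
      (1 : G))
  rw [isMIntegralCurveAt_iff'] at h1
  obtain ⟨ε, hε, h1⟩ := h1
  rw [Real.ball_eq_Ioo, zero_sub, zero_add] at h1
  obtain ⟨γ, hγ0, hγ⟩ := exists_isMIntegralCurve_of_isMIntegralCurveOn hv hε
    (fun x => ⟨fun t => x * γ₀ t, by simp [h0], h1.mul_left_invariant x⟩) 1
  refine ⟨γ, fun s t => ?_, ?_⟩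
  · have a := hγ.comp_add s
    have b := isMIntegralCurve_iff_isMIntegralCurveOn.2
        ((isMIntegralCurve_iff_isMIntegralCurveOn.1 hγ).mul_left_invariant (γ s))
    have := isMIntegralCurve_Ioo_eq_of_contMDiff_boundaryless (t₀ := 0) hv a b (by simp [hγ0])
    simpa [add_comm] using congrFun this t
  · have := hγ 0
    refine this.congr_mfderiv ?_
    apply ContinuousLinearMap.ext_ring
    change (1 : ℝ) • leftDifferential ℝ E (γ 0) v = (1 : ℝ) • v
    rw [hγ0, leftDifferential_one]
    rfl
end

/-! ### Groups without nonconstant holomorphic functions: centrality and the exponential map -/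

section
variable {E : Type} [NormedAddCommGroup E] [NormedSpace ℂ E]
  {G : Type} [TopologicalSpace G] [ChartedSpace E G] [Group G] [LieGroup 𝓘(ℂ, E) ω G]

/-- The adjoint representation of a complex Lie group without nonconstant holomorphic functions is
trivial. -/
theorem HolomorphicConstant.hasMFDerivAt_conj [FiniteDimensional ℂ E]
    (hG : HolomorphicConstant E G) (a : G) :
    HasMFDerivAt 𝓘(ℂ, E) 𝓘(ℂ, E) (fun x : G => a * x * a⁻¹) 1 (ContinuousLinearMap.id ℂ E) := by
  have : LieGroup 𝓘(ℂ, E) 1 G := LieGroup.of_le (n := ω) (by simp)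
  have : IsManifold 𝓘(ℂ, E) 1 G := IsManifold.of_le (n := ω) (by simp)
  let A : G → E →L[ℂ] E := fun a => mfderiv 𝓘(ℂ, E) 𝓘(ℂ, E) (fun x : G => a * x * a⁻¹) 1
  have hA : ∀ a : G, HasMFDerivAt 𝓘(ℂ, E) 𝓘(ℂ, E) (fun x : G => a * x * a⁻¹) 1 (A a) := fun a => by
    have : ContMDiff 𝓘(ℂ, E) 𝓘(ℂ, E) 1 (fun x : G => a * x * a⁻¹) :=
      (contMDiff_const.mul contMDiff_id).mul contMDiff_const
    exact (this.mdifferentiable (by simp) 1).hasMFDerivAt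
  have hs : ContMDiff 𝓘(ℂ, E) 𝓘(ℂ, E →L[ℂ] E) 1 A := by
    intro a₀
    have h1 : ContMDiff (𝓘(ℂ, E).prod 𝓘(ℂ, E)) 𝓘(ℂ, E) ω
        (Function.uncurry fun a x : G => a * x * a⁻¹) :=
      (contMDiff_fst.mul contMDiff_snd).mul contMDiff_fst.inv
    have h2 := ContMDiffAt.mfderiv (fun a x : G => a * x * a⁻¹) (fun _ : G => (1 : G)) (x₀ := a₀)
      (h1 _) (contMDiffAt_const (n := 1) (I := 𝓘(ℂ, E))) (by simp)
    -- Conjugations fix `1`, so all these differentials act on one tangent space, and the coordinate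
    -- form of the parametrized differential is `A` itself.
    have e : (fun a : G => a * 1 * a⁻¹) = fun _ => 1 := by ext; simp
    rw [e] at h2
    refine h2.congr_of_eventuallyEq (Filter.Eventually.of_forall fun a => ?_)
    have h3 := inTangentCoordinates_eq (I := 𝓘(ℂ, E)) (I' := 𝓘(ℂ, E)) (fun _ : G => (1 : G))
      (fun _ : G => (1 : G)) A (x₀ := a₀) (x := a) (mem_chart_source E 1) (mem_chart_source E 1)
    refine Eq.trans ?_ h3.symm
    ext v
    simp only [ContinuousLinearMap.comp_apply]
    rw [(tangentBundleCore 𝓘(ℂ, E) G).coordChange_self _ _ (by simp),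
      (tangentBundleCore 𝓘(ℂ, E) G).coordChange_self _ _ (by simp)]
  have h1 : A 1 = ContinuousLinearMap.id ℂ E := by
    have e : (fun x : G => 1 * x * 1⁻¹) = id := by ext; simp
    simp only [A]
    rw [e, mfderiv_id]
    rfl
  have : A a = ContinuousLinearMap.id ℂ E := by
    ext v
    by_contra hne
    -- Each matrix coefficient `b ↦ l (A b v)` is a holomorphic function on the group, so its values
    -- at `a` and at `1` agree.
    obtain ⟨l, hl⟩ := SeparatingDual.exists_ne_zero (R := ℂ) (sub_ne_zero.2 hne)
    have hd : MDifferentiable 𝓘(ℂ, E) 𝓘(ℂ, ℂ) (fun b => l (A b v)) := fun b =>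
      ((l.comp (ContinuousLinearMap.apply ℂ E v)).differentiableAt.mdifferentiableAt).comp b
        (hs.mdifferentiable (by simp) b)
    obtain ⟨c, hc⟩ := hG _ hd
    apply hl
    rw [map_sub, hc, ← hc 1, h1, sub_self]
  exact this ▸ hA a

/-- Since the adjoint representation is trivial, conjugating `γ` by `a` gives a one-parameter
subgroup with the same velocity, which is therefore `γ`. -/
theorem HolomorphicConstant.commute [FiniteDimensional ℂ E] [T2Space G]
    (hG : HolomorphicConstant E G) {γ : ℝ → G} {v : E}
    (hγ : ∀ s t, γ (s + t) = γ s * γ t)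
    (h : HasMFDerivAt 𝓘(ℝ, ℝ) 𝓘(ℝ, E) γ 0 ((1 : ℝ →L[ℝ] ℝ).smulRight v)) (a : G) (t : ℝ) :
    a * γ t = γ t * a := by
  have : LieGroup 𝓘(ℂ, E) 3 G := LieGroup.of_le (n := ω) (by simp)
  have : LieGroup 𝓘(ℝ, E) 3 G := LieGroup.complexToReal
  have : HasMFDerivAt 𝓘(ℝ, ℝ) 𝓘(ℝ, E) (fun t => a * γ t * a⁻¹) 0 ((1 : ℝ →L[ℝ] ℝ).smulRight v) := by
    have h1 : HasMFDerivAt 𝓘(ℝ, E) 𝓘(ℝ, E) (fun x : G => a * x * a⁻¹) (γ 0)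
        ((ContinuousLinearMap.id ℂ E).restrictScalars ℝ) := by
      rw [show γ 0 = 1 by simpa using hγ 0 0]
      exact (hG.hasMFDerivAt_conj a).complexToReal
    exact h1.comp 0 h
  have := congrFun (hom_eq_of_hasMFDerivAt (fun s t => by simp [hγ]) hγ this h) t
  exact mul_inv_eq_iff_eq_mul.1 this

/-- `p` is a holomorphic homomorphism from a vector space onto a central subgroup of `G`, with
derivative `L` at the origin. -/
structure IsCentralHom {F : Type} [NormedAddCommGroup F] [NormedSpace ℂ F] (p : F → G)
    (L : F →L[ℂ] E) : Prop where
  map_add : ∀ x y, p (x + y) = p x * p y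
  central : ∀ a x, a * p x = p x * a
  contMDiff : ContMDiff 𝓘(ℂ, F) 𝓘(ℂ, E) ω p
  hasMFDerivAt : HasMFDerivAt 𝓘(ℂ, F) 𝓘(ℂ, E) p 0 L

variable {F : Type} [NormedAddCommGroup F] [NormedSpace ℂ F]

omit [LieGroup 𝓘(ℂ, E) ω G] in
theorem IsCentralHom.map_zero {p : F → G} {L : F →L[ℂ] E} (h : IsCentralHom p L) : p 0 = 1 := by
  simpa using h.map_add 0 0

theorem IsCentralHom.mul {p q : F → G} {L L' : F →L[ℂ] E} (hp : IsCentralHom p L)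
    (hq : IsCentralHom q L') : IsCentralHom (fun x => p x * q x) (L + L') where
  map_add x y := by
    rw [hp.map_add, hq.map_add, mul_assoc, mul_assoc, ← mul_assoc (p y), ← hp.central (q x),
      mul_assoc]
  central a x := by
    rw [← mul_assoc, hp.central, mul_assoc, hq.central, mul_assoc]
  contMDiff := hp.contMDiff.mul hq.contMDiff
  hasMFDerivAt := by
    have : LieGroup 𝓘(ℂ, E) 1 G := LieGroup.of_le (n := ω) (by simp)
    exact hp.hasMFDerivAt.mul_of_eq_one hq.hasMFDerivAt hp.map_zero hq.map_zero

omit [LieGroup 𝓘(ℂ, E) ω G] in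
theorem isCentralHom_zero : IsCentralHom (fun _ : F => (1 : G)) (0 : F →L[ℂ] E) where
  map_add _ _ := (mul_one _).symm
  central _ _ := by simp
  contMDiff := contMDiff_const
  hasMFDerivAt := hasMFDerivAt_const _ _

omit [LieGroup 𝓘(ℂ, E) ω G] in
theorem IsCentralHom.comp {F' : Type} [NormedAddCommGroup F'] [NormedSpace ℂ F'] {p : F → G}
    {L : F →L[ℂ] E} (hp : IsCentralHom p L) (l : F' →L[ℂ] F) :
    IsCentralHom (fun x => p (l x)) (L ∘L l) where
  map_add x y := by rw [_root_.map_add, hp.map_add]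
  central a x := hp.central a _
  contMDiff := hp.contMDiff.comp l.contDiff.contMDiff
  hasMFDerivAt := by
    have h : HasMFDerivAt 𝓘(ℂ, F) 𝓘(ℂ, E) p (l 0) L := by
      rw [_root_.map_zero]
      exact hp.hasMFDerivAt
    exact h.comp 0 l.hasFDerivAt.hasMFDerivAt

/-- In a chart this is the analyticity of holomorphic functions of one complex variable. -/
theorem contMDiff_of_mdifferentiable_complex [CompleteSpace E] {f : ℂ → G}
    (hf : MDifferentiable 𝓘(ℂ, ℂ) 𝓘(ℂ, E) f) : ContMDiff 𝓘(ℂ, ℂ) 𝓘(ℂ, E) ω f := by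
  have : LieGroup 𝓘(ℂ, E) 1 G := LieGroup.of_le (n := ω) (by simp)
  have : IsManifold 𝓘(ℂ, E) 1 G := IsManifold.of_le (n := ω) (by simp)
  intro z
  refine ⟨(hf z).1, ?_⟩
  have ho : f ⁻¹' (extChartAt 𝓘(ℂ, E) (f z)).source ∈ nhds z :=
    (hf z).continuousAt.preimage_mem_nhds (extChartAt_source_mem_nhds _)
  have hd : ∀ᶠ w in nhds z, DifferentiableAt ℂ (fun w => extChartAt 𝓘(ℂ, E) (f z) (f w)) w := by
    filter_upwards [ho] with w hw
    rw [← mdifferentiableAt_iff_differentiableAt]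
    exact (mdifferentiableAt_extChartAt (by simpa using hw)).comp w (hf w)
  have : AnalyticAt ℂ (fun w => extChartAt 𝓘(ℂ, E) (f z) (f w)) z :=
    Complex.analyticAt_iff_eventually_differentiableAt.2 hd
  exact this.contDiffAt.contDiffWithinAt

/-- The homomorphism is `x + iy ↦ γ x * β y`, where `γ` and `β` are the one-parameter subgroups of
`v` and `iv`; it is multiplicative because these are central. Its real differential at the origin is
complex linear, and translation spreads this to every point, so it is holomorphic. -/
theorem HolomorphicConstant.exists_isCentralHom_smulRight [FiniteDimensional ℂ E] [T2Space G]
    (hG : HolomorphicConstant E G) (v : E) :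
    ∃ p : ℂ → G, IsCentralHom p ((1 : ℂ →L[ℂ] ℂ).smulRight v) := by
  have := FiniteDimensional.complete ℂ E
  have : LieGroup 𝓘(ℂ, E) 3 G := LieGroup.of_le (n := ω) (by simp)
  have : LieGroup 𝓘(ℂ, E) 1 G := LieGroup.of_le (n := ω) (by simp)
  have : LieGroup 𝓘(ℝ, E) 3 G := LieGroup.complexToReal
  have : LieGroup 𝓘(ℝ, E) 1 G := LieGroup.complexToReal
  obtain ⟨γ, hγ, hγ'⟩ := exists_hom_hasMFDerivAt (G := G) v
  obtain ⟨β, hβ, hβ'⟩ := exists_hom_hasMFDerivAt (G := G) (Complex.I • v)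
  let p : ℂ → G := fun z => γ z.re * β z.im
  have cγ := hG.commute hγ hγ'
  have cβ := hG.commute hβ hβ'
  have hp : ∀ x y, p (x + y) = p x * p y := fun x y => by
    simp only [p, Complex.add_re, Complex.add_im, hγ, hβ]
    rw [mul_assoc, mul_assoc, ← mul_assoc (γ y.re), ← cγ (β x.im), mul_assoc]
  have hre : HasMFDerivAt 𝓘(ℝ, ℂ) 𝓘(ℝ, E) (fun z : ℂ => γ z.re) 0
      (((1 : ℝ →L[ℝ] ℝ).smulRight v) ∘L Complex.reCLM) :=
    HasMFDerivAt.comp (f := Complex.reCLM) (g := γ) (0 : ℂ) (by simpa using hγ')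
      Complex.reCLM.hasFDerivAt.hasMFDerivAt
  have him : HasMFDerivAt 𝓘(ℝ, ℂ) 𝓘(ℝ, E) (fun z : ℂ => β z.im) 0
      (((1 : ℝ →L[ℝ] ℝ).smulRight (Complex.I • v)) ∘L Complex.imCLM) :=
    HasMFDerivAt.comp (f := Complex.imCLM) (g := β) (0 : ℂ) (by simpa using hβ')
      Complex.imCLM.hasFDerivAt.hasMFDerivAt
  have hr := hre.mul_of_eq_one him (by simpa using hγ 0 0) (by simpa using hβ 0 0)
  have hc : HasMFDerivAt 𝓘(ℂ, ℂ) 𝓘(ℂ, E) p 0 ((1 : ℂ →L[ℂ] ℂ).smulRight v) := by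
    apply HasMFDerivAt.realToComplex
    refine hr.congr_mfderiv ?_
    apply ContinuousLinearMap.ext
    intro (z : ℂ)
    change z.re • v + z.im • Complex.I • v = z • v
    conv_rhs => rw [← Complex.re_add_im z]
    rw [add_smul, mul_smul]
    rfl
  refine ⟨p, hp, fun a z => ?_, contMDiff_of_mdifferentiable_complex fun z =>
    (hc.translate hp z).mdifferentiableAt, hc⟩
  simp only [p]
  rw [← mul_assoc, cγ, mul_assoc, cβ, mul_assoc]

/-- The central homomorphisms along the lines of a basis are composed with the coordinates and
multiplied. Differentials add, and `∑ bᵢ* ⊗ bᵢ` is the identity. -/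
theorem HolomorphicConstant.exists_isCentralHom_id [FiniteDimensional ℂ E] [T2Space G]
    (hG : HolomorphicConstant E G) :
    ∃ p : E → G, IsCentralHom p (ContinuousLinearMap.id ℂ E) := by
  let b := Module.finBasis ℂ E
  let c : Fin _ → E →L[ℂ] ℂ := fun i => (b.coord i).toContinuousLinearMap
  have key : ∀ s : Finset (Fin (Module.finrank ℂ E)),
      ∃ p : E → G, IsCentralHom p (∑ i ∈ s, (c i).smulRight (b i)) := by
    intro s
    induction s using Finset.induction_on with
    | empty => exact ⟨_, isCentralHom_zero⟩
    | insert i s hi ih =>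
      obtain ⟨p, hp⟩ := ih
      obtain ⟨q, hq⟩ := hG.exists_isCentralHom_smulRight (b i)
      rw [Finset.sum_insert hi]
      exact ⟨_, (hq.comp (c i)).mul hp⟩
  obtain ⟨p, hp⟩ := key Finset.univ
  have e : ∑ i, (c i).smulRight (b i) = ContinuousLinearMap.id ℂ E := by
    ext v
    simp [c, sum_apply, b.sum_repr]
  exact ⟨p, e ▸ hp⟩
end

/-! ### The exponential map as a covering homomorphism -/

section
variable {E : Type} [NormedAddCommGroup E] [NormedSpace ℂ E]
  {G : Type} [TopologicalSpace G] [ChartedSpace E G] [Group G]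

/-- `p` is the exponential map of the commutative complex Lie group `G`. -/
abbrev IsExp (p : E → G) : Prop := IsCentralHom p (ContinuousLinearMap.id ℂ E)

namespace IsExp

theorem map_sub {p : E → G} (hp : IsExp p) (x y : E) : p (x - y) = p x * (p y)⁻¹ := by
  rw [eq_mul_inv_iff_mul_eq, ← hp.map_add, sub_add_cancel]

theorem map_neg {p : E → G} (hp : IsExp p) (x : E) : p (-x) = (p x)⁻¹ := by
  rw [eq_inv_iff_mul_eq_one, ← hp.map_add, neg_add_cancel, hp.map_zero]

/-- The kernel of the exponential map. -/
def kernel {p : E → G} (hp : IsExp p) : AddSubgroup E where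
  carrier := {x | p x = 1}
  zero_mem' := hp.map_zero
  add_mem' {x y} hx hy := by
    simp only [Set.mem_ofPred_eq] at *
    rw [hp.map_add, hx, hy, one_mul]
  neg_mem' {x} hx := by
    simp only [Set.mem_ofPred_eq] at *
    rw [hp.map_neg, hx, inv_one]

theorem mem_kernel {p : E → G} (hp : IsExp p) {x : E} : x ∈ hp.kernel ↔ p x = 1 := Iff.rfl

variable [LieGroup 𝓘(ℂ, E) ω G] [FiniteDimensional ℂ E]

omit [LieGroup 𝓘(ℂ, E) ω G] in
/-- The logarithm: a local inverse of the exponential map. -/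
theorem exists_log {p : E → G} (hp : IsExp p) : ∃ l : G → E, ContMDiffAt 𝓘(ℂ, E) 𝓘(ℂ, E) ω l 1 ∧
    l 1 = 0 ∧ (∀ᶠ g in nhds 1, p (l g) = g) ∧ ∀ᶠ x in nhds 0, l (p x) = x := by
  have := FiniteDimensional.complete ℂ E
  have h0 := hp.map_zero
  let φ := chartAt E (p 0)
  let f : E → E := fun x => φ (p x)
  have hf : ContDiffAt ℂ ω f 0 := (hp.contMDiff 0).2.contDiffAt (by simp)
  have hf' : HasFDerivAt f ((ContinuousLinearEquiv.refl ℂ E : E ≃L[ℂ] E) : E →L[ℂ] E) 0 :=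
    hp.hasMFDerivAt.2.hasFDerivAt (by simp)
  let e := hf.toOpenPartialHomeomorph f hf' (by simp)
  have he : ∀ x, e x = f x := fun x => rfl
  have he0 : (0 : E) ∈ e.source := hf.mem_toOpenPartialHomeomorph_source hf' (by simp)
  have hsymm : ContDiffAt ℂ ω e.symm (f 0) := hf.to_localInverse hf' (by simp)
  have hφ : ContMDiffAt 𝓘(ℂ, E) 𝓘(ℂ, E) ω φ (p 0) := contMDiffAt_extChartAt
  refine ⟨fun g => e.symm (φ g), ?_, ?_, ?_, ?_⟩
  · rw [← h0]
    exact hsymm.contMDiffAt.comp (p 0) hφ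
  · rw [← h0]
    exact e.left_inv he0
  · have h1 : ∀ᶠ g in nhds (p 0), φ g ∈ e.target :=
      hφ.continuousAt.preimage_mem_nhds (e.open_target.mem_nhds (e.map_source he0))
    have h2 : ∀ᶠ g in nhds (p 0), g ∈ φ.source := φ.open_source.mem_nhds (mem_chart_source _ _)
    have h3 : ContinuousAt (fun g => p (e.symm (φ g))) (p 0) := by
      refine ContinuousAt.comp (g := p) hp.contMDiff.continuous.continuousAt ?_
      exact ContinuousAt.comp (g := e.symm) hsymm.continuousAt hφ.continuousAt
    have h4 : ∀ᶠ g in nhds (p 0), p (e.symm (φ g)) ∈ φ.source := by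
      refine h3.preimage_mem_nhds (φ.open_source.mem_nhds ?_)
      rw [show e.symm (φ (p 0)) = 0 from e.left_inv he0]
      exact mem_chart_source _ _
    rw [← h0]
    filter_upwards [h1, h2, h4] with g h1 h2 h4
    exact φ.injOn h4 h2 (e.right_inv h1)
  · filter_upwards [e.open_source.mem_nhds he0] with x hx
    exact e.left_inv hx

/-- The logarithm at `1`, translated to `p x`, provides preimages close to `x`. -/
theorem image_mem_nhds {p : E → G} (hp : IsExp p) {x : E} {U : Set E} (hU : U ∈ nhds x) :
    p '' U ∈ nhds (p x) := by
  have : ContMDiffMul 𝓘(ℂ, E) ω G := inferInstance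
  obtain ⟨l, hl, hl0, hl1, -⟩ := hp.exists_log
  have hc : ContinuousAt (fun g => x + l ((p x)⁻¹ * g)) (p x) := by
    refine continuousAt_const.add (ContinuousAt.comp (g := l) (f := fun g => (p x)⁻¹ * g) ?_ ?_)
    · rw [inv_mul_cancel]
      exact hl.continuousAt
    · exact (contMDiff_mul_left (I := 𝓘(ℂ, E)) (n := ω)).continuous.continuousAt
  have hm : ContinuousAt (fun g => (p x)⁻¹ * g) (p x) :=
    (contMDiff_mul_left (I := 𝓘(ℂ, E)) (n := ω)).continuous.continuousAt
  have h1 : ∀ᶠ g in nhds (p x), x + l ((p x)⁻¹ * g) ∈ U := hc.preimage_mem_nhds (by simpa [hl0])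
  have h2 : ∀ᶠ g in nhds (p x), p (l ((p x)⁻¹ * g)) = (p x)⁻¹ * g :=
    hm.eventually (by simpa using hl1)
  filter_upwards [h1, h2] with g h1 h2
  exact ⟨_, h1, by rw [hp.map_add, h2, mul_inv_cancel_left]⟩

theorem isOpenMap {p : E → G} (hp : IsExp p) : IsOpenMap p := by
  intro U hU
  rw [isOpen_iff_mem_nhds]
  rintro _ ⟨x, hx, rfl⟩
  exact hp.image_mem_nhds (hU.mem_nhds hx)

/-- The image is an open subgroup, hence also closed, of a connected group. -/
theorem surjective [ConnectedSpace G] {p : E → G} (hp : IsExp p) : Function.Surjective p := by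
  have : IsTopologicalGroup G := topologicalGroup_of_lieGroup 𝓘(ℂ, E) ω
  let S : Subgroup G :=
    { carrier := Set.range p
      one_mem' := ⟨0, hp.map_zero⟩
      mul_mem' := by
        rintro _ _ ⟨x, rfl⟩ ⟨y, rfl⟩
        exact ⟨x + y, hp.map_add x y⟩
      inv_mem' := by
        rintro _ ⟨x, rfl⟩
        exact ⟨-x, hp.map_neg x⟩ }
  have ho : IsOpen (S : Set G) := hp.isOpenMap.isOpen_range
  have hcl : IsClopen (S : Set G) := ⟨S.isClosed_of_isOpen ho, ho⟩
  exact Set.range_eq_univ.1 (hcl.eq_univ ⟨1, S.one_mem⟩)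

theorem mul_comm [ConnectedSpace G] {p : E → G} (hp : IsExp p) (a b : G) : a * b = b * a := by
  obtain ⟨x, rfl⟩ := hp.surjective b
  exact hp.central a x

omit [LieGroup 𝓘(ℂ, E) ω G] in
theorem exists_ball_kernel {p : E → G} (hp : IsExp p) : ∃ U ∈ nhds (0 : E), ∀ x ∈ U,
    x ∈ hp.kernel → x = 0 := by
  obtain ⟨l, hl, hl0, -, hl1⟩ := hp.exists_log
  refine ⟨_, hl1, fun x hx hk => ?_⟩
  rw [← hx, hp.mem_kernel.1 hk, hl0]

omit [LieGroup 𝓘(ℂ, E) ω G] in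
theorem discreteTopology {p : E → G} (hp : IsExp p) : DiscreteTopology hp.kernel := by
  obtain ⟨U, hU, h⟩ := hp.exists_ball_kernel
  obtain ⟨V, hVU, hV, h0⟩ := mem_nhds_iff.1 hU
  rw [discreteTopology_iff_isOpen_singleton_zero]
  convert hV.preimage (continuous_subtype_val (p := (· ∈ hp.kernel)))
  ext x
  refine ⟨?_, fun hx => Subtype.ext (h x (hVU hx) x.2)⟩
  rintro rfl
  exact h0

/-- An open surjective homomorphism with discrete kernel is the quotient by a properly discontinuous
group of translations. -/
theorem isCoveringMap [ConnectedSpace G] {p : E → G} (hp : IsExp p) : IsCoveringMap p := by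
  have hq : Topology.IsQuotientMap p :=
    (hp.isOpenMap.isQuotientMap hp.contMDiff.continuous hp.surjective)
  refine (hq.isAddQuotientCoveringMap_of_addSubgroup hp.kernel
    ⟨hp.discreteTopology⟩ fun {x y} => ?_).isCoveringMap
  rw [← sub_eq_add_neg, hp.mem_kernel, hp.map_sub, mul_inv_eq_one, eq_comm]

omit [FiniteDimensional ℂ E] in
-- On each line through the origin both maps restrict to one-parameter subgroups with the same
-- velocity.
theorem hom_ext [T2Space G] {F : Type} [NormedAddCommGroup F] [NormedSpace ℝ F] {p q : F → G}
    (hp : ∀ x y, p (x + y) = p x * p y) (hq : ∀ x y, q (x + y) = q x * q y) {L : F →L[ℝ] E}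
    (hp' : HasMFDerivAt 𝓘(ℝ, F) 𝓘(ℝ, E) p 0 L) (hq' : HasMFDerivAt 𝓘(ℝ, F) 𝓘(ℝ, E) q 0 L) :
    p = q := by
  have : LieGroup 𝓘(ℂ, E) 3 G := LieGroup.of_le (n := ω) (by simp)
  have : LieGroup 𝓘(ℝ, E) 3 G := LieGroup.complexToReal
  ext v
  have key : ∀ {r : F → G}, HasMFDerivAt 𝓘(ℝ, F) 𝓘(ℝ, E) r 0 L →
      HasMFDerivAt 𝓘(ℝ, ℝ) 𝓘(ℝ, E) (fun t : ℝ => r (t • v)) 0 ((1 : ℝ →L[ℝ] ℝ).smulRight (L v)) :=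
          by
    intro r hr
    have h1 : HasMFDerivAt 𝓘(ℝ, F) 𝓘(ℝ, E) r ((1 : ℝ →L[ℝ] ℝ).smulRight v (0 : ℝ)) L := by
      have h0 : ((1 : ℝ →L[ℝ] ℝ).smulRight v (0 : ℝ)) = 0 := map_zero _
      rw [h0]
      exact hr
    have := h1.comp (0 : ℝ) ((1 : ℝ →L[ℝ] ℝ).smulRight v).hasFDerivAt.hasMFDerivAt
    refine this.congr_mfderiv ?_
    apply ContinuousLinearMap.ext_ring
    change L ((1 : ℝ) • v) = (1 : ℝ) • L v
    rw [map_smul]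
  have := congrFun (hom_eq_of_hasMFDerivAt (fun s t => by rw [add_smul, hp])
    (fun s t => by rw [add_smul, hq]) (key hp') (key hq')) 1
  simpa using this

omit [FiniteDimensional ℂ E] in
theorem unique [T2Space G] {p q : E → G} (hp : IsExp p) (hq : IsExp q) : p = q :=
  hom_ext hp.map_add hq.map_add hp.hasMFDerivAt.complexToReal hq.hasMFDerivAt.complexToReal

/-- Smooth maps from a real vector space to `G` lift through the exponential map. -/
theorem exists_lift [ConnectedSpace G] {p : E → G} (hp : IsExp p) {F : Type} [NormedAddCommGroup F]
    [NormedSpace ℝ F]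
    {f : F → G} (hf : ContMDiff 𝓘(ℝ, F) 𝓘(ℝ, E) ∞ f) :
    ∃ g : F → E, ContDiff ℝ ∞ g ∧ ∀ x, p (g x) = f x := by
  have : IsTopologicalGroup G := topologicalGroup_of_lieGroup 𝓘(ℂ, E) ω
  have : LieGroup 𝓘(ℂ, E) ∞ G := LieGroup.of_le (n := ω) (by simp)
  have : LieGroup 𝓘(ℝ, E) ∞ G := LieGroup.complexToReal
  obtain ⟨e₀, he₀⟩ := hp.surjective (f 0)
  obtain ⟨g, ⟨-, hg⟩, -⟩ := hp.isCoveringMap.existsUnique_continuousMap_lifts ⟨f,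
      hf.continuous⟩ 0 e₀ he₀
  have hg' : ∀ x, p (g x) = f x := fun x => congrFun hg x
  refine ⟨g, ?_, hg'⟩
  obtain ⟨l, hl, hl0, -, hl1⟩ := hp.exists_log
  rw [contDiff_iff_contDiffAt]
  intro x
  -- The lift supplied by covering theory is only continuous. Near `x` it is a translate of the
  -- smooth logarithm of `(f x)⁻¹ * f y`.
  have h1 : ∀ᶠ y in nhds x, g y = g x + l ((f x)⁻¹ * f y) := by
    have : Filter.Tendsto (fun y => g y - g x) (nhds x) (nhds 0) := by
      have : Continuous fun y => g y - g x := by fun_prop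
      simpa using this.tendsto x
    filter_upwards [this.eventually hl1] with y hy
    rw [hp.map_sub, hg', hg', ← hp.mul_comm] at hy
    rw [hy]
    abel
  refine ContDiffAt.congr_of_eventuallyEq ?_ h1
  refine contDiffAt_const.add ?_
  rw [← contMDiffAt_iff_contDiffAt]
  have h2 : ContMDiffAt 𝓘(ℝ, F) 𝓘(ℝ, E) ∞ (fun y => (f x)⁻¹ * f y) x := contMDiffAt_const.mul (hf x)
  refine ContMDiffAt.comp x (g := l) ?_ h2
  simpa using hl.complexToReal.of_le (by simp)

omit [LieGroup 𝓘(ℂ, E) ω G] [FiniteDimensional ℂ E] in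
theorem hasMFDerivAt_comp {p : E → G} (hp : IsExp p) {F : Type} [NormedAddCommGroup F]
    [NormedSpace ℝ F]
    {g : F → E} {g' : F →L[ℝ] E} {x : F} (hg : HasFDerivAt g g' x) (h0 : g x = 0) :
    HasMFDerivAt 𝓘(ℝ, F) 𝓘(ℝ, E) (fun y => p (g y)) x g' := by
  have := hp.hasMFDerivAt.complexToReal
  rw [← h0] at this
  exact this.comp x hg.hasMFDerivAt

omit [LieGroup 𝓘(ℂ, E) ω G] [FiniteDimensional ℂ E] in
theorem leftVelocity_comp {p : E → G} (hp : IsExp p) {g : ℝ → E} {t : ℝ}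
    (hg : DifferentiableAt ℝ g t) :
    leftVelocity E (fun s => p (g s)) t = deriv g t := by
  have h : HasFDerivAt (fun s => g s - g t) (fderiv ℝ g t) t := hg.hasFDerivAt.sub_const _
  have := (hp.hasMFDerivAt_comp h (sub_self _)).mfderiv
  have e : (fun s => (p (g t))⁻¹ * p (g s)) = fun s => p (g s - g t) := by
    ext s
    rw [hp.map_sub, ← hp.central, ← hp.map_neg, hp.central]
  rw [leftVelocity, e]
  exact (DFunLike.congr_fun this (1 : ℝ))
end IsExp
end

/-! ### First variation of the action in a flat space -/

theorem hasDerivAt_zero_of_abs_le_sq {f : ℝ → ℝ} {C : ℝ} (h : ∀ s, |s| ≤ 1 → |f s| ≤ C * s ^ 2) :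
    HasDerivAt f 0 0 := by
  have h0 : f 0 = 0 := by simpa using h 0 (by simp)
  rw [hasDerivAt_iff_isLittleO_nhds_zero]
  simp only [zero_add, h0, sub_zero, smul_zero]
  have h1 : f =O[nhds 0] fun s : ℝ => s ^ 2 := by
    refine Asymptotics.IsBigO.of_bound C ?_
    filter_upwards [Metric.closedBall_mem_nhds (0 : ℝ) one_pos] with s hs
    have hs' : |s| ≤ 1 := by simpa using hs
    simpa [abs_of_nonneg (sq_nonneg s)] using h s hs'
  exact h1.trans_isLittleO (by simpa using (Asymptotics.isLittleO_pow_id (𝕜 := ℝ) one_lt_two))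

section
variable {E : Type} [NormedAddCommGroup E] [NormedSpace ℝ E]  [FiniteDimensional ℝ E]

theorem deriv_mem_submodule {W : Submodule ℝ E} {g : ℝ → E} {t : ℝ}
    (hg : DifferentiableAt ℝ g t) (h : ∀ s, g s ∈ W) : deriv g t ∈ W := by
  by_contra hn
  obtain ⟨l, hl, hW⟩ := Submodule.exists_le_ker_of_notMem hn
  apply hl
  have h1 := (l.toContinuousLinearMap.hasFDerivAt.comp_hasDerivAt t hg.hasDerivAt).deriv
  have h2 : (l.toContinuousLinearMap ∘ g) = fun _ => 0 := by
    ext s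
    exact LinearMap.mem_ker.1 (hW (h s))
  rw [h2, deriv_const] at h1
  exact h1.symm

theorem integral_bilin_deriv (B : LinearMap.BilinForm ℝ E) {g : ℝ → E} (hg : ContDiff ℝ ∞ g) (v : E)
    (a b : ℝ) : ∫ t in a..b, B v (deriv g t) = B v (g b - g a) := by
  have hc : Continuous (deriv g) := hg.continuous_deriv (by simp)
  have := (B v).toContinuousLinearMap.intervalIntegral_comp_comm (μ := MeasureTheory.volume)
    (hc.intervalIntegrable a b)
  change ∫ t in a..b, (B v).toContinuousLinearMap (deriv g t) = _
  rw [this, intervalIntegral.integral_deriv_eq_sub (fun t _ => (hg.differentiable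
      (by simp)).differentiableAt)
    (hc.intervalIntegrable a b)]
  rfl

theorem continuous_bilin (B : LinearMap.BilinForm ℝ E) {X : Type} [TopologicalSpace X]
    {f g : X → E} (hf : Continuous f)
    (hg : Continuous g) : Continuous fun x => B (f x) (g x) := by
  change Continuous fun x => B.toContinuousBilinearMap (f x) (g x)
  fun_prop

/-- First variation of the action of a straight line. -/
theorem hasDerivAt_action_line (B : LinearMap.BilinForm ℝ E) (hB : ∀ x y, B x y = B y x) (v : E)
    {g : ℝ × ℝ → E} (hg : ContDiff ℝ ∞ g) {a b : ℝ} (hab : a < b)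
    (h0 : ∀ t, deriv (fun t => g (0, t)) t = v)
    (ha : ∀ s, g (s, a) = g (0, a)) (hb : ∀ s, g (s, b) = g (0, b)) :
    HasDerivAt (fun s => ∫ t in a..b, B (deriv (fun t => g (s, t)) t) (deriv (fun t => g (s, t)) t))
      0 0 := by
  have hgs : ∀ s, ContDiff ℝ ∞ fun t => g (s, t) := fun s => hg.comp (by fun_prop)
  let w : ℝ × ℝ → E := fun x => fderiv ℝ g x (0, 1) - v
  have hw : ContDiff ℝ 1 w :=
    ((hg.fderiv_right (m := 1) (by norm_cast)).clm_apply contDiff_const).sub contDiff_const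
  have hd : ∀ s t, deriv (fun t => g (s, t)) t = v + w (s, t) := fun s t => by
    have h1 := (hg.differentiable (by simp) (s, t)).hasFDerivAt
    have h2 : HasDerivAt (fun t : ℝ => (s, t)) (0, 1) t := (hasDerivAt_const t s).prodMk
        (hasDerivAt_id t)
    have h3 : HasDerivAt (fun t => g (s, t)) (fderiv ℝ g (s, t) (0, 1)) t := h1.comp_hasDerivAt t h2
    rw [h3.deriv]
    simp [w]
  have hw0 : ∀ t, w (0, t) = 0 := fun t => by
    have := h0 t
    rw [hd] at this
    simpa using this
  have hline : g (0, b) - g (0, a) = (b - a) • v := by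
    have h3 := intervalIntegral.integral_deriv_eq_sub (f := fun t => g (0, t)) (a := a) (b := b)
      (fun t _ => ((hgs 0).differentiable (by simp)).differentiableAt)
      (((hgs 0).continuous_deriv (by simp)).intervalIntegrable a b)
    rw [← h3]
    simp [h0]
  -- The integrand is `2 B(v, v + w) - B(v, v) + B(w, w)`. The integral of the first term depends
  -- only on the endpoints, which are fixed, so only the quadratic term varies with `s`.
  have hform : ∀ s, ∫ t in a..b, B (deriv (fun t => g (s, t)) t) (deriv (fun t => g (s, t)) t) =
      (b - a) * B v v + ∫ t in a..b, B (w (s, t)) (w (s, t)) := fun s => by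
    have hcs : Continuous fun t => deriv (fun t => g (s, t)) t := (hgs s).continuous_deriv (by simp)
    have hcw : Continuous fun t => w (s, t) := hw.continuous.comp (by fun_prop)
    have e : ∀ t, B (deriv (fun t => g (s, t)) t) (deriv (fun t => g (s, t)) t) =
        2 * B v (deriv (fun t => g (s, t)) t) - B v v + B (w (s, t)) (w (s, t)) := fun t => by
      rw [hd]
      simp only [map_add, LinearMap.add_apply]
      rw [hB (w (s, t)) v]
      ring
    have c1 := continuous_bilin B (continuous_const (y := v)) hcs
    have c2 := continuous_bilin B hcw hcw
    simp only [e]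
    rw [intervalIntegral.integral_add, intervalIntegral.integral_sub,
        intervalIntegral.integral_const_mul,
      integral_bilin_deriv B (hgs s), ha, hb, hline, intervalIntegral.integral_const]
    · simp
      ring
    · exact (continuous_const.mul c1).intervalIntegrable _ _
    · exact intervalIntegrable_const
    · exact ((continuous_const.mul c1).sub continuous_const).intervalIntegrable _ _
    · exact c2.intervalIntegrable _ _
  simp only [hform]
  suffices HasDerivAt (fun s => ∫ t in a..b, B (w (s, t)) (w (s, t))) 0 0 by
    simpa using this.const_add ((b - a) * B v v)
  -- the remaining term is quadratic in the parameter
  obtain ⟨C, hC⟩ : ∃ C, ∀ x ∈ (Set.Icc (-1) 1 ×ˢ Set.Icc a b : Set (ℝ × ℝ)), ‖fderiv ℝ w x‖ ≤ C :=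
    (isCompact_Icc.prod isCompact_Icc).exists_bound_of_continuousOn
      (hw.continuous_fderiv (by simp)).continuousOn
  -- The mean value inequality, from `w = 0` at `s = 0` and a bound on the derivative over a compact
  -- rectangle; it makes the quadratic term `O(s ^ 2)`.
  have hwb : ∀ s, |s| ≤ 1 → ∀ t ∈ Set.Icc a b, ‖w (s, t)‖ ≤ C * |s| := fun s hs t ht => by
    have := ((convex_Icc (-1 : ℝ) 1).prod (convex_Icc a b)).norm_image_sub_le_of_norm_fderiv_le
      (f := w) (x := (0, t)) (y := (s, t)) (fun x _ => hw.differentiable (by simp) x) hC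
      ⟨by simp, ht⟩ ⟨abs_le.1 hs, ht⟩
    rw [hw0] at this
    simpa using this
  let B' := B.toContinuousBilinearMap
  refine hasDerivAt_zero_of_abs_le_sq (C := ‖B'‖ * C ^ 2 * |b - a|) fun s hs => ?_
  have := intervalIntegral.norm_integral_le_of_norm_le_const (a := a) (b := b) (C := ‖B'‖ *
      (C * |s|) * (C * |s|))
    (f := fun t => B (w (s, t)) (w (s, t))) fun t ht => by
    have ht' : t ∈ Set.Icc a b := by
      rw [Set.uIoc_of_le hab.le] at ht
      exact ⟨ht.1.le, ht.2⟩
    have h1 := hwb s hs t ht'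
    calc ‖B' (w (s, t)) (w (s, t))‖ ≤ ‖B'‖ * ‖w (s, t)‖ * ‖w (s, t)‖ := B'.le_opNorm₂ _ _
      _ ≤ _ := mul_le_mul (mul_le_mul_of_nonneg_left h1 (ContinuousLinearMap.opNorm_nonneg _)) h1
          (norm_nonneg _)
        (mul_nonneg (ContinuousLinearMap.opNorm_nonneg _) ((norm_nonneg _).trans h1))
  calc _ ≤ _ := this
    _ = _ := by rw [← sq_abs s]; ring

/-- A curve whose action is stationary under its straightening has the action of a line. -/
theorem integral_eq_of_hasDerivAt_action (B : LinearMap.BilinForm ℝ E) (hB : ∀ x y, B x y = B y x)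
    {g : ℝ → E} (hg : ContDiff ℝ ∞ g) {m : E} (hm : m = g 1 - g 0)
    (h : HasDerivAt (fun s : ℝ => ∫ t in (0 : ℝ)..1, B (deriv (fun t => g t + s •
        (g t - g 0 - t • m)) t)
      (deriv (fun t => g t + s • (g t - g 0 - t • m)) t)) 0 0) :
    ∫ t in (0 : ℝ)..1, B (deriv g t) (deriv g t) = B m m := by
  have hgc : Continuous (deriv g) := hg.continuous_deriv (by simp)
  have hd : ∀ s t : ℝ, deriv (fun t => g t + s • (g t - g 0 - t • m)) t =
      deriv g t + s • (deriv g t - m) := fun s t => by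
    have h1 := (hg.differentiable (by simp) t).hasDerivAt
    have h2 := ((hasDerivAt_id t).smul_const m)
    have h3 : HasDerivAt (fun t => g t + s • (g t - g 0 - t • m))
        (deriv g t + s • (deriv g t - (1 : ℝ) • m)) t :=
      h1.add (((h1.sub_const (g 0)).sub h2).const_smul s)
    rw [h3.deriv, one_smul]
  -- The action is a quadratic polynomial in `s`. Stationarity kills its linear coefficient, which
  -- says `∫ B(g', g') = ∫ B(m, g')`, and the right side is `B(m, m)`.
  have hq : ∀ s : ℝ, ∫ t in (0 : ℝ)..1, B (deriv (fun t => g t + s • (g t - g 0 - t • m)) t)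
      (deriv (fun t => g t + s • (g t - g 0 - t • m)) t) =
      (∫ t in (0 : ℝ)..1, B (deriv g t) (deriv g t)) +
      s * (2 * ∫ t in (0 : ℝ)..1, B (deriv g t) (deriv g t - m)) +
      s ^ 2 * ∫ t in (0 : ℝ)..1, B (deriv g t - m) (deriv g t - m) := fun s => by
    have hc' : Continuous fun t => deriv g t - m := by fun_prop
    have c1 := continuous_bilin B hgc hgc
    have c2 := continuous_bilin B hgc hc'
    have c3 := continuous_bilin B hc' hc'
    have e : ∀ t, B (deriv (fun t => g t + s • (g t - g 0 - t • m)) t)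
        (deriv (fun t => g t + s • (g t - g 0 - t • m)) t) = B (deriv g t) (deriv g t) +
        s * (2 * B (deriv g t) (deriv g t - m)) + s ^ 2 * B (deriv g t - m) (deriv g t - m) := by
      intro t
      rw [hd]
      generalize deriv g t - m = y
      simp only [map_add, LinearMap.add_apply, map_smul, LinearMap.smul_apply, smul_eq_mul]
      rw [hB y]
      ring
    simp only [e]
    rw [intervalIntegral.integral_add, intervalIntegral.integral_add,
        intervalIntegral.integral_const_mul,
      intervalIntegral.integral_const_mul, intervalIntegral.integral_const_mul]
    · exact c1.intervalIntegrable _ _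
    · exact (continuous_const.mul (continuous_const.mul c2)).intervalIntegrable _ _
    · exact (c1.add (continuous_const.mul (continuous_const.mul c2))).intervalIntegrable _ _
    · exact (continuous_const.mul c3).intervalIntegrable _ _
  simp only [hq] at h
  have h2 : ∀ a b c : ℝ, HasDerivAt (fun s : ℝ => a + s * b + s ^ 2 * c) b 0 := fun a b c => by
    have h : HasDerivAt (fun s : ℝ => a + s * b + s ^ 2 * c) (1 * b + (2 : ℕ) * (0 : ℝ) ^
        (2 - 1) * 1 * c) 0 :=
      (((hasDerivAt_id (0 : ℝ)).mul_const b).const_add a).add (((hasDerivAt_id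
          (0 : ℝ)).pow 2).mul_const c)
    simpa using h
  have h3 := h.unique (h2 _ _ _)
  have h4 : ∫ t in (0 : ℝ)..1, B (deriv g t) (deriv g t - m) = 0 := by linarith
  have h5 := integral_bilin_deriv B hg m 0 1
  rw [← hm] at h5
  have c1 := continuous_bilin B hgc hgc
  have c2 := continuous_bilin B (continuous_const (y := m)) hgc
  simp only [map_sub] at h4
  simp only [hB _ m] at h4
  rw [intervalIntegral.integral_sub (c1.intervalIntegrable _ _) (c2.intervalIntegrable _ _),
      h5] at h4
  linarith
end

/-! ### The maximal compact subgroup and its closed geodesics -/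

namespace IsExp
variable {E : Type} [NormedAddCommGroup E] [NormedSpace ℂ E]
  {G : Type} [TopologicalSpace G] [ChartedSpace E G] [Group G] {p : E → G}

/-- The real span of the kernel of the exponential map. -/
noncomputable def latticeSpan (hp : IsExp p) : Submodule ℝ E := Submodule.span ℝ (hp.kernel : Set E)

theorem mem_latticeSpan (hp : IsExp p) {x : E} (hx : x ∈ hp.kernel) : x ∈ hp.latticeSpan :=
  Submodule.subset_span hx

/-- The subgroup generated by the one-parameter groups through the kernel. -/
noncomputable def core (hp : IsExp p) : Subgroup G where
  carrier := p '' hp.latticeSpan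
  one_mem' := ⟨0, zero_mem _, hp.map_zero⟩
  mul_mem' := by
    rintro _ _ ⟨x, hx, rfl⟩ ⟨y, hy, rfl⟩
    exact ⟨x + y, add_mem hx hy, hp.map_add x y⟩
  inv_mem' := by
    rintro _ ⟨x, hx, rfl⟩
    exact ⟨-x, neg_mem hx, hp.map_neg x⟩

theorem apply_mem_core (hp : IsExp p) {x : E} : p x ∈ hp.core ↔ x ∈ hp.latticeSpan := by
  refine ⟨?_, fun h => ⟨x, h, rfl⟩⟩
  rintro ⟨y, hy, h⟩
  have : x - y ∈ hp.kernel := by rw [hp.mem_kernel, hp.map_sub, h, mul_inv_cancel]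
  simpa using add_mem (hp.mem_latticeSpan this) hy

theorem sum_smul_mem (hp : IsExp p) {ι : Type} [Fintype ι] {b : ι → E} (hb : ∀ i, b i ∈ hp.kernel)
    (n : ι → ℤ) : ∑ i, (n i : ℝ) • b i ∈ hp.kernel :=
  sum_mem fun i _ => by
    rw [Int.cast_smul_eq_zsmul]
    exact _root_.zsmul_mem (hb i) _

theorem apply_eq_of_sub_mem (hp : IsExp p) {x y : E} (h : x - y ∈ hp.kernel) : p x = p y := by
  rwa [hp.mem_kernel, hp.map_sub, mul_inv_eq_one] at h

theorem sub_mem_kernel (hp : IsExp p) {x y : E} : x - y ∈ hp.kernel ↔ p x = p y := by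
  rw [hp.mem_kernel, hp.map_sub, mul_inv_eq_one]

variable [LieGroup 𝓘(ℂ, E) ω G] [FiniteDimensional ℂ E]

omit [LieGroup 𝓘(ℂ, E) ω G] in
-- Taking fractional parts of coordinates, with respect to kernel elements spanning `latticeSpan`,
-- shows that the subgroup is the continuous image of a closed cube.
theorem isCompact_core (hp : IsExp p) : IsCompact (hp.core : Set G) := by
  have : FiniteDimensional ℝ E := FiniteDimensional.complexToReal E
  obtain ⟨b, hb, hspan, -⟩ := Submodule.exists_fun_fin_finrank_span_eq ℝ (hp.kernel : Set E)
  let f : (Fin _ → ℝ) → E := fun t => ∑ i, t i • b i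
  have hf : Continuous f := by fun_prop
  have : (hp.core : Set G) = (fun t => p (f t)) '' (Set.pi Set.univ fun _ => Set.Icc (0 : ℝ) 1) :=
      by
    refine Set.Subset.antisymm ?_ ?_
    · rintro _ ⟨x, hx, rfl⟩
      rw [SetLike.mem_coe, latticeSpan, ← hspan, Submodule.mem_span_range_iff_exists_fun] at hx
      obtain ⟨c, rfl⟩ := hx
      refine ⟨fun i => Int.fract (c i), fun i _ => ⟨Int.fract_nonneg _, (Int.fract_lt_one _).le⟩,
          ?_⟩
      refine (hp.apply_eq_of_sub_mem ?_).symm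
      have := hp.sum_smul_mem hb fun i => ⌊c i⌋
      convert this using 1
      rw [← Finset.sum_sub_distrib]
      refine Finset.sum_congr rfl fun i _ => ?_
      rw [← sub_smul, Int.self_sub_fract]
    · rintro _ ⟨t, -, rfl⟩
      refine ⟨_, ?_, rfl⟩
      exact sum_mem fun i _ => Submodule.smul_mem _ _ (hp.mem_latticeSpan (hb i))
  rw [this]
  exact (isCompact_univ_pi fun _ => isCompact_Icc).image (hp.contMDiff.continuous.comp hf)

theorem isOpenQuotientMap [ConnectedSpace G] (hp : IsExp p) : IsOpenQuotientMap p :=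
  ⟨hp.surjective, hp.contMDiff.continuous, hp.isOpenMap⟩

/-- If `p x` lies in `L` and `x` is outside the span of the kernel, a real linear form vanishing on
that span but not at `x` descends to a continuous function on the group. It is bounded on the
compact `L`, yet takes the values `n * l x` at the powers of `p x`. -/
theorem le_core [ConnectedSpace G] (hp : IsExp p) {L : Subgroup G} (hL : IsCompact (L : Set G)) :
    L ≤ hp.core := by
  have : FiniteDimensional ℝ E := FiniteDimensional.complexToReal E
  intro g hg
  obtain ⟨x, rfl⟩ := hp.surjective g
  rw [hp.apply_mem_core]
  by_contra hx
  obtain ⟨l, hl, hW⟩ := Submodule.exists_le_ker_of_notMem hx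
  obtain ⟨s, hs⟩ := hp.surjective.hasRightInverse
  have hls : ∀ y, l (s (p y)) = l y := fun y => by
    have : s (p y) - y ∈ hp.kernel := hp.sub_mem_kernel.2 (hs _)
    have := LinearMap.mem_ker.1 (hW (hp.mem_latticeSpan this))
    rwa [_root_.map_sub, sub_eq_zero] at this
  have hc : Continuous fun g => l (s g) := by
    rw [hp.isOpenQuotientMap.isQuotientMap.continuous_iff]
    have : (fun g => l (s g)) ∘ p = l := funext hls
    rw [this]
    exact l.continuous_of_finiteDimensional
  obtain ⟨C, hC⟩ := hL.exists_bound_of_continuousOn hc.continuousOn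
  obtain ⟨n, hn⟩ := exists_nat_gt (C / |l x|)
  have hpn : ∀ n : ℕ, p (n • x) = p x ^ n := fun n => by
    induction n with
    | zero => simp [hp.map_zero]
    | succ k ih => rw [succ_nsmul, hp.map_add, ih, pow_succ]
  have := hC _ (L.pow_mem hg n)
  rw [← hpn, hls, map_nsmul, nsmul_eq_mul, norm_mul, Real.norm_natCast, Real.norm_eq_abs] at this
  rw [div_lt_iff₀ (abs_pos.2 hl)] at hn
  linarith

theorem maximal_core [ConnectedSpace G] (hp : IsExp p) :
    Maximal (fun L : Subgroup G => IsCompact (L : Set G)) hp.core :=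
  ⟨hp.isCompact_core, fun _ hL _ => hp.le_core hL⟩

theorem eq_core [ConnectedSpace G] (hp : IsExp p) {K : Subgroup G}
    (hK : Maximal (fun L : Subgroup G => IsCompact (L : Set G)) K) : K = hp.core :=
  le_antisymm (hp.le_core hK.1) (hK.2 hp.isCompact_core (hp.le_core hK.1))

/-- A smooth curve in the subgroup lifts to a curve inside the linear subspace `latticeSpan`, which
contains its derivatives; conversely `t ↦ p (t • v)` has velocity `v`. -/
theorem tangentAtOne_core [ConnectedSpace G] (hp : IsExp p) : tangentAtOne E hp.core =
    hp.latticeSpan := by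
  have : FiniteDimensional ℝ E := FiniteDimensional.complexToReal E
  refine le_antisymm (Submodule.span_le.2 ?_) fun v hv => Submodule.subset_span ?_
  · rintro _ ⟨γ, hγ, hK, h1, rfl⟩
    obtain ⟨g, hg, hgγ⟩ := hp.exists_lift hγ
    have hd := hg.differentiable (by simp) 0
    have h : HasFDerivAt (fun s => g s - g 0) (fderiv ℝ g 0) 0 := hd.hasFDerivAt.sub_const _
    have h2 := (hp.hasMFDerivAt_comp h (sub_self _)).mfderiv
    have e : (fun s => p (g s - g 0)) = γ := by
      ext s
      rw [hp.map_sub, hgγ, hgγ, h1, inv_one, mul_one]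
    rw [e] at h2
    have h3 : (mfderiv 𝓘(ℝ, ℝ) 𝓘(ℝ, E) γ 0 : ℝ →L[ℝ] E) 1 = deriv g 0 :=
      DFunLike.congr_fun h2 (1 : ℝ)
    rw [h3]
    exact deriv_mem_submodule hd fun s => hp.apply_mem_core.1 (hgγ s ▸ hK s)
  · have hs : ContDiff ℝ ∞ fun t : ℝ => t • v := by fun_prop
    have hps : ContMDiff 𝓘(ℝ, E) 𝓘(ℝ, E) ∞ p := fun x =>
      (hp.contMDiff x).complexToReal.of_le (by simp)
    refine ⟨fun t => p (t • v), hps.comp hs.contMDiff,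
      fun t => hp.apply_mem_core.2 (Submodule.smul_mem _ _ hv), by simp [hp.map_zero], ?_⟩
    have h : HasFDerivAt (fun t : ℝ => t • v) ((1 : ℝ →L[ℝ] ℝ).smulRight v) 0 :=
      (hasFDerivAt_id (0 : ℝ)).smul_const v
    have h2 := (hp.hasMFDerivAt_comp h (zero_smul _ _)).mfderiv
    have h3 := DFunLike.congr_fun h2 (1 : ℝ)
    refine Eq.trans ?_ h3.symm
    change v = (1 : ℝ) • v
    rw [one_smul]

omit [LieGroup 𝓘(ℂ, E) ω G] in
/-- The lattice is preserved by continuity: a continuous map to the kernel is constant. -/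
theorem eq_of_apply_eq (hp : IsExp p) {g : ℝ → E} (hg : Continuous g) (h : ∀ s, p (g s) = p (g 0))
    (s : ℝ) :
    g s = g 0 := by
  have := hp.discreteTopology
  let c : ℝ → hp.kernel := fun s => ⟨g s - g 0, hp.sub_mem_kernel.2 (h s)⟩
  have hc : Continuous c := by
    refine Continuous.subtype_mk ?_ _
    fun_prop
  have := PreconnectedSpace.constant inferInstance hc (x := s) (y := 0)
  simpa [c, sub_eq_zero] using this

/-- A variation lifts to the vector space, with fixed endpoints because fibres are discrete, and
there the first variation of a straight line vanishes. -/
theorem isGeodesicIn_line [ConnectedSpace G] (hp : IsExp p) (B : LinearMap.BilinForm ℝ E)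
    (hB : ∀ x y, B x y = B y x)
    {v : E} (hv : v ∈ hp.latticeSpan) : IsGeodesicIn E hp.core B fun t => p (t • v) := by
  have : FiniteDimensional ℝ E := FiniteDimensional.complexToReal E
  have hs : ContDiff ℝ ∞ fun t : ℝ => t • v := by fun_prop
  have hps : ContMDiff 𝓘(ℝ, E) 𝓘(ℝ, E) ∞ p := fun x =>
    (hp.contMDiff x).complexToReal.of_le (by simp)
  refine ⟨hps.comp hs.contMDiff, fun t => hp.apply_mem_core.2 (Submodule.smul_mem _ _ hv), ?_⟩
  intro a b hab Γ hΓ hK h0 ha hb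
  obtain ⟨g, hg, hgΓ⟩ := hp.exists_lift (F := ℝ × ℝ) hΓ
  have hgs : ∀ s, ContDiff ℝ ∞ fun t => g (s, t) := fun s => hg.comp (by fun_prop)
  have hgt : ∀ t, Continuous fun s => g (s, t) := fun t => hg.continuous.comp (by fun_prop)
  have hl : ∀ s t, leftVelocity E (fun t => Γ (s, t)) t = deriv (fun t => g (s, t)) t :=
      fun s t => by
    have : (fun t => Γ (s, t)) = fun t => p (g (s, t)) := by
      ext t
      rw [hgΓ]
    rw [this, hp.leftVelocity_comp ((hgs s).differentiable (by simp) t)]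
  have hl0 : ∀ t, deriv (fun t => g (0, t)) t = v := fun t => by
    rw [← hl]
    simp only [h0]
    rw [hp.leftVelocity_comp (hs.differentiable (by simp) t)]
    simpa using ((hasDerivAt_id t).smul_const v).deriv
  have := hasDerivAt_action_line B hB v hg hab hl0
    (fun s => hp.eq_of_apply_eq (hgt a) (fun s => by rw [hgΓ, hgΓ, ha, ha]) s)
    (fun s => hp.eq_of_apply_eq (hgt b) (fun s => by rw [hgΓ, hgΓ, hb, hb]) s)
  simp only [curveAction, hl]
  exact this

/-- The line through a kernel element `v` closes up to a geodesic of action `B v v`. Conversely a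
closed geodesic lifts to a path whose endpoints differ by some `m` in the kernel, and its action is
that of the chord, `B m m`. No nondegeneracy of `B` is needed. -/
theorem isPolarizedIn_core [ConnectedSpace G] (hp : IsExp p) (B : LinearMap.BilinForm ℝ E)
    (hB : ∀ x y, B x y = B y x) :
    IsPolarizedIn E hp.core B ↔ ∀ v ∈ hp.kernel, ∃ q : ℚ, B v v = q := by
  have : FiniteDimensional ℝ E := FiniteDimensional.complexToReal E
  constructor
  · intro h v hv
    obtain ⟨q, hq⟩ := h _ (hp.isGeodesicIn_line B hB (hp.mem_latticeSpan hv)) fun t => by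
      rw [add_smul, one_smul, hp.map_add, hp.mem_kernel.1 hv, mul_one]
    refine ⟨q, ?_⟩
    have hs : ContDiff ℝ ∞ fun t : ℝ => t • v := by fun_prop
    have : ∀ t, leftVelocity E (fun t : ℝ => p (t • v)) t = v := fun t => by
      rw [hp.leftVelocity_comp (hs.differentiable (by simp) t)]
      simpa using ((hasDerivAt_id t).smul_const v).deriv
    simpa [curveAction, this] using hq
  · intro h γ ⟨hγ, hK, hgeo⟩ hper
    obtain ⟨g, hg, hgγ⟩ := hp.exists_lift hγ
    have hm : g 1 - g 0 ∈ hp.kernel := by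
      rw [hp.sub_mem_kernel, hgγ, hgγ]
      simpa using hper 0
    obtain ⟨q, hq⟩ := h _ hm
    refine ⟨q, ?_⟩
    rw [← hq]
    have hl : ∀ {g : ℝ → E}, ContDiff ℝ ∞ g → ∀ t, leftVelocity E (fun t => p (g t)) t =
        deriv g t :=
      fun hg t => hp.leftVelocity_comp (hg.differentiable (by simp) t)
    have e : γ = fun t => p (g t) := funext fun t => (hgγ t).symm
    have hgT : ∀ t, g t ∈ hp.latticeSpan := fun t => hp.apply_mem_core.1 (hgγ t ▸ hK t)
    simp only [curveAction]
    rw [e]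
    simp only [hl hg]
    refine integral_eq_of_hasDerivAt_action B hB hg rfl ?_
    have hps : ContMDiff 𝓘(ℝ, E) 𝓘(ℝ, E) ∞ p := fun x =>
      (hp.contMDiff x).complexToReal.of_le (by simp)
    -- This family fixes the endpoints and stays in `latticeSpan`; at parameter `-1` it would be the
    -- chord.
    have hΓ : ContDiff ℝ ∞ fun x : ℝ × ℝ => g x.2 + x.1 • (g x.2 - g 0 - x.2 • (g 1 - g 0)) := by
      fun_prop
    have := hgeo 0 1 one_pos (fun x => p (g x.2 + x.1 • (g x.2 - g 0 - x.2 • (g 1 - g 0))))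
      (hps.comp hΓ.contMDiff)
      (fun s t => hp.apply_mem_core.2 (add_mem (hgT t) (Submodule.smul_mem _ _ (sub_mem
        (sub_mem (hgT t) (hgT 0)) (Submodule.smul_mem _ _ (sub_mem (hgT 1) (hgT 0)))))))
      (fun t => by simp [hgγ]) (fun s => by simp [hgγ]) (fun s => by simp [hgγ])
    simp only [curveAction] at this
    have hs : ∀ s : ℝ, ContDiff ℝ ∞ fun t => g t + s • (g t - g 0 - t • (g 1 - g 0)) := by
      intro s
      fun_prop
    simp only [hl (hs _)] at this
    exact this
end IsExp

/-! ### Conjugation on complexifications and decompositions in weight 2 -/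

section conj
variable {V : Type} [AddCommGroup V] [Module ℚ V]

@[simp]
theorem complexConj_tmul (z : ℂ) (v : V) :
    complexConj V (z ⊗ₜ[ℚ] v) = (starRingEnd ℂ z) ⊗ₜ[ℚ] v := rfl

@[simp]
theorem complexConj_complexConj (x : ℂ ⊗[ℚ] V) : complexConj V (complexConj V x) = x := by
  induction x with
  | zero => simp
  | tmul z v => simp
  | add x y hx hy => rw [map_add, map_add, hx, hy]

theorem complexConj_smul (z : ℂ) (x : ℂ ⊗[ℚ] V) :
    complexConj V (z • x) = starRingEnd ℂ z • complexConj V x := by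
  induction x with
  | zero => simp
  | tmul w v => simp [smul_tmul']
  | add x y hx hy => rw [smul_add, map_add, hx, hy, map_add, smul_add]

theorem complexConj_baseChange {W : Type} [AddCommGroup W] [Module ℚ W] (f : V →ₗ[ℚ] W)
    (x : ℂ ⊗[ℚ] V) : complexConj W (f.baseChange ℂ x) = f.baseChange ℂ (complexConj V x) := by
  induction x with
  | zero => simp
  | tmul w v => simp
  | add x y hx hy => rw [map_add, map_add, hx, hy, map_add, map_add]

theorem baseChange_complexConj (Q : LinearMap.BilinForm ℚ V) (x y : ℂ ⊗[ℚ] V) :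
    Q.baseChange ℂ (complexConj V x) (complexConj V y) = starRingEnd ℂ (Q.baseChange ℂ x y) := by
  induction x with
  | zero => simp
  | add x x' hx hx' => simp only [map_add, LinearMap.add_apply, hx, hx']
  | tmul z v =>
    induction y with
    | zero => simp
    | add y y' hy hy' => simp only [map_add, hy, hy']
    | tmul w u => simp [LinearMap.BilinForm.baseChange_tmul, Rat.smul_def]

theorem baseChange_symm {Q : LinearMap.BilinForm ℚ V} (hQ : ∀ x y, Q x y = Q y x) (x y : ℂ ⊗[ℚ] V) :
    Q.baseChange ℂ x y = Q.baseChange ℂ y x := by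
  induction x with
  | zero => simp
  | add x x' hx hx' => simp only [map_add, LinearMap.add_apply, hx, hx']
  | tmul z v =>
    induction y with
    | zero => simp
    | add y y' hy hy' => simp only [map_add, LinearMap.add_apply, hy, hy']
    | tmul w u => simp [LinearMap.BilinForm.baseChange_tmul, hQ v u, mul_comm]

/-- An element of the complexification which vanishes together with its conjugate on real and
imaginary parts. -/
theorem eq_zero_of_add_conj {x : ℂ ⊗[ℚ] V} (h : x + complexConj V x = 0)
    (h' : Complex.I • (x - complexConj V x) = 0) : x = 0 := by
  have h1 : x - complexConj V x = 0 := (smul_eq_zero_iff_right Complex.I_ne_zero).1 h'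
  have : (2 : ℂ) • x = 0 := by
    rw [show (2 : ℂ) • x = (x + complexConj V x) + (x - complexConj V x) by rw [two_smul]; abel,
      h, h1, add_zero]
  exact (smul_eq_zero_iff_right two_ne_zero).1 this

theorem conj_add_conj (x : ℂ ⊗[ℚ] V) :
    complexConj V (x + complexConj V x) = x + complexConj V x := by
  rw [map_add, complexConj_complexConj, add_comm]

theorem conj_I_sub_conj (x : ℂ ⊗[ℚ] V) :
    complexConj V (Complex.I • (x - complexConj V x)) = Complex.I • (x - complexConj V x) := by
  rw [complexConj_smul, map_sub, complexConj_complexConj, Complex.conj_I, neg_smul, ← smul_neg,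
    neg_sub]

theorem eq_re_add_im (x : ℂ ⊗[ℚ] V) : (2 : ℂ) • x =
    (x + complexConj V x) - Complex.I • (Complex.I • (x - complexConj V x)) := by
  rw [smul_smul, Complex.I_mul_I, two_smul]
  module

end conj

/-- Three complementary subspaces, placed in bidegrees `(2, 0)`, `(1, 1)` and `(0, 2)`. -/
def threePiece {M : Type} [AddCommGroup M] [Module ℂ M] (A B C : Submodule ℂ M) :
    ℕ × ℕ → Submodule ℂ M
  | (2, 0) => A
  | (1, 1) => B
  | (0, 2) => C
  | _ => ⊥

theorem threePiece_eq_bot {M : Type} [AddCommGroup M] [Module ℂ M] (A B C : Submodule ℂ M) :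
    ∀ p q : ℕ, p + q ≠ 2 → threePiece A B C (p, q) = ⊥ := by
  intro p q h
  unfold threePiece
  split
  · simp_all
  · simp_all
  · simp_all
  · rfl

theorem sum_eq_three {M : Type} [AddCommGroup M] [Module ℂ M] {P : ℕ × ℕ → Submodule ℂ M}
    (hP : ∀ p q : ℕ, p + q ≠ 2 → P (p, q) = ⊥) (d : DirectSum (ℕ × ℕ) fun i => P i) :
    DirectSum.coeAddMonoidHom P d = d (2, 0) + d (1, 1) + d (0, 2) := by
  classical
  have hz : ∀ i : ℕ × ℕ, i.1 + i.2 ≠ 2 → ((d i : P i) : M) = 0 := fun i hi => by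
    have := (hP i.1 i.2 hi).le (d i).2
    exact (Submodule.mem_bot ℂ).1 this
  rw [DirectSum.coeAddMonoidHom_eq_dfinsuppSum, DFinsupp.sum]
  have h1 : ∑ i ∈ DFinsupp.support d, ((d i : P i) : M) =
      ∑ i ∈ {((2 : ℕ), (0 : ℕ)), (1, 1), (0, 2)}, ((d i : P i) : M) := by
    apply Finset.sum_congr_of_eq_on_inter
    · intro i _ hi2
      apply hz
      obtain ⟨p, q⟩ := i
      simp only [Finset.mem_insert, Finset.mem_singleton, Prod.mk.injEq, not_or] at hi2
      simp only
      omega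
    · intro i _ hi
      simpa using hi
    · intros; rfl
  rw [h1]
  simp [add_assoc]

theorem isInternal_of_three {M : Type} [AddCommGroup M] [Module ℂ M] {P : ℕ × ℕ → Submodule ℂ M}
    (hP : ∀ p q : ℕ, p + q ≠ 2 → P (p, q) = ⊥)
    (h0 : ∀ a ∈ P (2, 0), ∀ b ∈ P (1, 1), ∀ c ∈ P (0, 2), a + b + c = 0 → a = 0 ∧ b = 0 ∧ c = 0)
    (h1 : P (2, 0) ⊔ P (1, 1) ⊔ P (0, 2) = ⊤) : DirectSum.IsInternal P := by
  constructor
  · rw [injective_iff_map_eq_zero]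
    intro d hd
    rw [sum_eq_three hP] at hd
    obtain ⟨ha, hb, hc⟩ := h0 _ (d (2, 0)).2 _ (d (1, 1)).2 _ (d (0, 2)).2 hd
    ext ⟨p, q⟩
    by_cases hpq : p + q = 2
    · obtain ⟨rfl, rfl⟩ | ⟨rfl, rfl⟩ | ⟨rfl, rfl⟩ : (p = 2 ∧ q = 0) ∨ (p = 1 ∧ q = 1) ∨ (p =
        0 ∧ q = 2) := by
        omega
      · exact ha
      · exact hb
      · exact hc
    · have := (hP p q hpq).le (d (p, q)).2
      exact (Submodule.mem_bot ℂ).1 this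
  · intro x
    have hx : x ∈ P (2, 0) ⊔ P (1, 1) ⊔ P (0, 2) := h1 ▸ Submodule.mem_top
    obtain ⟨y, hy, c, hc, rfl⟩ := Submodule.mem_sup.1 hx
    obtain ⟨a, ha, b, hb, rfl⟩ := Submodule.mem_sup.1 hy
    refine ⟨DirectSum.of (fun i => P i) (2, 0) ⟨a, ha⟩ + DirectSum.of (fun i => P i) (1, 1) ⟨b,
        hb⟩ +
      DirectSum.of (fun i => P i) (0, 2) ⟨c, hc⟩, ?_⟩
    simp

namespace RatHodgeStructure
variable (X : RatHodgeStructure 2)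

theorem eq_zero_of_sum_eq_zero {a b c : ℂ ⊗[ℚ] X.V} (ha : a ∈ X.piece (2, 0)) (hb : b ∈ X.piece (1,
    1))
    (hc : c ∈ X.piece (0, 2)) (h : a + b + c = 0) : a = 0 ∧ b = 0 ∧ c = 0 := by
  classical
  let d := DirectSum.of (fun i => X.piece i) (2, 0) ⟨a, ha⟩ + DirectSum.of (fun i => X.piece i) (1,
      1) ⟨b, hb⟩ +
      DirectSum.of (fun i => X.piece i) (0, 2) ⟨c, hc⟩
  have hd : d = 0 := by
    apply (injective_iff_map_eq_zero _).1 X.isInternal.1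
    simpa [d] using h
  have e : ∀ i, ((d i : X.piece i) : ℂ ⊗[ℚ] X.V) = 0 := fun i => by rw [hd]; rfl
  refine ⟨?_, ?_, ?_⟩
  · simpa [d, DirectSum.of_apply] using e (2, 0)
  · simpa [d, DirectSum.of_apply] using e (1, 1)
  · simpa [d, DirectSum.of_apply] using e (0, 2)

theorem exists_three (x : ℂ ⊗[ℚ] X.V) : ∃ a ∈ X.piece (2, 0), ∃ b ∈ X.piece (1, 1),
    ∃ c ∈ X.piece (0, 2), x = a + b + c := by
  obtain ⟨d, hd⟩ := X.isInternal.2 x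
  exact ⟨_, (d (2, 0)).2, _, (d (1, 1)).2, _, (d (0, 2)).2, by rw [← hd,
      sum_eq_three X.piece_eq_bot]⟩

end RatHodgeStructure

/-! ### From a rational structure on a CR vector space to a polarized Hodge structure -/

theorem mem_crComplex {U : Type} [AddCommGroup U] [Module ℂ U] {T : Submodule ℝ U} {x : U} :
    x ∈ crComplex T ↔ x ∈ T ∧ Complex.I • x ∈ T := by
  rw [crComplex, Submodule.mem_inf, Submodule.mem_smul_pointwise_iff_exists]
  refine and_congr_right fun _ => ⟨?_, fun h => ⟨-(Complex.I • x), neg_mem h, ?_⟩⟩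
  · rintro ⟨y, hy, rfl⟩
    rw [smul_smul, Complex.I_mul_I, neg_smul, one_smul]
    exact neg_mem hy
  · rw [smul_neg, smul_smul, Complex.I_mul_I, neg_smul, one_smul, neg_neg]

theorem I_smul_mem_crComplex {U : Type} [AddCommGroup U] [Module ℂ U] {T : Submodule ℝ U} {x : U}
    (hx : x ∈ crComplex T) : Complex.I • x ∈ crComplex T := by
  rw [mem_crComplex] at hx ⊢
  refine ⟨hx.2, ?_⟩
  rw [smul_smul, Complex.I_mul_I, neg_smul, one_smul]
  exact neg_mem hx.1

/-- A rational structure `V` on the real subspace `T` of a complex vector space `E`, with a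
complement `F` to `T ∩ iT` in `T`. -/
structure CRDatum (V E : Type) [AddCommGroup V] [Module ℚ V] [AddCommGroup E] [Module ℂ E] where
  φ : ℂ ⊗[ℚ] V →ₗ[ℂ] E
  T : Submodule ℝ E
  F : Submodule ℝ E
  inj : ∀ x, complexConj V x = x → φ x = 0 → x = 0
  mem_T : ∀ x, complexConj V x = x → φ x ∈ T
  exists_real : ∀ y ∈ T, ∃ x, complexConj V x = x ∧ φ x = y
  F_le : F ≤ T
  disjoint : ∀ y ∈ crComplex T, y ∈ F → y = 0
  le_sup : T ≤ crComplex T ⊔ F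

namespace CRDatum
variable {V E : Type} [AddCommGroup V] [Module ℚ V] [AddCommGroup E] [Module ℂ E] (D : CRDatum V E)

local notation "c" => complexConj V

theorem eq_zero_of_apply {x : ℂ ⊗[ℚ] V} (h : D.φ x = 0) (h' : D.φ (c x) = 0) : x = 0 :=
  eq_zero_of_add_conj (D.inj _ (conj_add_conj x) (by rw [map_add, h, h', add_zero]))
    (D.inj _ (conj_I_sub_conj x) (by rw [map_smul, map_sub, h, h', sub_zero, smul_zero]))

/-- The summand of bidegree `(0, 2)`. -/
noncomputable def P02 : Submodule ℂ (ℂ ⊗[ℚ] V) := LinearMap.ker D.φ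

/-- The summand of bidegree `(2, 0)`. -/
noncomputable def P20 : Submodule ℂ (ℂ ⊗[ℚ] V) where
  carrier := {x | D.φ (c x) = 0}
  zero_mem' := by simp
  add_mem' {x y} hx hy := by
    simp only [Set.mem_ofPred_eq] at *
    rw [map_add, map_add, hx, hy, add_zero]
  smul_mem' z x hx := by
    simp only [Set.mem_ofPred_eq] at *
    rw [complexConj_smul, map_smul, hx, smul_zero]

/-- Here `x + c x` and `I • (x - c x)` are twice the real part and minus twice the imaginary part of
`x`. This and the next formula show that requiring both to land in a real subspace is a complex
linear condition. -/
theorem add_conj_smul (z : ℂ) (x : ℂ ⊗[ℚ] V) : z • x + c (z • x) =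
    (z.re : ℂ) • (x + c x) + (z.im : ℂ) • Complex.I • (x - c x) := by
  have h1 := Complex.re_add_im z
  have h2 : starRingEnd ℂ z = z.re - z.im * Complex.I := by
    apply Complex.ext <;> simp
  rw [complexConj_smul, h2]
  conv_lhs => enter [1, 1]; rw [← h1]
  module

theorem I_sub_conj_smul (z : ℂ) (x : ℂ ⊗[ℚ] V) : Complex.I • (z • x - c (z • x)) =
    (z.re : ℂ) • Complex.I • (x - c x) - (z.im : ℂ) • (x + c x) := by
  have h1 := Complex.re_add_im z
  have h2 : starRingEnd ℂ z = z.re - z.im * Complex.I := by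
    apply Complex.ext <;> simp
  rw [complexConj_smul, h2]
  conv_lhs => enter [2, 1, 1]; rw [← h1]
  have : ∀ y : ℂ ⊗[ℚ] V, (z.im : ℂ) • y = -(Complex.I * ((z.im : ℂ) * Complex.I)) • y := fun y => by
    congr 1
    linear_combination (z.im : ℂ) * Complex.I_mul_I
  rw [this (x + c x)]
  module

/-- The summand of bidegree `(1, 1)`. -/
noncomputable def P11 : Submodule ℂ (ℂ ⊗[ℚ] V) where
  carrier := {x | D.φ (x + c x) ∈ D.F ∧ D.φ (Complex.I • (x - c x)) ∈ D.F}
  zero_mem' := by simp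
  add_mem' {x y} hx hy := by
    simp only [Set.mem_ofPred_eq] at *
    constructor
    · have := add_mem hx.1 hy.1
      rw [← map_add] at this
      convert! this using 2
      rw [map_add]
      abel
    · have := add_mem hx.2 hy.2
      rw [← map_add, ← smul_add] at this
      convert! this using 3
      rw [map_add]
      abel
  smul_mem' z x hx := by
    simp only [Set.mem_ofPred_eq] at *
    rw [add_conj_smul, I_sub_conj_smul, map_add, map_sub, map_smul D.φ (z.re : ℂ), map_smul D.φ
        (z.im : ℂ),
      map_smul D.φ (z.re : ℂ), map_smul D.φ (z.im : ℂ)]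
    exact ⟨add_mem (D.F.smul_mem z.re hx.1) (D.F.smul_mem z.im hx.2),
      sub_mem (D.F.smul_mem z.re hx.2) (D.F.smul_mem z.im hx.1)⟩

theorem mem_P11 {x : ℂ ⊗[ℚ] V} :
    x ∈ D.P11 ↔ D.φ (x + c x) ∈ D.F ∧ D.φ (Complex.I • (x - c x)) ∈ D.F := Iff.rfl

theorem mem_P20 {x : ℂ ⊗[ℚ] V} : x ∈ D.P20 ↔ D.φ (c x) = 0 := Iff.rfl

theorem mem_P02 {x : ℂ ⊗[ℚ] V} : x ∈ D.P02 ↔ D.φ x = 0 := Iff.rfl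

/-- As `φ x = 0`, the vectors `φ (c x)` and `I • φ (c x)` are, up to sign, the images of the real
elements `x + c x` and `I • (x - c x)`. -/
theorem mem_crComplex_of_mem_P02 {x : ℂ ⊗[ℚ] V} (hx : x ∈ D.P02) :
    D.φ (c x) ∈ crComplex D.T := by
  rw [mem_P02] at hx
  rw [mem_crComplex]
  constructor
  · have := D.mem_T _ (conj_add_conj x)
    rwa [map_add, hx, zero_add] at this
  · have := neg_mem (D.mem_T _ (conj_I_sub_conj x))
    rwa [map_smul, map_sub, hx, zero_sub, smul_neg, neg_neg] at this

theorem conj_mem_P02 {x : ℂ ⊗[ℚ] V} (hx : x ∈ D.P20) : c x ∈ D.P02 := hx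

theorem conj_mem_P20 {x : ℂ ⊗[ℚ] V} (hx : x ∈ D.P02) : c x ∈ D.P20 := by
  rw [mem_P20, complexConj_complexConj]
  exact hx

theorem conj_mem_P11 {x : ℂ ⊗[ℚ] V} (hx : x ∈ D.P11) : c x ∈ D.P11 := by
  rw [mem_P11] at *
  rw [complexConj_complexConj, add_comm]
  refine ⟨hx.1, ?_⟩
  rw [← neg_sub, smul_neg, map_neg]
  exact neg_mem hx.2

theorem real_mem_P11 {x : ℂ ⊗[ℚ] V} (hx : c x = x) (h : D.φ x ∈ D.F) : x ∈ D.P11 := by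
  rw [mem_P11, hx, sub_self, smul_zero, map_zero, map_add]
  exact ⟨add_mem h h, zero_mem _⟩

/-- If `z` is the real element with `φ z = I • φ x`, then `y = (x + I • z) / 2` is killed by `φ` and
has real part `x / 2`. -/
theorem exists_conj_mem_P02 {x : ℂ ⊗[ℚ] V} (hx : c x = x) (h : D.φ x ∈ crComplex D.T) :
    ∃ y ∈ D.P02, x = c y + y := by
  obtain ⟨z, hz, hz'⟩ := D.exists_real _ (mem_crComplex.1 h).2
  refine ⟨(2⁻¹ : ℂ) • (x + Complex.I • z), ?_, ?_⟩
  · rw [mem_P02, map_smul, map_add, map_smul, hz', smul_smul, Complex.I_mul_I, neg_smul, one_smul,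
      add_neg_cancel, smul_zero]
  · rw [complexConj_smul, map_add, complexConj_smul, hx, hz, Complex.conj_I]
    simp only [map_inv₀, Complex.conj_ofNat]
    module

/-- Independence: applying `φ` to a relation `u + m + w = 0` and to its conjugate puts the real and
imaginary parts of `m` in both `H` and `F`, so `m = 0`; then `u` is killed together with its
conjugate. Spanning: for real `x`, remove the real preimage of the `F`-component of `φ x`; what
remains maps into `H` and is a sum of conjugates. -/
theorem isInternal : DirectSum.IsInternal (threePiece D.P20 D.P11 D.P02) := by
  apply isInternal_of_three (threePiece_eq_bot _ _ _)
  · intro u (hu : u ∈ D.P20) m (hm : m ∈ D.P11) w (hw : w ∈ D.P02) h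
    have hum : D.φ u ∈ crComplex D.T := by
      simpa using D.mem_crComplex_of_mem_P02 (D.conj_mem_P02 hu)
    have hw' := D.mem_crComplex_of_mem_P02 hw
    have h1 : D.φ m = -D.φ u := by
      have := congrArg D.φ h
      rw [map_add, map_add, D.mem_P02.1 hw, add_zero, map_zero] at this
      rw [eq_neg_iff_add_eq_zero, add_comm, this]
    have h2 : D.φ (c m) = -D.φ (c w) := by
      have := congrArg D.φ (congrArg c h)
      rw [map_add, map_add, map_add, map_add, D.mem_P20.1 hu, zero_add, map_zero, map_zero] at this
      rwa [eq_neg_iff_add_eq_zero]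
    have hm0 : m = 0 := by
      refine eq_zero_of_add_conj (D.inj _ (conj_add_conj m) (D.disjoint _ ?_ hm.1))
        (D.inj _ (conj_I_sub_conj m) (D.disjoint _ ?_ hm.2))
      · rw [map_add, h1, h2]
        exact add_mem (neg_mem hum) (neg_mem hw')
      · rw [map_smul, map_sub, h1, h2]
        exact I_smul_mem_crComplex (sub_mem (neg_mem hum) (neg_mem hw'))
    have hu0 : u = 0 := by
      refine D.eq_zero_of_apply ?_ hu
      rw [hm0, map_zero] at h1
      exact neg_eq_zero.1 h1.symm
    refine ⟨hu0, hm0, ?_⟩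
    simpa [hu0, hm0] using h
  · change D.P20 ⊔ D.P11 ⊔ D.P02 = ⊤
    have hreal : ∀ x, c x = x → x ∈ D.P20 ⊔ D.P11 ⊔ D.P02 := fun x hx => by
      obtain ⟨y, hy, f, hf, hyf⟩ := Submodule.mem_sup.1 (D.le_sup (D.mem_T x hx))
      obtain ⟨a, ha, rfl⟩ := D.exists_real f (D.F_le hf)
      have hxa : c (x - a) = x - a := by rw [map_sub, hx, ha]
      obtain ⟨w, hw, hxw⟩ := D.exists_conj_mem_P02 hxa (by rwa [map_sub, ← hyf,
          add_sub_cancel_right])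
      have : x = c w + a + w := by
        rw [add_right_comm, ← hxw, sub_add_cancel]
      rw [this]
      exact Submodule.add_mem_sup (Submodule.add_mem_sup (D.conj_mem_P20 hw)
          (D.real_mem_P11 ha hf)) hw
    rw [eq_top_iff]
    intro x _
    have h2 : (2 : ℂ) • x ∈ D.P20 ⊔ D.P11 ⊔ D.P02 := by
      rw [eq_re_add_im]
      exact sub_mem (hreal _ (conj_add_conj x)) (Submodule.smul_mem _ _ (hreal _
          (conj_I_sub_conj x)))
    exact (Submodule.smul_mem_iff _ two_ne_zero).1 h2

/-- The Hodge structure of a `CRDatum`. -/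
noncomputable def toHodge [FiniteDimensional ℚ V] : RatHodgeStructure 2 where
  V := V
  piece := threePiece D.P20 D.P11 D.P02
  piece_eq_bot := threePiece_eq_bot _ _ _
  isInternal := D.isInternal
  conj_mem p q x hx := by
    by_cases hpq : p + q = 2
    · obtain ⟨rfl, rfl⟩ | ⟨rfl, rfl⟩ | ⟨rfl, rfl⟩ : (p = 2 ∧ q = 0) ∨ (p = 1 ∧ q = 1) ∨ (p =
        0 ∧ q = 2) := by
        omega
      · exact D.conj_mem_P02 hx
      · exact D.conj_mem_P11 hx
      · exact D.conj_mem_P20 hx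
    · rw [threePiece_eq_bot _ _ _ p q hpq, Submodule.mem_bot] at hx
      rw [hx, map_zero]
      exact zero_mem _

/-- A real symmetric form of the kind occurring in bi-CR Hermitian structures, rational on `V`. -/
structure Form (D : CRDatum V E) where
  B : LinearMap.BilinForm ℝ E
  symm : ∀ x y, B x y = B y x
  rational : ∀ u v : V, ∃ q : ℚ, B (D.φ (1 ⊗ₜ u)) (D.φ (1 ⊗ₜ v)) = q
  orthogonal : ∀ x ∈ crComplex D.T, ∀ y ∈ D.F, B x y = 0
  I_smul : ∀ x ∈ crComplex D.T, ∀ y ∈ crComplex D.T, B (Complex.I • x) (Complex.I • y) = B x y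
  neg : ∀ x ∈ crComplex D.T, x ≠ 0 → B x x < 0
  pos : ∀ x ∈ D.F, x ≠ 0 → 0 < B x x

namespace Form
variable {D} (β : D.Form)

/-- The rational form on `V`. -/
noncomputable def Q : LinearMap.BilinForm ℚ V :=
  have h : ∀ u v : V, (((β.rational u v).choose : ℚ) : ℝ) = β.B (D.φ (1 ⊗ₜ u)) (D.φ (1 ⊗ₜ v)) :=
    fun u v => (β.rational u v).choose_spec.symm
  have hs : ∀ (r : ℚ) (v : V), D.φ ((1 : ℂ) ⊗ₜ[ℚ] (r • v)) = (r : ℝ) • D.φ (1 ⊗ₜ v) := fun r v => by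
    rw [← smul_tmul, Rat.smul_def, mul_one, show (((r : ℚ) : ℂ)) = ((r : ℝ) : ℂ) by simp,
      ← Complex.coe_smul, ← map_smul, smul_tmul', smul_eq_mul, mul_one]
  LinearMap.mk₂ ℚ (fun u v => (β.rational u v).choose)
    (fun u u' v => by
      have : ∀ a b : ℚ, (a : ℝ) = b → a = b := fun a b h => by exact_mod_cast h
      apply this
      push_cast
      rw [h, h, h, tmul_add, map_add, map_add, LinearMap.add_apply])
    (fun r u v => by
      have : ∀ a b : ℚ, (a : ℝ) = b → a = b := fun a b h => by exact_mod_cast h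
      apply this
      rw [smul_eq_mul]
      push_cast
      rw [h, h, hs, map_smul, LinearMap.smul_apply, smul_eq_mul])
    (fun u v v' => by
      have : ∀ a b : ℚ, (a : ℝ) = b → a = b := fun a b h => by exact_mod_cast h
      apply this
      push_cast
      rw [h, h, h, tmul_add, map_add, map_add])
    (fun r u v => by
      have : ∀ a b : ℚ, (a : ℝ) = b → a = b := fun a b h => by exact_mod_cast h
      apply this
      rw [smul_eq_mul]
      push_cast
      rw [h, h, hs, map_smul, smul_eq_mul])

theorem Q_apply (u v : V) : ((β.Q u v : ℚ) : ℝ) = β.B (D.φ (1 ⊗ₜ u)) (D.φ (1 ⊗ₜ v)) :=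
  (β.rational u v).choose_spec.symm

theorem Q_symm (u v : V) : β.Q u v = β.Q v u := by
  have := (β.Q_apply u v).trans ((β.symm _ _).trans (β.Q_apply v u).symm)
  exact_mod_cast this

/-- Twice the real part of `z ⊗ₜ v` is `2 * z.re` times a rational vector, where `Q` and `B` agree;
additivity gives the rest. -/
theorem Q_baseChange_add_conj (x y : ℂ ⊗[ℚ] V) : β.Q.baseChange ℂ (x + c x) (y + c y) =
    (β.B (D.φ (x + c x)) (D.φ (y + c y)) : ℂ) := by
  have key : ∀ (z : ℂ) (v : V), D.φ (z ⊗ₜ v + c (z ⊗ₜ v)) = (2 * z.re) • D.φ (1 ⊗ₜ v) :=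
      fun z v => by
    rw [complexConj_tmul, ← add_tmul, Complex.add_conj, ← Complex.coe_smul, ← map_smul, smul_tmul',
        smul_eq_mul, mul_one]
  have key' : ∀ (z : ℂ) (v : V), z ⊗ₜ[ℚ] v + c (z ⊗ₜ v) = (((2 * z.re : ℝ)) : ℂ) ⊗ₜ v :=
      fun z v => by
    rw [complexConj_tmul, ← add_tmul, Complex.add_conj]
  induction x with
  | zero => simp
  | add x x' hx hx' =>
    have : x + x' + c (x + x') = (x + c x) + (x' + c x') := by rw [map_add]; abel
    rw [this]
    simp only [map_add, LinearMap.add_apply] at hx hx' ⊢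
    push_cast at hx hx' ⊢
    linear_combination hx + hx'
  | tmul z v =>
    induction y with
    | zero => simp
    | add y y' hy hy' =>
      have : y + y' + c (y + y') = (y + c y) + (y' + c y') := by rw [map_add]; abel
      rw [this]
      simp only [map_add, LinearMap.add_apply] at hy hy' ⊢
      push_cast at hy hy' ⊢
      linear_combination hy + hy'
    | tmul w u =>
      rw [key, key, key', key', LinearMap.BilinForm.baseChange_tmul, map_smul, map_smul,
          LinearMap.smul_apply, ← Q_apply]
      simp [Rat.smul_def]
      ring

theorem Q_baseChange_real {x y : ℂ ⊗[ℚ] V} (hx : c x = x) (hy : c y = y) :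
    β.Q.baseChange ℂ x y = (β.B (D.φ x) (D.φ y) : ℂ) := by
  have := β.Q_baseChange_add_conj x y
  rw [hx, hy] at this
  simp only [map_add, LinearMap.add_apply] at this
  push_cast at this
  linear_combination this / 4

/-- The extension of `Q` in terms of real and imaginary parts. -/
theorem four_mul_Q (x y : ℂ ⊗[ℚ] V) : 4 * β.Q.baseChange ℂ x y =
    β.B (D.φ (x + c x)) (D.φ (y + c y)) -
    β.B (D.φ (Complex.I • (x - c x))) (D.φ (Complex.I • (y - c y))) -
    Complex.I * (β.B (D.φ (x + c x)) (D.φ (Complex.I • (y - c y))) +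
    β.B (D.φ (Complex.I • (x - c x))) (D.φ (y + c y))) := by
  have h := congrArg₂ (fun a b => β.Q.baseChange ℂ a b) (eq_re_add_im x) (eq_re_add_im y)
  have r1 := conj_add_conj x
  have r2 := conj_I_sub_conj x
  have r3 := conj_add_conj y
  have r4 := conj_I_sub_conj y
  generalize x + c x = a at *
  generalize Complex.I • (x - c x) = b at *
  generalize y + c y = a' at *
  generalize Complex.I • (y - c y) = b' at *
  simp only [map_sub, map_smul, LinearMap.sub_apply, LinearMap.smul_apply, smul_eq_mul] at h
  rw [β.Q_baseChange_real r1 r3, β.Q_baseChange_real r1 r4, β.Q_baseChange_real r2 r3,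
    β.Q_baseChange_real r2 r4] at h
  linear_combination h + (β.B (D.φ b) (D.φ b')) * Complex.I_mul_I

end Form
end CRDatum

namespace CRDatum
variable {V E : Type} [AddCommGroup V] [Module ℚ V] [AddCommGroup E] [Module ℂ E] {D : CRDatum V E}

local notation "c" => complexConj V

namespace Form
variable (β : D.Form)

theorem B_I_smul_left {x y : E} (hx : x ∈ crComplex D.T) (hy : y ∈ crComplex D.T) :
    β.B (Complex.I • x) y = -β.B x (Complex.I • y) := by
  have := β.I_smul _ (I_smul_mem_crComplex hx) _ hy
  rw [smul_smul, Complex.I_mul_I, neg_smul, one_smul, map_neg, LinearMap.neg_apply] at this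
  exact this.symm

theorem φ_P02 {x : ℂ ⊗[ℚ] V} (hx : x ∈ D.P02) : D.φ (x + c x) = D.φ (c x) ∧
    D.φ (Complex.I • (x - c x)) = -(Complex.I • D.φ (c x)) := by
  rw [mem_P02] at hx
  rw [map_add, map_smul, map_sub, hx, zero_add, zero_sub, smul_neg]
  exact ⟨rfl, rfl⟩

/-- With `a = φ (c u)` and `b = φ (c w)` in `H`, the real part of `four_mul_Q` is `B(a, b) - B(Ia,
Ib)` and the imaginary part is, up to sign, `B(a, Ib) + B(Ia, b)`. Both vanish by the invariance of
`B` under `I`. -/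
theorem Q_P02_P02 {u w : ℂ ⊗[ℚ] V} (hu : u ∈ D.P02) (hw : w ∈ D.P02) :
    β.Q.baseChange ℂ u w = 0 := by
  have h := β.four_mul_Q u w
  have hu' := D.mem_crComplex_of_mem_P02 hu
  have hw' := D.mem_crComplex_of_mem_P02 hw
  rw [(φ_P02 hu).1, (φ_P02 hu).2, (φ_P02 hw).1, (φ_P02 hw).2] at h
  simp only [map_neg, LinearMap.neg_apply, neg_neg, β.B_I_smul_left hu' hw',
      β.I_smul _ hu' _ hw'] at h
  simpa using h

theorem Q_P02_P11 {u w : ℂ ⊗[ℚ] V} (hu : u ∈ D.P02) (hw : w ∈ D.P11) :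
    β.Q.baseChange ℂ u w = 0 := by
  have h := β.four_mul_Q u w
  have hu' := D.mem_crComplex_of_mem_P02 hu
  rw [(φ_P02 hu).1, (φ_P02 hu).2] at h
  have hIu := neg_mem (I_smul_mem_crComplex hu')
  rw [β.orthogonal _ hu' _ hw.1, β.orthogonal _ hu' _ hw.2, β.orthogonal _ hIu _ hw.1,
    β.orthogonal _ hIu _ hw.2] at h
  simpa using h

theorem Q_eq_zero_of_conj {u w : ℂ ⊗[ℚ] V} (h : β.Q.baseChange ℂ (c u) (c w) = 0) :
    β.Q.baseChange ℂ u w = 0 := by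
  rw [baseChange_complexConj] at h
  simpa using h

/-- The value is half of `B(a, a)` for `a = φ (c u)` in `H`, where `B` is negative; and `a ≠ 0`
since `u` and its conjugate cannot both be killed by `φ`. -/
theorem pos_P02 {u : ℂ ⊗[ℚ] V} (hu : u ∈ D.P02) (h0 : u ≠ 0) :
    ∃ r : ℝ, 0 < r ∧ β.Q.baseChange ℂ u (c u) = -(r : ℂ) := by
  have hu' := D.mem_crComplex_of_mem_P02 hu
  have hne : D.φ (c u) ≠ 0 := fun h => h0 (D.eq_zero_of_apply hu h)
  refine ⟨-(β.B (D.φ (c u)) (D.φ (c u))) / 2, by linarith [β.neg _ hu' hne], ?_⟩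
  have h := β.four_mul_Q u (c u)
  have e1 : D.φ (c u + c (c u)) = D.φ (c u) := by
    rw [complexConj_complexConj, add_comm, (φ_P02 hu).1]
  have e2 : D.φ (Complex.I • (c u - c (c u))) = Complex.I • D.φ (c u) := by
    rw [complexConj_complexConj, ← neg_sub, smul_neg, map_neg, (φ_P02 hu).2, neg_neg]
  rw [(φ_P02 hu).1, (φ_P02 hu).2, e1, e2] at h
  simp only [map_neg, LinearMap.neg_apply, β.B_I_smul_left hu' hu', β.I_smul _ hu' _ hu'] at h
  have e3 : β.B (D.φ (c u)) (Complex.I • D.φ (c u)) = 0 := by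
    have := β.B_I_smul_left hu' hu'
    rw [β.symm] at this
    linarith
  rw [e3] at h
  push_cast at h ⊢
  linear_combination h / 4

/-- The value is a quarter of the sum of `B` on the images of `u + c u` and `I • (u - c u)`, both in
`F`, where `B` is positive, and not both zero. -/
theorem pos_P11 {u : ℂ ⊗[ℚ] V} (hu : u ∈ D.P11) (h0 : u ≠ 0) :
    ∃ r : ℝ, 0 < r ∧ β.Q.baseChange ℂ u (c u) = (r : ℂ) := by
  have h := β.four_mul_Q u (c u)
  have e1 : D.φ (c u + c (c u)) = D.φ (u + c u) := by
    rw [complexConj_complexConj, add_comm]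
  have e2 : D.φ (Complex.I • (c u - c (c u))) = -D.φ (Complex.I • (u - c u)) := by
    rw [complexConj_complexConj, ← neg_sub, smul_neg, map_neg]
  rw [e1, e2] at h
  refine ⟨(β.B (D.φ (u + c u)) (D.φ (u + c u)) + β.B (D.φ (Complex.I • (u - c u))) (D.φ
      (Complex.I • (u - c u)))) / 4, ?_, ?_⟩
  · have hor : D.φ (u + c u) ≠ 0 ∨ D.φ (Complex.I • (u - c u)) ≠ 0 := by
      by_contra! hcon
      exact h0 (eq_zero_of_add_conj (D.inj _ (conj_add_conj u) hcon.1) (D.inj _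
          (conj_I_sub_conj u) hcon.2))
    have hnn : ∀ y ∈ D.F, 0 ≤ β.B y y := fun y hy => by
      by_cases hy0 : y = 0
      · simp [hy0]
      · exact (β.pos y hy hy0).le
    have a1 := hnn _ hu.1
    have a2 := hnn _ hu.2
    rcases hor with h | h
    · linarith [β.pos _ hu.1 h]
    · linarith [β.pos _ hu.2 h]
  · simp only [map_neg] at h
    rw [β.symm (D.φ (Complex.I • (u - c u))) (D.φ (u + c u))] at h
    push_cast at h ⊢
    linear_combination h / 4

theorem orthogonal_piece (p q r s : ℕ) (h : (p, q) ≠ (s, r)) (u : ℂ ⊗[ℚ] V)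
    (hu : u ∈ threePiece D.P20 D.P11 D.P02 (p, q)) (v : ℂ ⊗[ℚ] V)
    (hv : v ∈ threePiece D.P20 D.P11 D.P02 (r, s)) : β.Q.baseChange ℂ u v = 0 := by
  by_cases hpq : p + q = 2
  swap
  · rw [threePiece_eq_bot _ _ _ p q hpq, Submodule.mem_bot] at hu
    rw [hu, map_zero, LinearMap.zero_apply]
  by_cases hrs : r + s = 2
  swap
  · rw [threePiece_eq_bot _ _ _ r s hrs, Submodule.mem_bot] at hv
    rw [hv, map_zero]
  have hs := baseChange_symm β.Q_symm
  obtain ⟨rfl, rfl⟩ | ⟨rfl, rfl⟩ | ⟨rfl, rfl⟩ :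
    (p = 2 ∧ q = 0) ∨ (p = 1 ∧ q = 1) ∨ (p = 0 ∧ q = 2) := by omega
  all_goals
    obtain ⟨rfl, rfl⟩ | ⟨rfl, rfl⟩ | ⟨rfl, rfl⟩ :
      (r = 2 ∧ s = 0) ∨ (r = 1 ∧ s = 1) ∨ (r = 0 ∧ s = 2) := by omega
  · exact β.Q_eq_zero_of_conj (β.Q_P02_P02 (D.conj_mem_P02 hu) (D.conj_mem_P02 hv))
  · exact β.Q_eq_zero_of_conj (β.Q_P02_P11 (D.conj_mem_P02 hu) (D.conj_mem_P11 hv))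
  · exact absurd rfl h
  · exact (hs _ _).trans
      (β.Q_eq_zero_of_conj (β.Q_P02_P11 (D.conj_mem_P02 hv) (D.conj_mem_P11 hu)))
  · exact absurd rfl h
  · exact (hs _ _).trans (β.Q_P02_P11 hv hu)
  · exact absurd rfl h
  · exact β.Q_P02_P11 hu hv
  · exact β.Q_P02_P02 hu hv

theorem pos_piece (p q : ℕ) (u : ℂ ⊗[ℚ] V) (hu : u ∈ threePiece D.P20 D.P11 D.P02 (p, q))
    (h0 : u ≠ 0) : 0 < Complex.I ^ ((p : ℤ) - (q : ℤ)) * β.Q.baseChange ℂ u (c u) := by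
  by_cases hpq : p + q = 2
  swap
  · rw [threePiece_eq_bot _ _ _ p q hpq, Submodule.mem_bot] at hu
    exact absurd hu h0
  obtain ⟨rfl, rfl⟩ | ⟨rfl, rfl⟩ | ⟨rfl, rfl⟩ :
    (p = 2 ∧ q = 0) ∨ (p = 1 ∧ q = 1) ∨ (p = 0 ∧ q = 2) := by omega
  · obtain ⟨r, hr, h⟩ := β.pos_P02 (D.conj_mem_P02 hu) fun h => h0 (by
      rw [← complexConj_complexConj u, h, map_zero])
    rw [complexConj_complexConj, baseChange_symm β.Q_symm] at h
    rw [h, show Complex.I ^ (((2 : ℕ) : ℤ) - ((0 : ℕ) : ℤ)) = -1 by simp [zpow_ofNat], neg_one_mul,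
      neg_neg]
    exact_mod_cast hr
  · obtain ⟨r, hr, h⟩ := β.pos_P11 hu h0
    rw [h, show Complex.I ^ (((1 : ℕ) : ℤ) - ((1 : ℕ) : ℤ)) = 1 by simp, one_mul]
    exact_mod_cast hr
  · obtain ⟨r, hr, h⟩ := β.pos_P02 hu h0
    rw [h, show Complex.I ^ (((0 : ℕ) : ℤ) - ((2 : ℕ) : ℤ)) = -1 by simp [zpow_neg], neg_one_mul,
      neg_neg]
    exact_mod_cast hr

theorem Q_symm' (u v : V) : β.Q v u = (-1) ^ 2 * β.Q u v := by
  rw [β.Q_symm v u]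
  ring

/-- The polarized Hodge structure of a `CRDatum` with a rational form. -/
noncomputable def toPol [FiniteDimensional ℚ V] : PolHodgeStructure 2 where
  toRatHodgeStructure := D.toHodge
  Q := β.Q
  symm := β.Q_symm'
  orthogonal := β.orthogonal_piece
  pos := β.pos_piece

end Form

variable {V' E' : Type} [AddCommGroup V'] [Module ℚ V'] [AddCommGroup E'] [Module ℂ E']
    {D' : CRDatum V' E'}

theorem φ_baseChange {f : V →ₗ[ℚ] V'} {L : E →ₗ[ℂ] E'}
    (h : ∀ v, L (D.φ (1 ⊗ₜ v)) = D'.φ (1 ⊗ₜ f v)) (x : ℂ ⊗[ℚ] V) :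
    D'.φ (f.baseChange ℂ x) = L (D.φ x) := by
  induction x with
  | zero => simp
  | add x y hx hy => simp only [map_add, hx, hy]
  | tmul z v =>
    have e : ∀ {W : Type} [AddCommGroup W] [Module ℚ W] (w : W), z ⊗ₜ[ℚ] w = z • (1 : ℂ) ⊗ₜ[ℚ] w :=
        by
      intro W _ _ w
      rw [smul_tmul', smul_eq_mul, mul_one]
    rw [LinearMap.baseChange_tmul, e, e v, map_smul, map_smul, map_smul, h]

theorem baseChange_mem_piece {f : V →ₗ[ℚ] V'} {L : E →ₗ[ℂ] E'}
    (h : ∀ v, L (D.φ (1 ⊗ₜ v)) = D'.φ (1 ⊗ₜ f v)) (hF : ∀ x ∈ D.F, L x ∈ D'.F) (p q : ℕ)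
    (x : ℂ ⊗[ℚ] V) (hx : x ∈ threePiece D.P20 D.P11 D.P02 (p, q)) :
    f.baseChange ℂ x ∈ threePiece D'.P20 D'.P11 D'.P02 (p, q) := by
  have hc : ∀ x, complexConj V' (f.baseChange ℂ x) = f.baseChange ℂ (c x) :=
    complexConj_baseChange f
  by_cases hpq : p + q = 2
  · obtain ⟨rfl, rfl⟩ | ⟨rfl, rfl⟩ | ⟨rfl, rfl⟩ :
      (p = 2 ∧ q = 0) ∨ (p = 1 ∧ q = 1) ∨ (p = 0 ∧ q = 2) := by omega
    · have : D'.φ (complexConj V' (f.baseChange ℂ x)) = 0 := by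
        rw [hc, φ_baseChange h, D.mem_P20.1 hx, map_zero]
      exact this
    · have : f.baseChange ℂ x ∈ D'.P11 := by
        rw [mem_P11, hc, ← map_add, ← map_sub, ← map_smul, φ_baseChange h, φ_baseChange h]
        exact ⟨hF _ hx.1, hF _ hx.2⟩
      exact this
    · have : D'.φ (f.baseChange ℂ x) = 0 := by
        rw [φ_baseChange h, D.mem_P02.1 hx, map_zero]
      exact this
  · rw [threePiece_eq_bot _ _ _ p q hpq, Submodule.mem_bot] at hx
    rw [hx, map_zero]
    exact zero_mem _

/-- A linear map compatible with the data induces a morphism of Hodge structures. -/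
noncomputable def homOf [FiniteDimensional ℚ V] [FiniteDimensional ℚ V'] (f : V →ₗ[ℚ] V')
    (L : E →ₗ[ℂ] E') (h : ∀ v, L (D.φ (1 ⊗ₜ v)) = D'.φ (1 ⊗ₜ f v)) (hF : ∀ x ∈ D.F, L x ∈ D'.F) :
    RatHodgeStructure.Hom D.toHodge D'.toHodge where
  toLinearMap := f
  map_piece := baseChange_mem_piece h hF

/-- Every morphism of Hodge structures comes from a complex linear map. -/
theorem exists_linearMap [FiniteDimensional ℚ V] [FiniteDimensional ℚ V']
    (hsurj : Function.Surjective D.φ)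
    (f : RatHodgeStructure.Hom D.toHodge D'.toHodge) :
    ∃ L : E →ₗ[ℂ] E', (∀ v, L (D.φ (1 ⊗ₜ v)) = D'.φ (1 ⊗ₜ f.toLinearMap v)) ∧ ∀ x ∈ D.F,
        L x ∈ D'.F := by
  let f' : V →ₗ[ℚ] V' := f.toLinearMap
  obtain ⟨s, hs⟩ := D.φ.exists_rightInverse_of_surjective (LinearMap.range_eq_top.2 hsurj)
  let L : E →ₗ[ℂ] E' := D'.φ ∘ₗ f'.baseChange ℂ ∘ₗ s
  -- The choice of the section `s` does not matter: two preimages differ by an element of bidegree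
  -- `(0, 2)`, which `f` sends to the kernel of `D'.φ`.
  have hL : ∀ x, L (D.φ x) = D'.φ (f'.baseChange ℂ x) := fun x => by
    have h1 : s (D.φ x) - x ∈ D.P02 := by
      rw [mem_P02, map_sub, sub_eq_zero]
      exact LinearMap.congr_fun hs _
    have h2 : D'.φ (f'.baseChange ℂ (s (D.φ x) - x)) = 0 := f.map_piece 0 2 _ h1
    rw [map_sub, map_sub, sub_eq_zero] at h2
    exact h2
  refine ⟨L, fun v => by rw [hL, LinearMap.baseChange_tmul]; rfl, fun y hy => ?_⟩
  obtain ⟨x, hx, rfl⟩ := D.exists_real y (D.F_le hy)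
  have h1 : f'.baseChange ℂ x ∈ D'.P11 := f.map_piece 1 1 _ (D.real_mem_P11 hx hy)
  rw [hL]
  have h2 := h1.1
  rw [complexConj_baseChange, hx, map_add, ← two_smul ℝ] at h2
  exact (Submodule.smul_mem_iff _ two_ne_zero).1 h2

end CRDatum

/-! ### The rational span of a lattice -/

instance isScalarTower_rat_complex (E : Type) [AddCommGroup E] [Module ℂ E] [Module ℚ E] :
    IsScalarTower ℚ ℂ E where
  smul_assoc q z x := by rw [Rat.smul_def, mul_smul, Rat.cast_smul_eq_qsmul]

section
variable {E : Type} [NormedAddCommGroup E] [NormedSpace ℂ E] [FiniteDimensional ℂ E]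

/-- A discrete subgroup of a finite-dimensional space has a basis which is independent over the
real numbers. -/
theorem AddSubgroup.exists_basis_of_discrete (Λ : AddSubgroup E) [DiscreteTopology Λ] :
    ∃ (n : ℕ) (b : Fin n → E), (∀ i, b i ∈ Λ) ∧ LinearIndependent ℝ b ∧
      ∀ x ∈ Λ, ∃ m : Fin n → ℤ, x = ∑ i, m i • b i := by
  have : FiniteDimensional ℝ E := FiniteDimensional.complexToReal E
  let L : Submodule ℤ E := AddSubgroup.toIntSubmodule Λ
  have hd : DiscreteTopology L := ‹DiscreteTopology Λ›
  have : Module.Finite ℤ L := inferInstance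
  have : Module.Free ℤ L := inferInstance
  let B := Module.finBasis ℤ L
  have hspan : ∀ x ∈ Λ, ∃ m : Fin (Module.finrank ℤ L) → ℤ, x = ∑ i, m i • (B i : E) := fun x hx =>
    ⟨B.repr ⟨x, hx⟩, by
      have := congrArg L.subtype (B.sum_repr ⟨x, hx⟩)
      rw [map_sum] at this
      exact this.symm⟩
  refine ⟨_, fun i => (B i : E), fun i => (B i).2, ?_, hspan⟩
  -- For a discrete subgroup the real dimension of the span equals the ℤ-rank, so a ℤ-basis is
  -- independent over ℝ.
  rw [linearIndependent_iff_card_eq_finrank_span, Fintype.card_fin]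
  have h1 := Real.finrank_eq_int_finrank_of_discrete (s := Set.range fun i => (B i : E)) (by
    have hle : (Submodule.span ℤ (Set.range fun i => (B i : E))) ≤ L :=
      Submodule.span_le.2 (by rintro _ ⟨i, rfl⟩; exact (B i).2)
    exact DiscreteTopology.of_subset (s := (L : Set E)) hd hle)
  have h2 : Submodule.span ℤ (Set.range fun i => (B i : E)) = L := by
    refine le_antisymm (Submodule.span_le.2 (by rintro _ ⟨i, rfl⟩; exact (B i).2)) fun x hx => ?_
    obtain ⟨m, rfl⟩ := hspan x hx
    exact sum_mem fun i _ => Submodule.smul_mem _ _ (Submodule.subset_span ⟨i, rfl⟩)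
  rw [Set.finrank, Set.finrank, h2] at h1
  exact h1.symm

variable [Module ℚ E]

/-- The rational span of a lattice. -/
abbrev ratSpan (Λ : AddSubgroup E) : Submodule ℚ E := Submodule.span ℚ (Λ : Set E)

omit [FiniteDimensional ℂ E] [NormedSpace ℂ E] in
theorem exists_smul_mem_of_mem_ratSpan {Λ : AddSubgroup E} {v : E} (hv : v ∈ ratSpan Λ) :
    ∃ N : ℕ, N ≠ 0 ∧ N • v ∈ Λ := by
  induction hv using Submodule.span_induction with
  | mem x hx => exact ⟨1, one_ne_zero, by simpa using hx⟩
  | zero => exact ⟨1, one_ne_zero, by simp⟩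
  | add x y _ _ hx hy =>
    obtain ⟨N, hN, h⟩ := hx
    obtain ⟨M, hM, h'⟩ := hy
    refine ⟨N * M, mul_ne_zero hN hM, ?_⟩
    rw [smul_add]
    refine add_mem ?_ ?_
    · rw [mul_comm, mul_smul]
      exact nsmul_mem h M
    · rw [mul_smul]
      exact nsmul_mem h' N
  | smul q x _ hx =>
    obtain ⟨N, hN, h⟩ := hx
    refine ⟨q.den * N, mul_ne_zero q.den_nz hN, ?_⟩
    have : (q.den * N) • q • x = q.num • N • x := by
      rw [← Nat.cast_smul_eq_nsmul ℚ (q.den * N), ← Nat.cast_smul_eq_nsmul ℚ N,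
        ← Int.cast_smul_eq_zsmul ℚ q.num, smul_smul, smul_smul]
      congr 1
      have := Rat.den_mul_eq_num q
      push_cast
      linear_combination (N : ℚ) * this
    rw [this]
    exact zsmul_mem h _

/-- The natural map from the complexification of the rational span of a lattice. -/
noncomputable def ratSpanMap (Λ : AddSubgroup E) : ℂ ⊗[ℚ] ratSpan Λ →ₗ[ℂ] E :=
  LinearMap.liftBaseChange ℂ (ratSpan Λ).subtype

omit [FiniteDimensional ℂ E] in
theorem ratSpanMap_tmul (Λ : AddSubgroup E) (z : ℂ) (v : ratSpan Λ) :
    ratSpanMap Λ (z ⊗ₜ v) = z • (v : E) := LinearMap.liftBaseChange_tmul ..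

omit [FiniteDimensional ℂ E] [NormedSpace ℂ E] in
theorem exists_tensor_repr {Λ : AddSubgroup E} {n : ℕ} {b : Fin n → E} (hb : ∀ i, b i ∈ Λ)
    (hs : ∀ x ∈ Λ, ∃ m : Fin n → ℤ, x = ∑ i, m i • b i) (x : ℂ ⊗[ℚ] ratSpan Λ) :
    ∃ z : Fin n → ℂ, x = ∑ i, z i ⊗ₜ ⟨b i, Submodule.subset_span (hb i)⟩ := by
  have hv : ∀ v ∈ ratSpan Λ, ∃ q : Fin n → ℚ, v = ∑ i, q i • b i := fun v hv => by
    have : ratSpan Λ ≤ Submodule.span ℚ (Set.range b) := Submodule.span_le.2 fun x hx => by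
      obtain ⟨m, rfl⟩ := hs x hx
      exact sum_mem fun i _ => zsmul_mem (Submodule.subset_span (Set.mem_range_self i)) _
    obtain ⟨q, hq⟩ := (Submodule.mem_span_range_iff_exists_fun ℚ).1 (this hv)
    exact ⟨q, hq.symm⟩
  induction x with
  | zero => exact ⟨0, by simp⟩
  | add x y hx hy =>
    obtain ⟨z, rfl⟩ := hx
    obtain ⟨w, rfl⟩ := hy
    exact ⟨z + w, by simp [add_tmul, Finset.sum_add_distrib]⟩
  | tmul z v =>
    obtain ⟨q, hq⟩ := hv v v.2
    have : v = ∑ i, q i • (⟨b i, Submodule.subset_span (hb i)⟩ : ratSpan Λ) := by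
      apply Subtype.ext
      rw [hq]
      simp
    refine ⟨fun i => q i • z, ?_⟩
    conv_lhs => rw [this, tmul_sum]
    exact Finset.sum_congr rfl fun i _ => by rw [smul_tmul]

instance (Λ : AddSubgroup E) [DiscreteTopology Λ] : FiniteDimensional ℚ (ratSpan Λ) := by
  obtain ⟨n, b, hb, -, hs⟩ := Λ.exists_basis_of_discrete
  have : ratSpan Λ = Submodule.span ℚ (Set.range b) := by
    refine le_antisymm (Submodule.span_le.2 fun x hx => ?_) (Submodule.span_mono ?_)
    · obtain ⟨m, rfl⟩ := hs x hx
      exact sum_mem fun i _ => zsmul_mem (Submodule.subset_span (Set.mem_range_self i)) _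
    · rintro _ ⟨i, rfl⟩
      exact hb i
  rw [this]
  exact FiniteDimensional.span_of_finite ℚ (Set.finite_range b)

/-- A real element has real coefficients on a lattice basis, and discreteness makes this basis
independent over ℝ. Adding `x` to its conjugate exhibits the coefficients of `2x` as real. -/
theorem ratSpanMap_injective_of_conj (Λ : AddSubgroup E) [DiscreteTopology Λ] {x : ℂ ⊗[ℚ] ratSpan Λ}
    (hx : complexConj _ x = x) (h : ratSpanMap Λ x = 0) : x = 0 := by
  obtain ⟨n, b, hb, hi, hs⟩ := Λ.exists_basis_of_discrete
  obtain ⟨z, hz⟩ := exists_tensor_repr hb hs x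
  have h2 : (2 : ℂ) • x =
      ∑ i, ((2 * (z i).re : ℝ) : ℂ) ⊗ₜ[ℚ] (⟨b i, Submodule.subset_span (hb i)⟩ : ratSpan Λ) := by
    rw [two_smul]
    nth_rewrite 2 [← hx]
    rw [hz, map_sum, ← Finset.sum_add_distrib]
    exact Finset.sum_congr rfl fun i _ => by rw [complexConj_tmul, ← add_tmul, Complex.add_conj]
  have h3 : ∑ i, (2 * (z i).re) • b i = 0 := by
    have := congrArg (ratSpanMap Λ) h2
    rw [map_smul, h, smul_zero, map_sum] at this
    rw [this]
    exact Finset.sum_congr rfl fun i _ => by rw [ratSpanMap_tmul, Complex.coe_smul]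
  have h4 := Fintype.linearIndependent_iff.1 hi _ h3
  have h5 : (2 : ℂ) • x = 0 := by
    rw [h2]
    exact Finset.sum_eq_zero fun i _ => by rw [h4 i, Complex.ofReal_zero, zero_tmul]
  exact (smul_eq_zero.1 h5).resolve_left two_ne_zero

omit [FiniteDimensional ℂ E] in
theorem ratSpanMap_mem (Λ : AddSubgroup E) (x : ℂ ⊗[ℚ] ratSpan Λ) :
    ratSpanMap Λ (x + complexConj _ x) ∈ Submodule.span ℝ (Λ : Set E) := by
  have hV : ∀ v ∈ ratSpan Λ, v ∈ Submodule.span ℝ (Λ : Set E) := fun v hv => by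
    induction hv using Submodule.span_induction with
    | mem x hx => exact Submodule.subset_span hx
    | zero => exact zero_mem _
    | add x y _ _ hx hy => exact add_mem hx hy
    | smul q x _ hx =>
      rw [← Rat.cast_smul_eq_qsmul ℝ]
      exact Submodule.smul_mem _ _ hx
  induction x with
  | zero => simp
  | add x y hx hy =>
    rw [map_add (complexConj _), add_add_add_comm, map_add]
    exact add_mem hx hy
  | tmul z v =>
    rw [complexConj_tmul, ← add_tmul, Complex.add_conj, ratSpanMap_tmul, Complex.coe_smul]
    exact Submodule.smul_mem _ _ (hV v v.2)

omit [FiniteDimensional ℂ E] in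
theorem exists_ratSpanMap_eq (Λ : AddSubgroup E) {y : E} (hy : y ∈ Submodule.span ℝ (Λ : Set E)) :
    ∃ x : ℂ ⊗[ℚ] ratSpan Λ, complexConj _ x = x ∧ ratSpanMap Λ x = y := by
  induction hy using Submodule.span_induction with
  | mem x hx =>
    exact ⟨1 ⊗ₜ ⟨x, Submodule.subset_span hx⟩, by rw [complexConj_tmul, map_one],
      by rw [ratSpanMap_tmul, one_smul]⟩
  | zero => exact ⟨0, by simp, by simp⟩
  | add x y _ _ hx hy =>
    obtain ⟨a, ha, rfl⟩ := hx
    obtain ⟨b, hb, rfl⟩ := hy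
    exact ⟨a + b, by rw [map_add, ha, hb], by rw [map_add]⟩
  | smul r x _ hx =>
    obtain ⟨a, ha, rfl⟩ := hx
    exact ⟨(r : ℂ) • a, by rw [complexConj_smul, ha, Complex.conj_ofReal],
      by rw [map_smul, Complex.coe_smul]⟩

end

/-! ### The CR form of a Hermitian inner product -/

section
variable {U : Type} [AddCommGroup U] [Module ℂ U] {h : InnerProductSpace.Core ℂ U}
  {T : Submodule ℝ U}

theorem reForm_apply (x y : U) : reForm h x y = (h.inner x y).re := rfl

theorem reForm_comm (x y : U) : reForm h x y = reForm h y x := by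
  rw [reForm_apply, reForm_apply, ← h.conj_inner_symm x y, Complex.conj_re]

theorem reForm_self_pos {x : U} (hx : x ≠ 0) : 0 < reForm h x x := by
  have h1 : 0 ≤ (h.inner x x).re := h.re_inner_nonneg x
  refine lt_of_le_of_ne h1 fun h0 => hx (h.definite x (Complex.ext h0.symm ?_))
  exact Complex.conj_eq_iff_im.1 (h.conj_inner_symm x x)

theorem reForm_I_smul (x y : U) : reForm h (Complex.I • x) (Complex.I • y) = reForm h x y := by
  have h1 : h.inner (Complex.I • x) (Complex.I • y) = h.inner x y := by
    rw [h.smul_left, ← h.conj_inner_symm x (Complex.I • y), h.smul_left, map_mul, h.conj_inner_symm,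
      Complex.conj_conj, Complex.conj_I, ← mul_assoc, neg_mul, Complex.I_mul_I, neg_neg, one_mul]
  rw [reForm_apply, h1, reForm_apply]

theorem crCocomplex_le : crCocomplex h T ≤ T := inf_le_left

theorem mem_crCocomplex {y : U} : y ∈ crCocomplex h T ↔
    y ∈ T ∧ ∀ x ∈ crComplex T, reForm h x y = 0 := Iff.rfl

variable [FiniteDimensional ℂ U]

theorem eq_zero_of_mem_crCocomplex {y : U} (hy : y ∈ crComplex T) (hy' : y ∈ crCocomplex h T) :
    y = 0 :=
  Submodule.disjoint_def.1 (isCompl_crComplex h T).disjoint y hy hy'.2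

theorem le_crComplex_sup_crCocomplex : T ≤ crComplex T ⊔ crCocomplex h T := fun y hy => by
  have : y ∈ crComplex T ⊔ (reForm h).orthogonal (crComplex T) := by
    rw [(isCompl_crComplex h T).sup_eq_top]
    trivial
  obtain ⟨a, ha, b, hb, rfl⟩ := Submodule.mem_sup.1 this
  refine Submodule.add_mem_sup ha ⟨?_, hb⟩
  simpa using sub_mem hy ((mem_crComplex.1 ha).1 : a ∈ T)

theorem crForm_apply (x y : U) : crForm h T x y =
    reForm h (x - Submodule.projection _ _ (isCompl_crComplex h T) x)
      (y - Submodule.projection _ _ (isCompl_crComplex h T) y) -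
    reForm h (Submodule.projection _ _ (isCompl_crComplex h T) x)
      (Submodule.projection _ _ (isCompl_crComplex h T) y) := rfl

theorem crForm_comm (x y : U) : crForm h T x y = crForm h T y x := by
  rw [crForm_apply, crForm_apply, reForm_comm, reForm_comm (Submodule.projection _ _ _ x)]

theorem crForm_add {a b a' b' : U} (ha : a ∈ crComplex T) (hb : b ∈ crCocomplex h T)
    (ha' : a' ∈ crComplex T) (hb' : b' ∈ crCocomplex h T) :
    crForm h T (a + b) (a' + b') = reForm h b b' - reForm h a a' := by
  have key : ∀ a ∈ crComplex T, ∀ b ∈ crCocomplex h T,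
      Submodule.projection _ _ (isCompl_crComplex h T) (a + b) = a := fun a ha b hb => by
    rw [map_add, Submodule.projection_apply_of_mem_left _ ha,
        Submodule.projection_apply_of_mem_right _ hb.2, add_zero]
  rw [crForm_apply, key a ha b hb, key a' ha' b' hb', add_sub_cancel_left, add_sub_cancel_left]

theorem crForm_crComplex {a a' : U} (ha : a ∈ crComplex T) (ha' : a' ∈ crComplex T) :
    crForm h T a a' = -reForm h a a' := by
  simpa using crForm_add (h := h) ha (zero_mem _) ha' (zero_mem _)

theorem crForm_crCocomplex {b b' : U} (hb : b ∈ crCocomplex h T) (hb' : b' ∈ crCocomplex h T) :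
    crForm h T b b' = reForm h b b' := by
  simpa using crForm_add (h := h) (zero_mem _) hb (zero_mem _) hb'

theorem crForm_mixed {a b : U} (ha : a ∈ crComplex T) (hb : b ∈ crCocomplex h T) :
    crForm h T a b = 0 := by
  simpa using crForm_add (h := h) ha (zero_mem _) (zero_mem _) hb

end

/-! ### The CR datum and rational form of a lattice -/

section
variable {E : Type} [NormedAddCommGroup E] [NormedSpace ℂ E] [FiniteDimensional ℂ E] [Module ℚ E]

/-- The `CRDatum` of a lattice and a Hermitian inner product. -/
noncomputable def latticeDatum (Λ : AddSubgroup E) [DiscreteTopology Λ]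
    (h : InnerProductSpace.Core ℂ E) (T : Submodule ℝ E) (hT : T = Submodule.span ℝ (Λ : Set E)) :
    CRDatum (ratSpan Λ) E where
  φ := ratSpanMap Λ
  T := T
  F := crCocomplex h T
  inj _ := ratSpanMap_injective_of_conj Λ
  mem_T x hx := by
    have := ratSpanMap_mem Λ x
    rw [hx, ← two_smul ℝ, LinearMap.map_smul_of_tower] at this
    rw [hT]
    exact (Submodule.smul_mem_iff _ two_ne_zero).1 this
  exists_real y hy := exists_ratSpanMap_eq Λ (hT ▸ hy)
  F_le := crCocomplex_le
  disjoint _ := eq_zero_of_mem_crCocomplex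
  le_sup := le_crComplex_sup_crCocomplex

omit [FiniteDimensional ℂ E] in
-- Clear denominators to reach lattice vectors, then polarize the rational quadratic form.
theorem bilin_rational {Λ : AddSubgroup E} {B : LinearMap.BilinForm ℝ E} (hs : ∀ x y, B x y = B y x)
    (hB : ∀ v ∈ Λ, ∃ q : ℚ, B v v = q) {u v : E} (hu : u ∈ ratSpan Λ) (hv : v ∈ ratSpan Λ) :
    ∃ q : ℚ, B u v = q := by
  obtain ⟨N, hN, hu'⟩ := exists_smul_mem_of_mem_ratSpan hu
  obtain ⟨M, hM, hv'⟩ := exists_smul_mem_of_mem_ratSpan hv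
  obtain ⟨a, ha⟩ := hB _ hu'
  obtain ⟨b, hb⟩ := hB _ hv'
  obtain ⟨d, hd⟩ := hB _ (add_mem hu' hv')
  refine ⟨(d - a - b) / 2 / N / M, ?_⟩
  have hN' : (N : ℝ) ≠ 0 := by exact_mod_cast hN
  have hM' : (M : ℝ) ≠ 0 := by exact_mod_cast hM
  rw [map_add B, LinearMap.add_apply, map_add, map_add, ha, hb, hs (M • v) (N • u)] at hd
  simp only [map_nsmul, LinearMap.smul_apply, nsmul_eq_mul] at hd
  push_cast
  field_simp
  linear_combination hd

/-- The rational form of a lattice with a Hermitian inner product whose CR form is rational. -/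
noncomputable def latticeForm (Λ : AddSubgroup E) [DiscreteTopology Λ]
    (h : InnerProductSpace.Core ℂ E) (T : Submodule ℝ E) (hT : T = Submodule.span ℝ (Λ : Set E))
    (hB : ∀ v ∈ Λ, ∃ q : ℚ, crForm h T v v = q) : (latticeDatum Λ h T hT).Form where
  B := crForm h T
  symm := crForm_comm
  rational u v := by
    have : ∀ u : ratSpan Λ, (latticeDatum Λ h T hT).φ (1 ⊗ₜ u) = u := fun u =>
      (ratSpanMap_tmul Λ 1 u).trans (one_smul _ _)
    rw [this, this]
    exact bilin_rational crForm_comm hB u.2 v.2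
  orthogonal _ hx _ hy := crForm_mixed hx hy
  I_smul x hx y hy := by
    refine (crForm_crComplex (I_smul_mem_crComplex hx) (I_smul_mem_crComplex hy)).trans ?_
    rw [reForm_I_smul]
    exact (crForm_crComplex hx hy).symm
  neg x hx h0 := by
    exact (crForm_crComplex hx hx).trans_lt (neg_neg_of_pos (reForm_self_pos h0))
  pos x hx h0 := by
    exact (reForm_self_pos h0).trans_eq (crForm_crCocomplex hx hx).symm

theorem latticeDatum_apply (Λ : AddSubgroup E) [DiscreteTopology Λ]
    (h : InnerProductSpace.Core ℂ E) (T : Submodule ℝ E) (hT : T = Submodule.span ℝ (Λ : Set E))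
    (u : ratSpan Λ) : (latticeDatum Λ h T hT).φ (1 ⊗ₜ u) = u :=
  (ratSpanMap_tmul Λ 1 u).trans (one_smul _ _)

end

/-! ### Consequences of the constancy of holomorphic functions for the lattice -/

namespace IsExp
section
variable {E : Type} [NormedAddCommGroup E] [NormedSpace ℂ E]
  {G : Type} [TopologicalSpace G] [ChartedSpace E G] [Group G] [LieGroup 𝓘(ℂ, E) ω G]
  [FiniteDimensional ℂ E] {p : E → G}

/-- Functions which are periodic with respect to the kernel of the exponential map descend. -/
theorem exists_descend [ConnectedSpace G] (hp : IsExp p) {F Z : Type} [NormedAddCommGroup F]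
    [NormedSpace ℂ F] [TopologicalSpace Z] [ChartedSpace F Z] {f : E → Z}
    (hf : ContMDiff 𝓘(ℂ, E) 𝓘(ℂ, F) ω f) (h : ∀ x, ∀ y ∈ hp.kernel, f (x + y) = f x) :
    ∃ g : G → Z, ContMDiff 𝓘(ℂ, E) 𝓘(ℂ, F) ω g ∧ ∀ x, g (p x) = f x := by
  have hg : ∀ x, f (Function.surjInv hp.surjective (p x)) = f x := fun x => by
    have h1 : Function.surjInv hp.surjective (p x) - x ∈ hp.kernel :=
      hp.sub_mem_kernel.2 (Function.surjInv_eq hp.surjective _)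
    rw [← h x _ h1, add_sub_cancel]
  refine ⟨fun y => f (Function.surjInv hp.surjective y), fun a => ?_, hg⟩
  obtain ⟨x, rfl⟩ := hp.surjective a
  obtain ⟨l, hl, hl1, hl2, -⟩ := hp.exists_log
  have hL : ContMDiff 𝓘(ℂ, E) 𝓘(ℂ, E) ω fun y : G => (p x)⁻¹ * y := contMDiff_const.mul contMDiff_id
  have hx1 : (p x)⁻¹ * p x = 1 := inv_mul_cancel _
  have hl' : ContMDiffAt 𝓘(ℂ, E) 𝓘(ℂ, E) ω (fun y : G => x + l ((p x)⁻¹ * y)) (p x) := by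
    refine contMDiffAt_const.add (ContMDiffAt.comp (p x) (g := l) ?_ (hL (p x)))
    rw [hx1]
    exact hl
  refine (ContMDiffAt.comp (p x) (hf _) hl').congr_of_eventuallyEq ?_
  have ht : Filter.Tendsto (fun y : G => (p x)⁻¹ * y) (nhds (p x)) (nhds 1) := by
    have := (hL (p x)).continuousAt
    rwa [ContinuousAt, hx1] at this
  filter_upwards [ht.eventually hl2] with y hy
  have : p (x + l ((p x)⁻¹ * y)) = y := by rw [hp.map_add, hy, mul_inv_cancel_left]
  conv_lhs => rw [← this]
  exact hg _

/-- If all holomorphic functions are constant, then no nonzero linear form is integral on the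
lattice. -/
theorem eq_zero_of_integral [ConnectedSpace G] (hp : IsExp p) (hG : HolomorphicConstant E G)
    {l : E →ₗ[ℂ] ℂ} (h : ∀ x ∈ hp.kernel, ∃ n : ℤ, l x = n) : l = 0 := by
  have hsm : ContDiff ℂ ω fun x => Complex.exp
      (2 * Real.pi * Complex.I * l.toContinuousLinearMap x) := by
    fun_prop
  obtain ⟨g, hg, hgp⟩ := hp.exists_descend hsm.contMDiff fun x y hy => by
    obtain ⟨n, hn⟩ := h y hy
    have : l.toContinuousLinearMap y = n := hn
    rw [map_add, mul_add, Complex.exp_add, this]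
    rw [_root_.mul_comm _ (n : ℂ), Complex.exp_int_mul_two_pi_mul_I, mul_one]
  obtain ⟨a, ha⟩ := hG g (hg.mdifferentiable (by simp))
  have h1 : ∀ x, Complex.exp (2 * Real.pi * Complex.I * l x) = 1 := fun x => by
    have e1 := (hgp x).symm.trans (ha _)
    have e0 := (hgp 0).symm.trans (ha _)
    rw [map_zero, mul_zero, Complex.exp_zero] at e0
    exact e1.trans e0.symm
  by_contra hne
  obtain ⟨x, hx⟩ : ∃ x, l x ≠ 0 := by
    by_contra! hcon
    exact hne (LinearMap.ext hcon)
  -- At this point `l` takes the value `i`, where the exponential is `exp (-2π)`, of norm different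
  -- from `1`.
  have h2 := h1 ((Complex.I * (l x)⁻¹) • x)
  rw [map_smul, smul_eq_mul, mul_assoc Complex.I, inv_mul_cancel₀ hx, mul_one, mul_assoc,
      Complex.I_mul_I] at h2
  have h3 := congrArg norm h2
  rw [Complex.norm_exp, norm_one, Real.exp_eq_one_iff] at h3
  have : (2 * (Real.pi : ℂ) * -1).re = -(2 * Real.pi) := by simp
  rw [this] at h3
  linarith [Real.pi_pos]

instance (hp : IsExp p) : DiscreteTopology hp.kernel := hp.discreteTopology

variable [Module ℚ E]

/-- A complex linear form vanishing on the image vanishes on the lattice, so it is integral there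
and hence zero. -/
theorem ratSpanMap_surjective [ConnectedSpace G] (hp : IsExp p) (hG : HolomorphicConstant E G) :
    Function.Surjective (ratSpanMap hp.kernel) := by
  rw [← LinearMap.range_eq_top]
  by_contra hne
  obtain ⟨l, hl, hle⟩ := Submodule.exists_le_ker_of_lt_top _ (lt_top_iff_ne_top.2 hne)
  refine hl (hp.eq_zero_of_integral hG fun x hx => ⟨0, ?_⟩)
  have : ratSpanMap hp.kernel (1 ⊗ₜ ⟨x, Submodule.subset_span hx⟩) = x := by
    rw [ratSpanMap_tmul, one_smul]
  rw [Int.cast_zero]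
  exact hle ⟨_, this⟩

/-- Multiplying `l` by the product of the denominators of `μ` on a lattice basis makes it integral
on the lattice. -/
theorem eq_zero_of_rational [ConnectedSpace G] (hp : IsExp p) (hG : HolomorphicConstant E G)
    (l : E →ₗ[ℂ] ℂ) (μ : ratSpan hp.kernel →ₗ[ℚ] ℚ) (h : ∀ v : ratSpan hp.kernel, l v = μ v) :
    μ = 0 := by
  obtain ⟨n, b, hb, -, hs⟩ := hp.kernel.exists_basis_of_discrete
  have h1 : ((∏ i, (μ ⟨b i, Submodule.subset_span (hb i)⟩).den : ℕ) : ℂ) • l = 0 := by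
    refine hp.eq_zero_of_integral hG fun x hx => ?_
    obtain ⟨m, rfl⟩ := hs x hx
    have hi : ∀ i, ∃ k : ℤ, (((∏ i, (μ ⟨b i, Submodule.subset_span (hb i)⟩).den : ℕ) : ℂ) • l)
        (b i) = k := by
      intro i
      obtain ⟨d, hd⟩ := Finset.dvd_prod_of_mem (fun i => (μ ⟨b i, Submodule.subset_span
          (hb i)⟩).den)
        (Finset.mem_univ i)
      refine ⟨(μ ⟨b i, Submodule.subset_span (hb i)⟩).num * d, ?_⟩
      rw [LinearMap.smul_apply, h ⟨b i, Submodule.subset_span (hb i)⟩, hd, smul_eq_mul]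
      have := Rat.den_mul_eq_num (μ ⟨b i, Submodule.subset_span (hb i)⟩)
      have := congrArg (Rat.cast : ℚ → ℂ) this
      push_cast at this ⊢
      linear_combination (d : ℂ) * this
    choose k hk using hi
    refine ⟨∑ i, m i * k i, ?_⟩
    rw [map_sum]
    rw [Int.cast_sum]
    exact Finset.sum_congr rfl fun i _ => by rw [map_zsmul, hk, zsmul_eq_mul, Int.cast_mul]
  have h2 : l = 0 := (smul_eq_zero.1 h1).resolve_left
    (Nat.cast_ne_zero.2 (Finset.prod_ne_zero_iff.2 fun i _ => Rat.den_nz _))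
  ext v
  have := h v
  rw [h2, LinearMap.zero_apply] at this
  exact_mod_cast this.symm

/-- The target has no part of bidegree `(0, 2)`, so `f` kills the kernel of `V_ℂ → E`. Hence the
composite of `f` with any rational form on `W` extends to a complex linear form on `E`, and vanishes
by `eq_zero_of_rational`; but `f` is onto. -/
theorem noWeightZeroQuotient [ConnectedSpace G] (hp : IsExp p) (hG : HolomorphicConstant E G)
    (h : InnerProductSpace.Core ℂ E) (T : Submodule ℝ E)
    (hT : T = Submodule.span ℝ (hp.kernel : Set E)) :
    (latticeDatum hp.kernel h T hT).toHodge.NoWeightZeroQuotient := by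
  intro W f hf
  by_contra hW
  rw [not_subsingleton_iff_nontrivial] at hW
  obtain ⟨w, hw⟩ := exists_ne (0 : W.V)
  obtain ⟨ν, hν⟩ : ∃ ν : Module.Dual ℚ W.V, ν w ≠ 0 := by
    by_contra! hcon
    exact hw ((Module.forall_dual_apply_eq_zero_iff ℚ w).1 hcon)
  let F : ratSpan hp.kernel →ₗ[ℚ] W.V := f.toLinearMap
  let μ : ratSpan hp.kernel →ₗ[ℚ] ℚ := ν ∘ₗ F
  have hF : ∀ x, ratSpanMap hp.kernel x = 0 → F.baseChange ℂ x = 0 := fun x hx =>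
    (Submodule.mem_bot ℂ).1 (f.map_piece 0 2 x hx)
  let μ' : ℂ ⊗[ℚ] ratSpan hp.kernel →ₗ[ℂ] ℂ :=
    (LinearMap.liftBaseChange ℂ ((Algebra.linearMap ℚ ℂ) ∘ₗ ν)) ∘ₗ F.baseChange ℂ
  obtain ⟨s, hs⟩ := (ratSpanMap hp.kernel).exists_rightInverse_of_surjective
    (LinearMap.range_eq_top.2 (hp.ratSpanMap_surjective hG))
  have hμ : μ = 0 := by
    refine hp.eq_zero_of_rational hG (μ' ∘ₗ s) μ fun v => ?_
    have h1 : ratSpanMap hp.kernel (s v - 1 ⊗ₜ v) = 0 := by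
      rw [_root_.map_sub, ratSpanMap_tmul, one_smul, sub_eq_zero]
      exact LinearMap.congr_fun hs _
    have h2 := hF _ h1
    rw [_root_.map_sub, sub_eq_zero] at h2
    change LinearMap.liftBaseChange ℂ _ (F.baseChange ℂ (s v)) = _
    rw [h2, LinearMap.baseChange_tmul, LinearMap.liftBaseChange_tmul, one_smul]
    rfl
  obtain ⟨v, hv⟩ := hf w
  apply hν
  have : μ v = 0 := LinearMap.congr_fun hμ v
  rw [← hv]
  exact this

end
end IsExp

/-! ### The functor from abelian Cousin groups to polarized Hodge structures -/

namespace AbelianCousinGroup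
variable (X Y Z : AbelianCousinGroup)

noncomputable instance : Module ℚ X.E := Module.compHom X.E (algebraMap ℚ ℂ)

/-- The exponential map. -/
noncomputable def exp : X.E → X.G := X.holomorphicConstant.exists_isCentralHom_id.choose

theorem isExp : IsExp X.exp := X.holomorphicConstant.exists_isCentralHom_id.choose_spec

/-- The kernel of the exponential map. -/
noncomputable def lattice : AddSubgroup X.E := X.isExp.kernel

instance : DiscreteTopology X.lattice := X.isExp.discreteTopology

theorem K_eq : X.K = X.isExp.core := X.isExp.eq_core X.maximal_compact

theorem T_eq : X.T = Submodule.span ℝ (X.lattice : Set X.E) := by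
  rw [T, K_eq]
  exact X.isExp.tangentAtOne_core

theorem rational_of_mem_lattice (v : X.E) (hv : v ∈ X.lattice) :
    ∃ q : ℚ, crForm X.metric X.T v v = q := by
  -- The form itself depends on `K` through its tangent space, so it is made arbitrary before `K` is
  -- replaced.
  have key : ∀ K, K = X.isExp.core → ∀ B : LinearMap.BilinForm ℝ X.E, (∀ x y, B x y = B y x) →
      IsPolarizedIn X.E K B → ∃ q : ℚ, B v v = q := by
    rintro _ rfl B hB h
    exact (X.isExp.isPolarizedIn_core B hB).1 h v hv
  exact key _ X.K_eq _ crForm_comm X.polarized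

/-- The linear algebra data of an abelian Cousin group. -/
noncomputable def datum : CRDatum (ratSpan X.lattice) X.E :=
  latticeDatum X.lattice X.metric X.T X.T_eq

/-- The rational form of an abelian Cousin group. -/
noncomputable def form : X.datum.Form :=
  latticeForm X.lattice X.metric X.T X.T_eq X.rational_of_mem_lattice

theorem datum_apply (v : ratSpan X.lattice) : X.datum.φ (1 ⊗ₜ v) = v :=
  latticeDatum_apply _ _ _ _ v

theorem datum_surjective : Function.Surjective X.datum.φ :=
  X.isExp.ratSpanMap_surjective X.holomorphicConstant

theorem form_Q (u v : ratSpan X.lattice) :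
    ((X.form.Q u v : ℚ) : ℝ) = crForm X.metric X.T u v := by
  rw [CRDatum.Form.Q_apply, datum_apply, datum_apply]
  rfl

theorem noWeightZeroQuotient : X.datum.toHodge.NoWeightZeroQuotient :=
  X.isExp.noWeightZeroQuotient X.holomorphicConstant X.metric X.T X.T_eq

variable {X Y Z}

theorem hasMFDerivAt_hom (f : X ⟶ Y) :
    HasMFDerivAt 𝓘(ℂ, X.E) 𝓘(ℂ, Y.E) (hom f) 1 (differential X Y (hom f)) :=
  ((Hom.contMDiff f).mdifferentiable (by simp) 1).hasMFDerivAt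

/-- Both sides are homomorphisms from `X.E` with the same differential at the origin. -/
theorem hom_exp (f : X ⟶ Y) (x : X.E) :
    hom f (X.exp x) = Y.exp (differential X Y (hom f) x) := by
  have h1 : HasMFDerivAt 𝓘(ℝ, X.E) 𝓘(ℝ, Y.E) (fun x => hom f (X.exp x)) 0
      ((differential X Y (hom f)).restrictScalars ℝ) := by
    have hd : ∀ a : X.G, a = 1 → HasMFDerivAt 𝓘(ℂ, X.E) 𝓘(ℂ, Y.E) (hom f) a
        (differential X Y (hom f)) := by
      rintro a rfl
      exact hasMFDerivAt_hom f
    exact (HasMFDerivAt.comp (0 : X.E) (hd _ X.isExp.map_zero) X.isExp.hasMFDerivAt).complexToReal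
  have h2 : HasMFDerivAt 𝓘(ℝ, X.E) 𝓘(ℝ, Y.E) (fun x => Y.exp (differential X Y (hom f) x)) 0
      ((differential X Y (hom f)).restrictScalars ℝ) :=
    Y.isExp.hasMFDerivAt_comp
      (((differential X Y (hom f)).restrictScalars ℝ).hasFDerivAt (x := 0)) (map_zero _)
  exact congrFun (IsExp.hom_ext (fun x y => by rw [X.isExp.map_add, map_mul])
    (fun x y => by rw [map_add, Y.isExp.map_add]) h1 h2) x

theorem differential_mem_lattice (f : X ⟶ Y) {x : X.E} (hx : x ∈ X.lattice) :
    differential X Y (hom f) x ∈ Y.lattice := by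
  change Y.exp _ = 1
  rw [← hom_exp, show X.exp x = 1 from hx, map_one]

theorem differential_mem_ratSpan (f : X ⟶ Y) (x : X.E) (hx : x ∈ ratSpan X.lattice) :
    ((differential X Y (hom f)).toLinearMap.restrictScalars ℚ) x ∈ ratSpan Y.lattice := by
  suffices ratSpan X.lattice ≤
    (ratSpan Y.lattice).comap ((differential X Y
        (hom f)).toLinearMap.restrictScalars ℚ) from this hx
  exact Submodule.span_le.2 fun x hx => Submodule.subset_span (differential_mem_lattice f hx)

/-- The rational linear map induced by a morphism. -/
noncomputable def ratMap (f : X ⟶ Y) : ratSpan X.lattice →ₗ[ℚ] ratSpan Y.lattice :=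
  ((differential X Y (hom f)).toLinearMap.restrictScalars ℚ).restrict (differential_mem_ratSpan f)

/-- The functor to polarized Hodge structures. -/
noncomputable def hodge : AbelianCousinGroup ⥤ PolHodgeStructure 2 where
  obj X := X.form.toPol
  map {X Y} f := CRDatum.homOf (ratMap f) (differential X Y (hom f)).toLinearMap
    (fun v => by rw [datum_apply, datum_apply]; rfl) (Hom.map_cocomplex f)
  map_id X := by
    apply RatHodgeStructure.Hom.ext
    refine LinearMap.ext fun v : ratSpan X.lattice => Subtype.ext ?_
    exact differential_id X v
  map_comp f g := by
    apply RatHodgeStructure.Hom.ext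
    refine LinearMap.ext fun v => Subtype.ext ?_
    exact differential_comp f g _

end AbelianCousinGroup

/-! ### Inverses of bijective morphisms of Hodge structures -/

namespace RatHodgeStructure
variable {X Y : RatHodgeStructure 2}

/-- A bijective morphism of Hodge structures has an inverse. -/
theorem Hom.exists_inverse (f : Hom X Y) (hf : Function.Bijective f.toLinearMap) :
    ∃ g : Hom Y X, g.toLinearMap ∘ₗ f.toLinearMap = LinearMap.id ∧
      f.toLinearMap ∘ₗ g.toLinearMap = LinearMap.id := by
  let e : X.V ≃ₗ[ℚ] Y.V := LinearEquiv.ofBijective f.toLinearMap hf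
  have h1 : e.symm.toLinearMap ∘ₗ f.toLinearMap = LinearMap.id := LinearMap.ext e.symm_apply_apply
  have h2 : f.toLinearMap ∘ₗ e.symm.toLinearMap = LinearMap.id := LinearMap.ext e.apply_symm_apply
  have h1' : ∀ x, e.symm.toLinearMap.baseChange ℂ (f.toLinearMap.baseChange ℂ x) = x := fun x => by
    rw [← LinearMap.comp_apply, ← LinearMap.baseChange_comp, h1, LinearMap.baseChange_id,
      LinearMap.id_apply]
  have h2' : ∀ x, f.toLinearMap.baseChange ℂ (e.symm.toLinearMap.baseChange ℂ x) = x := fun x => by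
    rw [← LinearMap.comp_apply, ← LinearMap.baseChange_comp, h2, LinearMap.baseChange_id,
      LinearMap.id_apply]
  have hz : ∀ x, f.toLinearMap.baseChange ℂ x = 0 → x = 0 := fun x hx => by
    rw [← h1' x, hx, map_zero]
  refine ⟨⟨e.symm.toLinearMap, fun p q y hy => ?_⟩, h1, h2⟩
  by_cases hpq : p + q = 2
  swap
  · rw [Y.piece_eq_bot p q hpq, Submodule.mem_bot] at hy
    rw [hy, map_zero]
    exact zero_mem _
  -- The images of the three components of the preimage add up to `y`, which has a single type; the
  -- other two images vanish, hence so do those components.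
  obtain ⟨a, ha, b, hb, d, hd, habd⟩ := X.exists_three (e.symm.toLinearMap.baseChange ℂ y)
  have hy' := h2' y
  rw [habd, map_add, map_add] at hy'
  have ha' := f.map_piece 2 0 a ha
  have hb' := f.map_piece 1 1 b hb
  have hd' := f.map_piece 0 2 d hd
  obtain ⟨rfl, rfl⟩ | ⟨rfl, rfl⟩ | ⟨rfl, rfl⟩ :
    (p = 2 ∧ q = 0) ∨ (p = 1 ∧ q = 1) ∨ (p = 0 ∧ q = 2) := by omega
  · obtain ⟨-, h3, h4⟩ := Y.eq_zero_of_sum_eq_zero (sub_mem ha' hy) hb' hd' (by rw [← hy']; abel)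
    rw [habd, hz b h3, hz d h4, add_zero, add_zero]
    exact ha
  · obtain ⟨h3, -, h4⟩ := Y.eq_zero_of_sum_eq_zero ha' (sub_mem hb' hy) hd' (by rw [← hy']; abel)
    rw [habd, hz a h3, hz d h4, zero_add, add_zero]
    exact hb
  · obtain ⟨h3, h4, -⟩ := Y.eq_zero_of_sum_eq_zero ha' hb' (sub_mem hd' hy) (by rw [← hy']; abel)
    rw [habd, hz a h3, hz b h4, zero_add, zero_add]
    exact hd

end RatHodgeStructure

/-! ### Rescaling the metric -/

section
variable {U : Type} [AddCommGroup U] [Module ℂ U]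

/-- A positive multiple of a Hermitian inner product. -/
@[reducible] noncomputable def scaleCore (h : InnerProductSpace.Core ℂ U) (r : ℝ) (hr : 0 < r) :
    InnerProductSpace.Core ℂ U where
  inner x y := (r : ℂ) * h.inner x y
  conj_inner_symm x y := by rw [map_mul, Complex.conj_ofReal, h.conj_inner_symm]
  re_inner_nonneg x := by
    have h1 : 0 ≤ (h.inner x x).re := h.re_inner_nonneg x
    have : ((r : ℂ) * h.inner x x).re = r * (h.inner x x).re := Complex.re_ofReal_mul _ _
    exact (mul_nonneg hr.le h1).trans_eq this.symm
  add_left x y z := by rw [h.add_left, mul_add]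
  smul_left x y z := by rw [h.smul_left]; ring
  definite x hx := h.definite x
    ((mul_eq_zero.1 hx).resolve_left (Complex.ofReal_ne_zero.2 hr.ne'))

variable {h : InnerProductSpace.Core ℂ U} {r : ℝ} {hr : 0 < r} {T : Submodule ℝ U}

theorem reForm_scaleCore (x y : U) : reForm (scaleCore h r hr) x y = r * reForm h x y :=
  Complex.re_ofReal_mul _ _

theorem crCocomplex_scaleCore : crCocomplex (scaleCore h r hr) T = crCocomplex h T := by
  ext y
  simp only [mem_crCocomplex, reForm_scaleCore, mul_eq_zero, hr.ne', false_or]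

theorem crForm_scaleCore [FiniteDimensional ℂ U] {x y : U} (hx : x ∈ T) (hy : y ∈ T) :
    crForm (scaleCore h r hr) T x y = r * crForm h T x y := by
  obtain ⟨a, ha, b, hb, rfl⟩ := Submodule.mem_sup.1 (le_crComplex_sup_crCocomplex (h := h) hx)
  obtain ⟨a', ha', b', hb', rfl⟩ := Submodule.mem_sup.1 (le_crComplex_sup_crCocomplex (h := h) hy)
  have e : ∀ y ∈ crCocomplex h T, y ∈ crCocomplex (scaleCore h r hr) T := fun y hy => by
    rwa [crCocomplex_scaleCore]
  rw [crForm_add ha hb ha' hb', crForm_add ha (e b hb) ha' (e b' hb'), reForm_scaleCore,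
      reForm_scaleCore, mul_sub]

end

/-! ### Morphisms and isogenies in terms of lattices -/

namespace AbelianCousinGroup
variable {X Y : AbelianCousinGroup}

/-- The lattice spans `X.E` over ℂ, by the surjectivity of `V_ℂ → E`. -/
theorem linearMap_ext {W : Type} [AddCommGroup W] [Module ℂ W] {L L' : X.E →ₗ[ℂ] W}
    (h : ∀ v ∈ X.lattice, L v = L' v) : L = L' := by
  have h' : ∀ v ∈ ratSpan X.lattice, L v = L' v := fun v hv => by
    obtain ⟨N, hN, hv'⟩ := exists_smul_mem_of_mem_ratSpan hv
    have := h _ hv'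
    rw [← Nat.cast_smul_eq_nsmul ℂ, map_smul, map_smul] at this
    exact smul_right_injective _ (Nat.cast_ne_zero.2 hN) this
  ext x
  obtain ⟨x, rfl⟩ := X.datum_surjective x
  induction x with
  | zero => simp
  | add x y hx hy => simp only [map_add, hx, hy]
  | tmul z v =>
    have : X.datum.φ (z ⊗ₜ v) = z • (v : X.E) := ratSpanMap_tmul _ _ _
    rw [this, map_smul, map_smul, h' v v.2]

theorem exp_surjective : Function.Surjective X.exp := X.isExp.surjective

theorem mem_lattice {x : X.E} : x ∈ X.lattice ↔ X.exp x = 1 := Iff.rfl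

theorem exp_smul (N : ℕ) (x : X.E) : X.exp (N • x) = X.exp x ^ N := by
  induction N with
  | zero => rw [zero_smul, X.isExp.map_zero, pow_zero]
  | succ N ih => rw [succ_nsmul, X.isExp.map_add, ih, pow_succ]

/-- Morphisms are determined by their differentials. -/
theorem hom_ext' {f g : X ⟶ Y}
    (h : ∀ v ∈ X.lattice, differential X Y (hom f) v = differential X Y (hom g) v) : f = g := by
  have h' : (differential X Y (hom f)).toLinearMap = (differential X Y (hom g)).toLinearMap :=
    linearMap_ext h
  apply Hom.ext
  refine MonoidHom.ext fun a => ?_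
  obtain ⟨x, rfl⟩ := exp_surjective a
  exact (hom_exp f x).trans ((congrArg Y.exp (LinearMap.congr_fun h' x)).trans (hom_exp g x).symm)

instance : hodge.Faithful where
  map_injective {X Y} f g hfg := by
    have h1 : ratMap f = ratMap g := congrArg RatHodgeStructure.Hom.toLinearMap hfg
    refine hom_ext' fun v hv => ?_
    exact congrArg Subtype.val (LinearMap.congr_fun h1 ⟨v, Submodule.subset_span hv⟩)

/-- `X.exp x` lies in the kernel of the homomorphism, where every element is killed by the order of
the kernel. -/
theorem exists_smul_mem_lattice {f : X ⟶ Y} {x : X.E}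
    (hx : differential X Y (hom f) x ∈ Y.lattice) :
    Nat.card (hom f).ker • x ∈ X.lattice := by
  have h1 : X.exp x ∈ (hom f).ker := by
    rw [MonoidHom.mem_ker, hom_exp]
    exact hx
  have h2 : (⟨X.exp x, h1⟩ : (hom f).ker) ^ Nat.card (hom f).ker = 1 := pow_card_eq_one'
  rw [mem_lattice, exp_smul]
  exact congrArg Subtype.val h2

/-- If the differential kills `x`, it kills the whole line through `x`, and a fixed multiple of this
line lies in the discrete lattice. -/
theorem differential_injective {f : X ⟶ Y} (hf : Finite (hom f).ker) :
    Function.Injective (differential X Y (hom f)) := by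
  rw [injective_iff_map_eq_zero]
  intro x hx
  obtain ⟨U, hU, h0⟩ := X.isExp.exists_ball_kernel
  have h1 : ∀ t : ℝ, t • Nat.card (hom f).ker • x ∈ X.lattice := fun t => by
    rw [smul_comm]
    refine exists_smul_mem_lattice ?_
    have : differential X Y (hom f) (t • x) = 0 := by
      rw [← Complex.coe_smul, map_smul, hx, smul_zero]
    rw [this]
    exact zero_mem _
  have h2 : Filter.Tendsto (fun t : ℝ => t • Nat.card (hom f).ker • x) (nhdsWithin 0 {0}ᶜ)
      (nhds 0) := by
    have : Continuous fun t : ℝ => t • Nat.card (hom f).ker • x := by fun_prop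
    have := this.tendsto 0
    rw [zero_smul] at this
    exact this.mono_left nhdsWithin_le_nhds
  obtain ⟨t, ht, ht0⟩ := ((h2.eventually hU).and self_mem_nhdsWithin).exists
  have h3 := h0 _ ht (h1 t)
  have h4 := (smul_eq_zero.1 h3).resolve_left ht0
  rw [← Nat.cast_smul_eq_nsmul ℂ] at h4
  exact (smul_eq_zero.1 h4).resolve_left (Nat.cast_ne_zero.2 Nat.card_pos.ne')

theorem countable_lattice : (X.lattice : Set X.E).Countable := by
  obtain ⟨n, b, hb, -, hs⟩ := X.lattice.exists_basis_of_discrete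
  refine (Set.countable_range fun m : Fin n → ℤ => ∑ i, m i • b i).mono fun x hx => ?_
  obtain ⟨m, rfl⟩ := hs x hx
  exact ⟨m, rfl⟩

/-- Let `l` be a nonzero form killing the image of the differential. Surjectivity on groups means
that every vector is an image up to a lattice vector, so `l` maps the countable lattice onto ℂ. -/
theorem differential_surjective {f : X ⟶ Y} (hf : Function.Surjective (hom f)) :
    Function.Surjective (differential X Y (hom f)) := by
  change Function.Surjective (differential X Y (hom f)).toLinearMap
  rw [← LinearMap.range_eq_top]
  by_contra hne
  obtain ⟨l, hl, hle⟩ := Submodule.exists_le_ker_of_lt_top _ (lt_top_iff_ne_top.2 hne)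
  have h1 : Set.univ ⊆ l '' Y.lattice := fun z _ => by
    obtain ⟨y, rfl⟩ := LinearMap.surjective hl z
    obtain ⟨a, ha⟩ := hf (Y.exp y)
    obtain ⟨x, rfl⟩ := exp_surjective a
    refine ⟨y - differential X Y (hom f) x, ?_, ?_⟩
    · refine Y.isExp.sub_mem_kernel.2 ?_
      rw [← hom_exp, ha]
    · have : l (differential X Y (hom f) x) = 0 := hle ⟨x, rfl⟩
      rw [map_sub, this, sub_zero]
  exact not_countable_complex ((Y.countable_lattice.image l).mono h1)

/-- A lattice vector of the target lifts to the tangent space of the source, and multiplying by the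
order of the kernel brings the lift into the source lattice. -/
theorem ratMap_bijective {f : X ⟶ Y} (hf : isogeny f) : Function.Bijective (ratMap f) := by
  have hinj : Function.Injective (ratMap f) := fun u v huv =>
    Subtype.ext (differential_injective hf.2 (congrArg Subtype.val huv))
  refine ⟨hinj, ?_⟩
  suffices h : ratSpan Y.lattice ≤
      (ratSpan X.lattice).map ((differential X Y (hom f)).toLinearMap.restrictScalars ℚ) by
    rintro ⟨v, hv⟩
    obtain ⟨u, hu, huv⟩ := h hv
    exact ⟨⟨u, hu⟩, Subtype.ext huv⟩
  refine Submodule.span_le.2 fun y hy => ?_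
  obtain ⟨x, rfl⟩ := differential_surjective hf.1 y
  refine ⟨x, ?_, rfl⟩
  have h1 := Submodule.subset_span (R := ℚ) (exists_smul_mem_lattice hy)
  rw [← Nat.cast_smul_eq_nsmul ℚ] at h1
  have := hf.2
  exact (Submodule.smul_mem_iff _ (Nat.cast_ne_zero.2 Nat.card_pos.ne')).1 h1

theorem isIso_hodge_map {f : X ⟶ Y} (hf : isogeny f) : IsIso (hodge.map f) := by
  obtain ⟨g, hg, hg'⟩ := RatHodgeStructure.Hom.exists_inverse (hodge.map f) (ratMap_bijective hf)
  exact ⟨g, RatHodgeStructure.Hom.ext hg, RatHodgeStructure.Hom.ext hg'⟩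

/-- A linear map respecting lattices and cocomplex subspaces integrates to a morphism. -/
theorem exists_hom (L : X.E →L[ℂ] Y.E) (hL : ∀ x ∈ X.lattice, L x ∈ Y.lattice)
    (hF : ∀ x ∈ crCocomplex X.metric X.T, L x ∈ crCocomplex Y.metric Y.T) :
    ∃ f : X ⟶ Y, differential X Y (hom f) = L ∧ ∀ x, hom f (X.exp x) = Y.exp (L x) := by
  obtain ⟨g, hg, hgp⟩ := X.isExp.exists_descend (f := fun x => Y.exp (L x))
    (Y.isExp.contMDiff.comp L.contDiff.contMDiff) fun x y hy => by
      rw [map_add, Y.isExp.map_add, mem_lattice.1 (hL y hy), mul_one]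
  have hg1 : g 1 = 1 := by
    rw [← X.isExp.map_zero]
    exact (hgp 0).trans (by rw [map_zero, Y.isExp.map_zero])
  let φ : X.G →* Y.G := {
    toFun := g
    map_one' := hg1
    map_mul' := fun a b => by
      obtain ⟨x, rfl⟩ := exp_surjective a
      obtain ⟨y, rfl⟩ := exp_surjective b
      have e1 := hgp x
      have e2 := hgp y
      have e3 := hgp (x + y)
      rw [map_add, Y.isExp.map_add, ← e1, ← e2] at e3
      rw [← e3]
      exact congrArg g (X.isExp.map_add x y).symm }
  have hd : differential X Y φ = L := by
    have h1 : HasMFDerivAt 𝓘(ℂ, X.E) 𝓘(ℂ, Y.E) φ 1 (differential X Y φ) :=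
      (hg.mdifferentiable (by simp) 1).hasMFDerivAt
    have h1' : ∀ a : X.G, a = 1 → HasMFDerivAt 𝓘(ℂ, X.E) 𝓘(ℂ, Y.E) φ a
        (differential X Y φ) := by
      rintro a rfl
      exact h1
    have h2 : HasMFDerivAt 𝓘(ℂ, X.E) 𝓘(ℂ, Y.E) (fun x => φ (X.exp x)) 0 (differential X Y φ) :=
      HasMFDerivAt.comp (0 : X.E) (h1' _ X.isExp.map_zero) X.isExp.hasMFDerivAt
    have h3' : ∀ a : Y.E, a = 0 → HasMFDerivAt 𝓘(ℂ, Y.E) 𝓘(ℂ, Y.E) Y.exp a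
        (ContinuousLinearMap.id ℂ Y.E) := by
      rintro a rfl
      exact Y.isExp.hasMFDerivAt
    have h3 : HasMFDerivAt 𝓘(ℂ, X.E) 𝓘(ℂ, Y.E) (fun x => Y.exp (L x)) 0 L :=
      HasMFDerivAt.comp (0 : X.E) (h3' _ (map_zero L)) (L.hasFDerivAt (x := 0)).hasMFDerivAt
    have h4 : (fun x => φ (X.exp x)) = fun x => Y.exp (L x) := funext hgp
    rw [h4] at h2
    exact hasMFDerivAt_unique h2 h3
  have hT : ∀ x ∈ X.T, L x ∈ Y.T := fun x hx => by
    rw [T_eq] at hx ⊢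
    suffices Submodule.span ℝ (X.lattice : Set X.E) ≤
      (Submodule.span ℝ (Y.lattice : Set Y.E)).comap (L.toLinearMap.restrictScalars ℝ) from this hx
    exact Submodule.span_le.2 fun x hx => Submodule.subset_span (hL x hx)
  refine ⟨Hom.mk φ hg (fun a ha => ?_) fun v hv => ?_, hd, hgp⟩
  · rw [K_eq] at ha ⊢
    obtain ⟨x, hx, rfl⟩ := ha
    refine ⟨L x, ?_, (hgp x).symm⟩
    have := hT x (by rw [T_eq]; exact hx)
    rw [T_eq] at this
    exact this
  · rw [hd]
    exact hF v hv

/-- The same group, with the metric multiplied by a positive integer. -/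
noncomputable def scale (X : AbelianCousinGroup) (N : ℕ) (hN : (0 : ℝ) < N) : AbelianCousinGroup :=
  { X with
    metric := scaleCore X.metric N hN
    polarized := by
      have key : ∀ K, K = X.isExp.core → ∀ B : LinearMap.BilinForm ℝ X.E, (∀ x y, B x y = B y x) →
          (∀ v ∈ X.lattice, ∃ q : ℚ, B v v = q) → IsPolarizedIn X.E K B := by
        rintro _ rfl B hB h
        exact (X.isExp.isPolarizedIn_core B hB).2 h
      refine key _ X.K_eq _ crForm_comm fun v hv => ?_
      have hT : v ∈ X.T := by
        rw [T_eq]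
        exact Submodule.subset_span hv
      obtain ⟨q, hq⟩ := X.rational_of_mem_lattice v hv
      exact ⟨N * q, (crForm_scaleCore hT hT).trans (by rw [hq]; push_cast; rfl)⟩ }

end AbelianCousinGroup

/-! ### A criterion for a functor to be a localization -/

section
universe v u v' u'
variable {C : Type u} [Category.{v} C] {D : Type u'} [Category.{v'} D]

/-- A functor which is faithful, essentially surjective and full up to precomposition with
morphisms of `W`, all of which it inverts, is a localization. -/
theorem nonempty_localization_equivalence (F : C ⥤ D) [F.Faithful] [F.EssSurj]
    (W : MorphismProperty C) [W.IsMultiplicative] (hF : W.IsInvertedBy F)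
    (h : ∀ (X Y : C) (φ : F.obj X ⟶ F.obj Y), ∃ (X' : C) (s : X' ⟶ X) (f : X' ⟶ Y),
      W s ∧ F.map s ≫ φ = F.map f) : Nonempty (D ≌ W.Localization) := by
  -- A cospan with one leg in `W` becomes, under `F`, a single morphism, which `h` writes as a roof.
  -- Maps equalized by an element of `W` are already equal, since `F` is faithful and inverts it.
  have hW : W.HasRightCalculusOfFractions :=
    { exists_rightFraction := fun X Y φ => by
        have := hF _ φ.hs
        obtain ⟨X', s, f, hs, hsf⟩ := h X Y (F.map φ.f ≫ inv (F.map φ.s))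
        refine ⟨⟨s, hs, f⟩, F.map_injective ?_⟩
        rw [F.map_comp, F.map_comp, ← hsf, Category.assoc, Category.assoc, IsIso.inv_hom_id,
          Category.comp_id]
      ext := fun X Y Y' f₁ f₂ s hs hfs => by
        have := hF _ hs
        refine ⟨X, 𝟙 X, W.id_mem X, ?_⟩
        rw [Category.id_comp, Category.id_comp]
        apply F.map_injective
        rw [← cancel_mono (F.map s), ← F.map_comp, ← F.map_comp, hfs] }
  let G := Localization.lift F hF W.Q
  let e : W.Q ⋙ G ≅ F := Localization.fac F hF W.Q
  have heG : ∀ {X Y : C} (a : X ⟶ Y), G.map (W.Q.map a) ≫ e.hom.app Y = e.hom.app X ≫ F.map a :=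
    fun a => e.hom.naturality a
  -- The localization has the same objects as `C`, so `f` and `g` below may be taken between objects
  -- `W.Q.obj X` and `W.Q.obj Y`.
  have hobj : ∀ A : W.Localization, ∃ X, A = W.Q.obj X := fun A =>
    ⟨(Localization.Construction.objEquiv W).symm A,
      ((Localization.Construction.objEquiv W).apply_symm_apply A).symm⟩
  have hG1 : G.Faithful := ⟨by
    intro A B f g hfg
    obtain ⟨X, rfl⟩ := hobj A
    obtain ⟨Y, rfl⟩ := hobj B
    -- After composition with denominators both `f` and `g` come from morphisms of `C`. These have
    -- the same image under `F`, so they are equal.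
    obtain ⟨a, ha⟩ := Localization.exists_rightFraction W.Q W f
    have ha' : W.Q.map a.s ≫ f = W.Q.map a.f := by
      rw [ha, MorphismProperty.RightFraction.map_s_comp_map]
    obtain ⟨b, hb⟩ := Localization.exists_rightFraction W.Q W (W.Q.map a.s ≫ g)
    have hb' : W.Q.map b.s ≫ W.Q.map a.s ≫ g = W.Q.map b.f := by
      rw [hb, MorphismProperty.RightFraction.map_s_comp_map]
    have h1 := Localization.inverts W.Q W _ a.hs
    have h2 := Localization.inverts W.Q W _ b.hs
    have h3 : b.s ≫ a.f = b.f := by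
      apply F.map_injective
      rw [← cancel_epi (e.hom.app _), ← heG, ← heG, ← hb', W.Q.map_comp, ← ha', G.map_comp,
        G.map_comp, G.map_comp, G.map_comp, hfg]
    rw [← cancel_epi (W.Q.map a.s), ← cancel_epi (W.Q.map b.s), ha', hb', ← W.Q.map_comp, h3]⟩
  have hG2 : G.Full := ⟨by
    intro A B φ
    obtain ⟨X, rfl⟩ := hobj A
    obtain ⟨Y, rfl⟩ := hobj B
    obtain ⟨X', s, f, hs, hsf⟩ := h X Y (e.inv.app X ≫ φ ≫ e.hom.app Y)
    have h1 := Localization.inverts W.Q W _ hs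
    refine ⟨inv (W.Q.map s) ≫ W.Q.map f, ?_⟩
    rw [← cancel_epi (G.map (W.Q.map s)), ← G.map_comp, IsIso.hom_inv_id_assoc,
      ← cancel_mono (e.hom.app Y), heG, ← hsf, ← Category.assoc (e.hom.app X'), ← heG]
    simp⟩
  have hG3 : G.EssSurj := ⟨fun A => ⟨W.Q.obj (F.objPreimage A),
    ⟨e.app _ ≪≫ F.objObjPreimageIso A⟩⟩⟩
  have : G.IsEquivalence := { }
  exact ⟨G.asEquivalence.symm⟩

end

/-! ### Morphisms of Hodge structures as fractions with isogeny denominators -/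

namespace AbelianCousinGroup
variable {X Y Z : AbelianCousinGroup}

instance : isogeny.IsMultiplicative where
  id_mem X := ⟨fun x => ⟨x, rfl⟩, by
    have : (MonoidHom.id X.G).ker = ⊥ := MonoidHom.ker_id
    change Finite (MonoidHom.id X.G).ker
    rw [this]
    infer_instance⟩
  comp_mem {X Y Z} f g hf hg := by
    refine ⟨hg.1.comp hf.1, ?_⟩
    have h1 : ((hom g).ker : Set Y.G).Finite := hg.2
    have h2 : ((hom f).ker : Set X.G).Finite := hf.2
    -- The kernel of a composite is the preimage of a finite kernel, and nonempty fibres are cosets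
    -- of the other finite kernel.
    refine (h1.preimage' (f := hom f) fun b _ => ?_ : ((hom f) ⁻¹' ((hom g).ker : Set Y.G)).Finite)
    by_cases hb : ∃ a, hom f a = b
    · obtain ⟨a, rfl⟩ := hb
      refine (h2.image fun k => a * k).subset fun x hx => ⟨a⁻¹ * x, ?_, mul_inv_cancel_left _ _⟩
      change hom f (a⁻¹ * x) = 1
      rw [map_mul, map_inv, show hom f x = hom f a from hx, inv_mul_cancel]
    · convert! Set.finite_empty
      ext x
      exact ⟨fun hx => hb ⟨x, hx⟩, fun hx => hx.elim⟩

/-- A morphism whose differential is multiplication by a positive integer is an isogeny. -/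
theorem isogeny_of_differential {f : X ⟶ Y} {N : ℕ} (hN : N ≠ 0) (L : X.E ≃L[ℂ] Y.E)
    (hL' : ∀ y ∈ Y.lattice, L.symm y ∈ X.lattice)
    (hf : ∀ x, differential X Y (hom f) x = N • L x) : isogeny f := by
  have hNC : (N : ℂ) ≠ 0 := Nat.cast_ne_zero.2 hN
  refine ⟨fun a => ?_, ?_⟩
  · obtain ⟨y, rfl⟩ := exp_surjective a
    refine ⟨X.exp ((N : ℂ)⁻¹ • L.symm y), ?_⟩
    rw [hom_exp, hf, map_smul, L.apply_symm_apply, ← Nat.cast_smul_eq_nsmul ℂ, smul_smul,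
      mul_inv_cancel₀ hNC, one_smul]
  · obtain ⟨n, b, hb, -, hs⟩ := X.lattice.exists_basis_of_discrete
    -- The kernel consists of classes of vectors in `N⁻¹` times the lattice. Reducing the
    -- coordinates modulo `N` leaves finitely many.
    have hfin : (Set.pi Set.univ fun _ : Fin n => Set.Ico (0 : ℤ) N).Finite :=
      Set.Finite.pi fun _ => Set.finite_Ico _ _
    refine ((hfin.image fun m => X.exp ((N : ℂ)⁻¹ • ∑ i, m i • b i)).subset ?_ :
      ((hom f).ker : Set X.G).Finite)
    intro a ha
    obtain ⟨x, rfl⟩ := exp_surjective a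
    have ha' : hom f (X.exp x) = 1 := ha
    rw [hom_exp, hf, ← map_nsmul] at ha'
    have h1 := hL' _ (mem_lattice.2 ha')
    rw [L.symm_apply_apply] at h1
    obtain ⟨m, hm⟩ := hs _ h1
    refine ⟨fun i => m i % N, fun i _ => ⟨Int.emod_nonneg _ (by exact_mod_cast hN),
      Int.emod_lt_of_pos _ (by exact_mod_cast Nat.pos_of_ne_zero hN)⟩, ?_⟩
    refine X.isExp.sub_mem_kernel.1 ?_
    have h2 : x = (N : ℂ)⁻¹ • ∑ i, m i • b i := by
      rw [← hm, ← Nat.cast_smul_eq_nsmul ℂ, smul_smul, inv_mul_cancel₀ hNC, one_smul]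
    have h3 : (N : ℂ)⁻¹ • ∑ i, (m i % N) • b i - x = -∑ i, (m i / N) • b i := by
      rw [h2, ← smul_sub, ← Finset.sum_sub_distrib, ← Finset.sum_neg_distrib, Finset.smul_sum]
      refine Finset.sum_congr rfl fun i _ => ?_
      have h4 : m i % N = m i - N * (m i / N) := Int.emod_def _ _
      rw [h4, sub_smul, sub_sub_cancel_left, mul_smul, smul_neg, natCast_zsmul,
        ← Nat.cast_smul_eq_nsmul ℂ, smul_smul, inv_mul_cancel₀ hNC, one_smul]
    rw [h3]
    exact neg_mem (sum_mem fun i _ => zsmul_mem (hb i) _)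

theorem form_eq_of_lattice {B B' : LinearMap.BilinForm ℝ X.E}
    (h : ∀ u ∈ X.lattice, ∀ v ∈ X.lattice, B u v = B' u v) {u v : X.E} (hu : u ∈ X.T)
    (hv : v ∈ X.T) : B u v = B' u v := by
  rw [T_eq] at hu hv
  induction hu using Submodule.span_induction with
  | zero => simp
  | add x y _ _ hx hy => rw [map_add, map_add, LinearMap.add_apply, LinearMap.add_apply, hx, hy]
  | smul r x _ hx => rw [map_smul, map_smul, LinearMap.smul_apply, LinearMap.smul_apply, hx]
  | mem x hx =>
    induction hv using Submodule.span_induction with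
    | zero => simp
    | add y z _ _ hy hz => rw [map_add, map_add, hy, hz]
    | smul r y _ hy => rw [map_smul, map_smul, hy]
    | mem y hy => exact h x hx y hy

theorem bilin_smul {U : Type} [AddCommGroup U] [Module ℝ U] (B : LinearMap.BilinForm ℝ U) (M : ℕ)
    (u v : U) : B ((M : ℝ) • u) ((M : ℝ) • v) = ((M ^ 2 : ℕ) : ℝ) * B u v := by
  rw [map_smul, map_smul, LinearMap.smul_apply, smul_eq_mul, smul_eq_mul]
  push_cast
  ring

theorem hodge_Q (u v : ratSpan X.lattice) :
    (((hodge.obj X).Q u v : ℚ) : ℝ) = crForm X.metric X.T u v := X.form_Q u v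

/-- Morphisms between the Hodge structures of abelian Cousin groups come from morphisms of abelian
Cousin groups, up to isogeny. -/
theorem exists_isogeny_of_hodge (φ : hodge.obj X ⟶ hodge.obj Y) :
    ∃ (X' : AbelianCousinGroup) (s : X' ⟶ X) (f : X' ⟶ Y), isogeny s ∧ isometric s ∧
      hodge.map s ≫ φ = hodge.map f ∧
      (PolHodgeStructure.orthogonalMaps 2 φ → isometric f) := by
  obtain ⟨L, hL, hLF⟩ := CRDatum.exists_linearMap X.datum_surjective φ
  let φ' : ratSpan X.lattice →ₗ[ℚ] ratSpan Y.lattice := RatHodgeStructure.Hom.toLinearMap φ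
  have hL1 : ∀ v : ratSpan X.lattice, L v = φ' v := fun v => by
    have := hL v
    rw [datum_apply] at this
    exact this.trans (Y.datum_apply (φ' v))
  obtain ⟨n, b, hb, -, hs⟩ := X.lattice.exists_basis_of_discrete
  have hex : ∀ i, ∃ N : ℕ, N ≠ 0 ∧ N • L (b i) ∈ Y.lattice := fun i =>
    exists_smul_mem_of_mem_ratSpan (by
      rw [hL1 ⟨b i, Submodule.subset_span (hb i)⟩]
      exact (φ' _).2)
  choose N hN hNb using hex
  have hN0 : ∏ i, N i ≠ 0 := Finset.prod_ne_zero_iff.2 fun i _ => hN i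
  have hNL : ∀ x ∈ X.lattice, (∏ i, N i) • L x ∈ Y.lattice := fun x hx => by
    obtain ⟨m, rfl⟩ := hs x hx
    rw [map_sum, Finset.smul_sum]
    refine sum_mem fun i _ => ?_
    obtain ⟨d, hd⟩ := Finset.dvd_prod_of_mem N (Finset.mem_univ i)
    rw [hd, map_zsmul, smul_comm, mul_comm, mul_smul]
    exact zsmul_mem (nsmul_mem (hNb i) _) _
  generalize ∏ i, N i = M at hN0 hNL
  have hM : (0 : ℝ) < ((M ^ 2 : ℕ) : ℝ) := by exact_mod_cast pow_pos (Nat.pos_of_ne_zero hN0) 2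
  -- Multiplication by `M` scales the form by `M ^ 2`, so the rescaled metric makes it an isometry
  -- `X' ⟶ X`; the same factor serves for `M • L`.
  let X' := X.scale (M ^ 2) hM
  have hcF : crCocomplex X'.metric X'.T = crCocomplex X.metric X.T :=
    crCocomplex_scaleCore (hr := hM)
  have hcf : ∀ u ∈ X.T, ∀ v ∈ X.T, crForm X'.metric X'.T u v =
      ((M ^ 2 : ℕ) : ℝ) * crForm X.metric X.T u v := fun u hu v hv => crForm_scaleCore (hr :=
          hM) hu hv
  obtain ⟨s, hs, -⟩ := exists_hom (X := X') (Y := X) ((M : ℂ) • ContinuousLinearMap.id ℂ X.E)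
    (fun x hx => by
      change (M : ℂ) • x ∈ X.lattice
      rw [Nat.cast_smul_eq_nsmul]
      exact nsmul_mem hx M)
    (fun x hx => by
      rw [hcF] at hx
      exact (crCocomplex X.metric X.T).smul_mem (M : ℝ) hx)
  obtain ⟨f, hf, -⟩ := exists_hom (X := X') (Y := Y) ((M : ℂ) • L.toContinuousLinearMap)
    (fun x hx => by
      change (M : ℂ) • L x ∈ Y.lattice
      rw [Nat.cast_smul_eq_nsmul]
      exact hNL x hx)
    (fun x hx => by
      rw [hcF] at hx
      exact (crCocomplex Y.metric Y.T).smul_mem (M : ℝ) (hLF x hx))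
  have hs' : ∀ x : X.E, differential X' X (hom s) x = (M : ℝ) • x := fun x =>
    DFunLike.congr_fun hs x
  have hf' : ∀ x : X.E, differential X' Y (hom f) x = (M : ℝ) • L x := fun x =>
    DFunLike.congr_fun hf x
  refine ⟨X', s, f, ?_, ?_, ?_, fun hφ => ?_⟩
  · refine isogeny_of_differential hN0 (ContinuousLinearEquiv.refl ℂ X.E)
      (fun x hx => hx) fun x => (hs' x).trans ?_
    exact Nat.cast_smul_eq_nsmul ℝ M (x : X.E)
  · intro u hu v hv
    refine Eq.trans ?_ (hcf u hu v hv).symm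
    refine Eq.trans ?_ (bilin_smul _ M u v)
    exact congrArg₂ (fun a b => crForm X.metric X.T a b) (hs' u) (hs' v)
  · apply RatHodgeStructure.Hom.ext
    refine LinearMap.ext fun v : ratSpan X.lattice => ?_
    have h1 : ratMap s v = (M : ℚ) • v := Subtype.ext ((hs' v).trans (by
      rw [Nat.cast_smul_eq_nsmul, Nat.cast_smul_eq_nsmul]
      rfl))
    have h2 : φ' (ratMap s v) = ratMap f v := by
      rw [h1, map_smul]
      refine Subtype.ext ((?_ : _ = (M : ℝ) • L v).trans (hf' v).symm)
      rw [hL1, Nat.cast_smul_eq_nsmul, Nat.cast_smul_eq_nsmul]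
      rfl
    exact h2
  -- Orthogonality is known on rational vectors, and extends to `X.T`, the real span of the lattice,
  -- by bilinearity.
  · have h1 : ∀ u ∈ X.T, ∀ v ∈ X.T, crForm Y.metric Y.T (L u) (L v) = crForm X.metric X.T u v := by
      intro u hu v hv
      refine form_eq_of_lattice (B := (crForm Y.metric Y.T).compl₁₂ (L.restrictScalars ℝ)
        (L.restrictScalars ℝ)) (fun u hu v hv => ?_) hu hv
      let u' : ratSpan X.lattice := ⟨u, Submodule.subset_span hu⟩
      let v' : ratSpan X.lattice := ⟨v, Submodule.subset_span hv⟩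
      change crForm Y.metric Y.T (L u') (L v') = crForm X.metric X.T u' v'
      rw [hL1, hL1, ← hodge_Q, ← hodge_Q]
      exact congrArg _ (hφ u' v')
    intro u hu v hv
    refine Eq.trans ?_ (hcf u hu v hv).symm
    rw [← h1 u hu v hv]
    refine Eq.trans ?_ (bilin_smul _ M (L u) (L v))
    exact congrArg₂ (fun a b => crForm Y.metric Y.T a b) (hf' u) (hf' v)

theorem orthogonal_hodge_map {f : X ⟶ Y} (hf : isometric f) :
    PolHodgeStructure.orthogonalMaps 2 (hodge.map f) := fun u v => by
  let u' : ratSpan X.lattice := u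
  let v' : ratSpan X.lattice := v
  have hT : ∀ x ∈ ratSpan X.lattice, x ∈ X.T := fun x hx => by
    obtain ⟨N, hN, h⟩ := exists_smul_mem_of_mem_ratSpan hx
    have h1 : N • x ∈ X.T := by
      rw [T_eq]
      exact Submodule.subset_span h
    rw [← Nat.cast_smul_eq_nsmul ℝ] at h1
    exact (Submodule.smul_mem_iff _ (Nat.cast_ne_zero.2 hN)).1 h1
  have h1 : (((hodge.obj Y).Q (ratMap f u') (ratMap f v') : ℚ) : ℝ) = (hodge.obj X).Q u' v' := by
    rw [hodge_Q, hodge_Q]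
    exact hf u' (hT _ u'.2) v' (hT _ v'.2)
  exact_mod_cast h1

/-- The functor to polarized Hodge structures without nontrivial quotients of weight 0. -/
noncomputable def hodgeFunctor :
    AbelianCousinGroup ⥤ PolHodgeStructure.noWeightZeroQuotient.FullSubcategory :=
  PolHodgeStructure.noWeightZeroQuotient.lift hodge noWeightZeroQuotient

/-- The functor to polarized Hodge structures, on isometric morphisms. -/
noncomputable def isometricHodge :
    WideSubcategory isometric ⥤ WideSubcategory (PolHodgeStructure.orthogonalMaps 2) where
  obj X := ⟨hodge.obj X.obj⟩
  map f := ⟨hodge.map f.hom, orthogonal_hodge_map f.property⟩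
  map_id X := WideSubcategory.hom_ext _ (hodge.map_id X.obj)
  map_comp f g := WideSubcategory.hom_ext _ (hodge.map_comp f.hom g.hom)

/-- The functor to polarized Hodge structures without nontrivial quotients of weight 0, on
isometric morphisms. -/
noncomputable def isometricHodgeFunctor : WideSubcategory isometric ⥤
    (PolHodgeStructure.noWeightZeroQuotient.inverseImage
      (wideSubcategoryInclusion (PolHodgeStructure.orthogonalMaps 2))).FullSubcategory :=
  ObjectProperty.lift _ isometricHodge fun X => X.obj.noWeightZeroQuotient

instance : hodgeFunctor.Faithful where
  map_injective {X Y} f g h := by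
    have h' : hodge.map f = hodge.map g :=
      congrArg (PolHodgeStructure.noWeightZeroQuotient.ι.map) h
    exact hodge.map_injective h'

instance : isometricHodge.Faithful where
  map_injective {X Y} f g h := by
    refine WideSubcategory.hom_ext _ (hodge.map_injective ?_)
    exact congrArg InducedWideCategory.Hom.hom h

instance : isometricHodgeFunctor.Faithful where
  map_injective {X Y} f g h := by
    have h' : isometricHodge.map f = isometricHodge.map g :=
      congrArg (ObjectProperty.ι _).map h
    exact isometricHodge.map_injective h'

theorem orthogonal_of_comp_eq {P P' : PolHodgeStructure 2} {f : P ⟶ P'} {g : P' ⟶ P}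
    (hf : PolHodgeStructure.orthogonalMaps 2 f) (h : g ≫ f = 𝟙 P') :
    PolHodgeStructure.orthogonalMaps 2 g := fun u v => by
  have h2 : ∀ u, RatHodgeStructure.Hom.toLinearMap f (RatHodgeStructure.Hom.toLinearMap g u) = u :=
    fun u => LinearMap.congr_fun (congrArg RatHodgeStructure.Hom.toLinearMap h) u
  have h1 := hf (RatHodgeStructure.Hom.toLinearMap g u) (RatHodgeStructure.Hom.toLinearMap g v)
  rw [h2, h2] at h1
  exact h1.symm

theorem isIso_orthogonal {f : X ⟶ Y} (hf : isogeny f) (hf' : isometric f) :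
    IsIso (X := (⟨hodge.obj X⟩ : WideSubcategory (PolHodgeStructure.orthogonalMaps 2)))
      (Y := ⟨hodge.obj Y⟩) (InducedWideCategory.Hom.mk (hodge.map f) (orthogonal_hodge_map hf')) :=
          by
  have := isIso_hodge_map hf
  have h2 : PolHodgeStructure.orthogonalMaps 2 (inv (hodge.map f)) :=
    orthogonal_of_comp_eq (orthogonal_hodge_map hf') (IsIso.inv_hom_id _)
  exact (WideSubcategory.isoMk (X := ⟨hodge.obj X⟩) (Y := ⟨hodge.obj Y⟩) (asIso (hodge.map f))
    (orthogonal_hodge_map hf') h2).isIso_hom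

theorem isIso_isometricHodge_map {X Y : WideSubcategory isometric} {f : X ⟶ Y}
    (hf : isogeny (X := X.obj) (Y := Y.obj) f.hom) : IsIso (isometricHodge.map f) :=
  isIso_orthogonal hf f.property

end AbelianCousinGroup

open AbelianCousinGroup in
/-- If the functor to Hodge structures is essentially surjective, then it induces equivalences. -/
theorem nonempty_equivalences_of_exists (H : ∀ P : PolHodgeStructure 2,
    P.toRatHodgeStructure.NoWeightZeroQuotient →
    ∃ (X : AbelianCousinGroup) (e : hodge.obj X ≅ P),
      PolHodgeStructure.orthogonalMaps 2 e.hom ∧ PolHodgeStructure.orthogonalMaps 2 e.inv) :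
    Nonempty
      ((PolHodgeStructure.noWeightZeroQuotient.inverseImage
          (wideSubcategoryInclusion (PolHodgeStructure.orthogonalMaps 2))).FullSubcategory ≌
        (AbelianCousinGroup.isogeny.inverseImage
          (wideSubcategoryInclusion AbelianCousinGroup.isometric)).Localization) ∧
    Nonempty
      (PolHodgeStructure.noWeightZeroQuotient.FullSubcategory ≌
        AbelianCousinGroup.isogeny.Localization) := by
  constructor
  · have : isometricHodgeFunctor.EssSurj := ⟨fun P => by
      obtain ⟨X, e, he, he'⟩ := H P.obj.obj P.property
      exact ⟨⟨X⟩, ⟨ObjectProperty.isoMk _ (WideSubcategory.isoMk e he he')⟩⟩⟩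
    refine nonempty_localization_equivalence isometricHodgeFunctor _ (fun X Y f hf => ?_)
      fun X Y φ => ?_
    · have := isIso_isometricHodge_map hf
      exact (ObjectProperty.isIso_hom_iff (isometricHodgeFunctor.map f)).1 this
    · obtain ⟨X', s, f, h1, h2, h3, h4⟩ := exists_isogeny_of_hodge φ.hom.hom
      exact ⟨⟨X'⟩, ⟨s, h2⟩, ⟨f, h4 φ.hom.property⟩, h1,
        ObjectProperty.hom_ext _ (WideSubcategory.hom_ext _ h3)⟩
  · have : hodgeFunctor.EssSurj := ⟨fun P => by
      obtain ⟨X, e, -⟩ := H P.obj P.property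
      exact ⟨X, ⟨ObjectProperty.isoMk _ e⟩⟩⟩
    refine nonempty_localization_equivalence hodgeFunctor _ (fun X Y f hf => ?_)
      fun X Y φ => ?_
    · have := isIso_hodge_map hf
      exact (ObjectProperty.isIso_hom_iff (hodgeFunctor.map f)).1 this
    · obtain ⟨X', s, f, h1, -, h3, -⟩ := exists_isogeny_of_hodge φ.hom
      exact ⟨X', s, f, h1, ObjectProperty.hom_ext _ h3⟩

/-! ### The complex Lie group of a lattice -/

section
variable {E : Type} [NormedAddCommGroup E]

/-- The quotient of a vector space by a subgroup, as a multiplicative group. -/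
def LatticeQuotient (Λ : AddSubgroup E) : Type := Multiplicative (E ⧸ Λ)

namespace LatticeQuotient
variable (Λ : AddSubgroup E)

instance : CommGroup (LatticeQuotient Λ) := inferInstanceAs (CommGroup (Multiplicative (E ⧸ Λ)))

instance : TopologicalSpace (LatticeQuotient Λ) :=
  inferInstanceAs (TopologicalSpace (Multiplicative (E ⧸ Λ)))

/-- The projection. -/
def mk (x : E) : LatticeQuotient Λ := Multiplicative.ofAdd (QuotientAddGroup.mk x)

theorem mk_add (x y : E) : mk Λ (x + y) = mk Λ x * mk Λ y := rfl

theorem mk_neg (x : E) : mk Λ (-x) = (mk Λ x)⁻¹ := rfl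

theorem mk_zero : mk Λ 0 = 1 := rfl

theorem mk_surjective : Function.Surjective (mk Λ) := QuotientAddGroup.mk_surjective

theorem mk_eq_one {x : E} : mk Λ x = 1 ↔ x ∈ Λ := QuotientAddGroup.eq_zero_iff x

theorem continuous_mk : Continuous (mk Λ) := QuotientAddGroup.continuous_mk

instance [NormedSpace ℂ E] : ConnectedSpace (LatticeQuotient Λ) :=
  (mk_surjective Λ).connectedSpace (continuous_mk Λ)

variable [DiscreteTopology Λ]

instance : T2Space (LatticeQuotient Λ) := by
  have : IsClosed (Λ : Set E) := AddSubgroup.isClosed_of_discrete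
  exact inferInstanceAs (T2Space (E ⧸ Λ))

theorem isLocalHomeomorph_mk : IsLocalHomeomorph (mk Λ) := by
  have h : IsDiscrete (Λ : Set E) := ⟨‹_›⟩
  have := (Λ.isAddQuotientCoveringMap_of_comm h).isCoveringMap.isLocalHomeomorph
  exact this

/-- All local inverses of the projection are taken as charts, so that coordinate changes are locally
translations. -/
noncomputable instance : ChartedSpace E (LatticeQuotient Λ) where
  atlas := {e | ⇑e.symm = mk Λ}
  chartAt q := (isLocalHomeomorph_mk Λ).localInverseAt (Function.surjInv (mk_surjective Λ) q)
  mem_chart_source q := by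
    have := (isLocalHomeomorph_mk Λ).apply_self_mem_localInverseAt_source
      (x := Function.surjInv (mk_surjective Λ) q)
    rwa [Function.surjInv_eq (mk_surjective Λ) q] at this
  chart_mem_atlas q := (isLocalHomeomorph_mk Λ).localInverseAt_symm _

theorem mem_atlas_iff {e : OpenPartialHomeomorph (LatticeQuotient Λ) E} :
    e ∈ atlas E (LatticeQuotient Λ) ↔ ⇑e.symm = mk Λ := Iff.rfl

variable {Λ}

/-- In charts, the projection is locally a translation. -/
theorem eventually_chart_mk {e : OpenPartialHomeomorph (LatticeQuotient Λ) E} (he : ⇑e.symm = mk Λ)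
    {z₀ : E} (hz : mk Λ z₀ ∈ e.source) :
    ∀ᶠ z in nhds z₀, e (mk Λ z) = z + (e (mk Λ z₀) - z₀) := by
  have hmk := (continuous_mk Λ).continuousAt (x := z₀)
  have h1 : ContinuousAt (fun z => e (mk Λ z) - z - (e (mk Λ z₀) - z₀)) z₀ :=
    (((e.continuousAt hz).comp hmk).sub continuousAt_id).sub continuousAt_const
  have h2 := h1.tendsto
  rw [sub_self] at h2
  -- The difference of the two sides projects to `1` and is close to `0`, so local injectivity at
  -- `0` makes it vanish.
  obtain ⟨U, hU, hinj⟩ := isLocallyInjective_iff_nhds.1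
    (isLocalHomeomorph_mk Λ).isLocallyInjective 0
  filter_upwards [h2.eventually hU, hmk.eventually (e.open_source.mem_nhds hz)] with z hzU hze
  have h3 : ∀ y ∈ e.source, mk Λ (e y) = y := fun y hy => by
    rw [← he]
    exact e.left_inv hy
  have h4 : mk Λ (e (mk Λ z) - z - (e (mk Λ z₀) - z₀)) = mk Λ 0 := by
    simp only [sub_eq_add_neg, mk_add, mk_neg, neg_add_rev, neg_neg, h3 _ hze, h3 _ hz, mk_zero]
    simp
  have h5 := hinj hzU (mem_of_mem_nhds hU) h4
  rw [sub_sub, sub_eq_zero] at h5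
  exact h5

variable [NormedSpace ℂ E]

theorem contDiffAt_chart_mk {e : OpenPartialHomeomorph (LatticeQuotient Λ) E} (he : ⇑e.symm = mk Λ)
    {z₀ : E} (hz : mk Λ z₀ ∈ e.source) : ContDiffAt ℂ ω (fun z => e (mk Λ z)) z₀ :=
  (contDiffAt_id.add (contDiffAt_const (c := e (mk Λ z₀) - z₀))).congr_of_eventuallyEq
    (eventually_chart_mk he hz)

theorem hasFDerivAt_chart_mk {e : OpenPartialHomeomorph (LatticeQuotient Λ) E}
    (he : ⇑e.symm = mk Λ) {z₀ : E} (hz : mk Λ z₀ ∈ e.source) :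
    HasFDerivAt (fun z => e (mk Λ z)) (ContinuousLinearMap.id ℂ E) z₀ :=
  ((hasFDerivAt_id z₀).add_const (e (mk Λ z₀) - z₀)).congr_of_eventuallyEq
    (eventually_chart_mk he hz)

omit [NormedSpace ℂ E] in
theorem chartAt_symm (q : LatticeQuotient Λ) : ⇑(chartAt E q).symm = mk Λ :=
  chart_mem_atlas E q

instance : IsManifold 𝓘(ℂ, E) ω (LatticeQuotient Λ) := by
  refine isManifold_of_contDiffOn _ _ _ fun e e' he he' z hz => ?_
  rw [mem_atlas_iff] at he he'
  have hz' : mk Λ z ∈ e'.source := by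
    rw [← he]
    exact (by simpa using hz.1 : _ ∧ _).2
  refine ContDiffAt.contDiffWithinAt ((contDiffAt_chart_mk he' hz').congr_of_eventuallyEq ?_)
  refine Filter.Eventually.of_forall fun y => ?_
  rw [← he]
  rfl

theorem contMDiff_mk : ContMDiff 𝓘(ℂ, E) 𝓘(ℂ, E) ω (mk Λ) := fun z => by
  rw [contMDiffAt_iff_target]
  refine ⟨(continuous_mk Λ).continuousAt, ContDiffAt.contMDiffAt ?_⟩
  exact contDiffAt_chart_mk (chartAt_symm _) (mem_chart_source E (mk Λ z))

theorem hasMFDerivAt_mk (z : E) :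
    HasMFDerivAt 𝓘(ℂ, E) 𝓘(ℂ, E) (mk Λ) z (ContinuousLinearMap.id ℂ E) :=
  ⟨(continuous_mk Λ).continuousAt,
    (hasFDerivAt_chart_mk (chartAt_symm _) (mem_chart_source E (mk Λ z))).hasFDerivWithinAt⟩

theorem exists_section (z : E) : ∃ σ : LatticeQuotient Λ → E,
    ContMDiffAt 𝓘(ℂ, E) 𝓘(ℂ, E) ω σ (mk Λ z) ∧ ∀ᶠ q in nhds (mk Λ z), mk Λ (σ q) = q := by
  let e := (isLocalHomeomorph_mk Λ).localInverseAt z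
  have he : ⇑e.symm = mk Λ := (isLocalHomeomorph_mk Λ).localInverseAt_symm z
  have hz : mk Λ z ∈ e.source := (isLocalHomeomorph_mk Λ).apply_self_mem_localInverseAt_source
  refine ⟨e, ?_, ?_⟩
  · have he' : e ∈ atlas E (LatticeQuotient Λ) := he
    exact contMDiffAt_of_mem_maximalAtlas (I := 𝓘(ℂ, E)) (n := ω)
      (IsManifold.subset_maximalAtlas he') hz
  · filter_upwards [e.open_source.mem_nhds hz] with q hq
    rw [← he]
    exact e.left_inv hq

instance : LieGroup 𝓘(ℂ, E) ω (LatticeQuotient Λ) where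
  contMDiff_mul := by
    rintro ⟨a, b⟩
    obtain ⟨x, rfl⟩ := mk_surjective Λ a
    obtain ⟨y, rfl⟩ := mk_surjective Λ b
    obtain ⟨σ, hσ, hσ'⟩ := exists_section (Λ := Λ) x
    obtain ⟨τ, hτ, hτ'⟩ := exists_section (Λ := Λ) y
    have h1 : ContMDiffAt (𝓘(ℂ, E).prod 𝓘(ℂ, E)) 𝓘(ℂ, E) ω
        (fun p : LatticeQuotient Λ × LatticeQuotient Λ => σ p.1 + τ p.2) (mk Λ x, mk Λ y) :=
      (ContMDiffAt.comp (mk Λ x, mk Λ y) (g := σ) hσ contMDiffAt_fst).add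
        (ContMDiffAt.comp (mk Λ x, mk Λ y) (g := τ) hτ contMDiffAt_snd)
    refine (ContMDiffAt.comp _ (contMDiff_mk _) h1).congr_of_eventuallyEq ?_
    filter_upwards [continuousAt_fst.eventually hσ', continuousAt_snd.eventually hτ'] with p hp hp'
    change p.1 * p.2 = mk Λ (σ p.1 + τ p.2)
    rw [mk_add, hp, hp']
  contMDiff_inv := by
    intro a
    obtain ⟨x, rfl⟩ := mk_surjective Λ a
    obtain ⟨σ, hσ, hσ'⟩ := exists_section (Λ := Λ) x
    refine (ContMDiffAt.comp _ (contMDiff_mk _) hσ.neg).congr_of_eventuallyEq ?_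
    filter_upwards [hσ'] with q hq
    change q⁻¹ = mk Λ (-σ q)
    rw [mk_neg, hq]

theorem isExp_mk : IsExp (mk Λ) where
  map_add := mk_add Λ
  central a x := mul_comm a (mk Λ x)
  contMDiff := contMDiff_mk
  hasMFDerivAt := hasMFDerivAt_mk 0

end LatticeQuotient
end

/-! ### Fourier series and periods on a torus -/

namespace UnitAddTorus
variable {d : Type} [Fintype d]

theorem mFourier_apply_add (n : d → ℤ) (x y : UnitAddTorus d) :
    mFourier n (x + y) = mFourier n x * mFourier n y := by
  simp only [mFourier, ContinuousMap.coe_mk, ← Finset.prod_mul_distrib]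
  refine Finset.prod_congr rfl fun i _ => ?_
  simp [fourier_apply, smul_add, AddCircle.toCircle_add]

/-- The Fourier coefficients of a function with a period `τ` vanish at the characters which are
nontrivial on `τ`. -/
theorem mFourierCoeff_eq_zero_of_period {f : UnitAddTorus d → ℂ} {τ : UnitAddTorus d}
    (hf : ∀ x, f (x + τ) = f x) {n : d → ℤ} (hn : mFourier n τ ≠ 1) : mFourierCoeff f n = 0 := by
  have h1 : mFourierCoeff f n = mFourier (-n) τ * mFourierCoeff f n := by
    unfold mFourierCoeff
    let _ : MeasureTheory.MeasureSpace UnitAddCircle := ⟨AddCircle.haarAddCircle⟩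
    have : MeasureTheory.Measure.IsAddHaarMeasure
      (MeasureTheory.MeasureSpace.volume : MeasureTheory.Measure UnitAddCircle) :=
      inferInstanceAs (MeasureTheory.Measure.IsAddHaarMeasure AddCircle.haarAddCircle)
    rw [← MeasureTheory.integral_const_mul]
    refine (MeasureTheory.integral_add_right_eq_self _ τ).symm.trans ?_
    refine congrArg _ (funext fun t => ?_)
    rw [hf, mFourier_apply_add, smul_eq_mul, smul_eq_mul]
    ring
  by_contra hne
  have h2 : mFourier (-n) τ = 1 := by
    apply mul_right_cancel₀ hne
    rw [one_mul, ← h1]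
  rw [mFourier_neg] at h2
  apply hn
  rw [← Complex.conj_conj (mFourier n τ), h2, map_one]

/-- With one possibly nonzero coefficient the Fourier series is summable, and it converges pointwise
to the continuous function. -/
theorem apply_eq_of_mFourierCoeff (f : C(UnitAddTorus d, ℂ))
    (hf : ∀ n, n ≠ 0 → mFourierCoeff f n = 0) (x y : UnitAddTorus d) : f x = f y := by
  have hs : Summable (mFourierCoeff f) := summable_of_ne_finset_zero (s := {0}) fun n hn =>
    hf n (by simpa using hn)
  have key : ∀ x, f x = mFourierCoeff f 0 := fun x => by
    refine (hasSum_mFourier_series_apply_of_summable hs x).unique ?_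
    have := hasSum_single (f := fun n => mFourierCoeff f n • mFourier n x) 0 fun n hn => by
      rw [hf n hn, zero_smul]
    simpa [mFourier_zero] using this
  rw [key, key]

theorem mFourier_coe (n : d → ℤ) (y : d → ℝ) :
    mFourier n (fun i => (y i : UnitAddCircle)) =
      Complex.exp (2 * Real.pi * Complex.I * ((∑ i, n i * y i : ℝ) : ℂ)) := by
  simp only [mFourier, ContinuousMap.coe_mk]
  push_cast
  rw [Finset.mul_sum, Complex.exp_sum]
  refine Finset.prod_congr rfl fun i _ => ?_
  rw [fourier_coe_apply]
  congr 1
  push_cast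
  ring

end UnitAddTorus

/-- A continuous function with the periods `ℤᵐ`, and with further periods not killed by any integral
linear form, is constant. -/
theorem eq_of_periodic {d : Type} [Fintype d] {g : (d → ℝ) → ℂ} (hg : Continuous g)
    (hper : ∀ (x : d → ℝ) (n : d → ℤ), g (x + fun i => (n i : ℝ)) = g x)
    (h : ∀ n : d → ℤ, n ≠ 0 → ∃ y : d → ℝ, ∑ i, n i * y i ≠ 0 ∧ ∀ (r : ℝ) x, g (x + r • y) = g x)
    (x y : d → ℝ) : g x = g y := by
  let q : (d → ℝ) → UnitAddTorus d := Pi.map fun _ x => (x : UnitAddCircle)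
  have hq : IsOpenQuotientMap q := IsOpenQuotientMap.piMap fun _ =>
    ⟨QuotientAddGroup.mk_surjective, QuotientAddGroup.continuous_mk, QuotientAddGroup.isOpenMap_coe⟩
  have hfac : ∀ x y, q x = q y → g x = g y := fun x y hxy => by
    have h1 : ∀ i, ∃ n : ℤ, n • (1 : ℝ) = x i - y i := fun i => by
      rw [← AddCircle.coe_eq_zero_iff, AddCircle.coe_sub, sub_eq_zero]
      exact congrFun hxy i
    choose n hn using h1
    rw [← hper y n]
    congr 1
    ext i
    have := hn i
    simp only [zsmul_eq_mul, mul_one] at this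
    simp [this]
  have hF : ∀ x, g (Function.surjInv hq.surjective (q x)) = g x := fun x =>
    hfac _ _ (Function.surjInv_eq hq.surjective _)
  let f : C(UnitAddTorus d, ℂ) := ⟨fun t => g (Function.surjInv hq.surjective t), by
    rw [hq.isQuotientMap.continuous_iff]
    convert! hg using 1
    exact funext hF⟩
  have hfq : ∀ x, f (q x) = g x := hF
  rw [← hfq, ← hfq]
  refine UnitAddTorus.apply_eq_of_mFourierCoeff f (fun n hn => ?_) _ _
  obtain ⟨z, hz, hz'⟩ := h n hn
  -- The period is scaled so that the integral form takes the value `1 / 2` on it, where the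
  -- character is `-1`.
  refine UnitAddTorus.mFourierCoeff_eq_zero_of_period (τ := q ((2 * ∑ i, n i * z i)⁻¹ • z))
    (fun t => ?_) ?_
  · obtain ⟨x, rfl⟩ := hq.surjective t
    have : q x + q ((2 * ∑ i, n i * z i)⁻¹ • z) = q (x + (2 * ∑ i, n i * z i)⁻¹ • z) := rfl
    rw [this, hfq, hfq, hz']
  · have h1 : ∑ i, n i * ((2 * ∑ i, n i * z i)⁻¹ • z) i = 1 / 2 := by
      simp only [Pi.smul_apply, smul_eq_mul, mul_left_comm _ (2 * ∑ i, n i * z i)⁻¹]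
      rw [← Finset.mul_sum]
      field_simp
    have h2 := UnitAddTorus.mFourier_coe n ((2 * ∑ i, n i * z i)⁻¹ • z)
    rw [h1] at h2
    have h3 : Complex.exp (2 * Real.pi * Complex.I * ((1 / 2 : ℝ) : ℂ)) = -1 := by
      rw [← Complex.exp_pi_mul_I]
      congr 1
      push_cast
      ring
    rw [h3] at h2
    intro h4
    have h5 : (-1 : ℂ) = 1 := h2.symm.trans h4
    norm_num at h5

/-! ### Constancy of periodic entire functions -/

section
variable {E : Type} [NormedAddCommGroup E] [NormedSpace ℂ E]

/-- Entire functions with a lattice of periods, not killed by integral linear forms, are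
constant. -/
theorem eq_of_differentiable_of_periodic {d : Type} [Fintype d] {b : d → E} {g : E → ℂ}
    (hg : Differentiable ℂ g) (hper : ∀ x i, g (x + b i) = g x)
    (hspan : ∀ x : E, ∃ y y' : d → ℝ, x = ∑ i, y i • b i + Complex.I • ∑ i, y' i • b i)
    (h : ∀ n : d → ℤ, n ≠ 0 → ∃ y y' : d → ℝ, ∑ i, n i * y i ≠ 0 ∧
      Complex.I • ∑ i, y i • b i = ∑ i, y' i • b i) (x : E) : g x = g 0 := by
  let s : (d → ℝ) →ₗ[ℝ] E := Fintype.linearCombination ℝ b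
  have hs : ∀ y, s y = ∑ i, y i • b i := fun y => Fintype.linearCombination_apply ℝ b y
  have hsc : Continuous s := s.continuous_of_finiteDimensional
  have hperZ : ∀ (x : E) (n : ℤ) i, g (x + n • b i) = g x := fun x n i => by
    induction n using Int.induction_on generalizing x with
    | zero => simp
    | succ n ih => rw [add_smul, one_smul, ← add_assoc, hper, ih]
    | pred n ih =>
      have := hper (x + (-(n : ℤ) - 1) • b i) i
      rw [← this, add_assoc, ← add_one_zsmul, sub_add_cancel, ih]
  have hper' : ∀ (x : E) (n : d → ℤ), g (x + s fun i => (n i : ℝ)) = g x := fun x n => by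
    rw [hs]
    have : ∀ t : Finset d, g (x + ∑ i ∈ t, (n i : ℝ) • b i) = g x := fun t => by
      classical
      induction t using Finset.induction_on with
      | empty => simp
      | insert i t hi ih =>
        rw [Finset.sum_insert hi, add_comm (_ • _), ← add_assoc, Int.cast_smul_eq_zsmul, hperZ, ih]
    exact this _
  -- Modulo the periods, the translate of the real span through `x` is covered by a compact cube.
  have hbdd : ∀ x : E, ∃ C, ∀ y, ‖g (x + s y)‖ ≤ C := fun x => by
    have hK : IsCompact (Set.pi Set.univ fun _ : d => Set.Icc (0 : ℝ) 1) :=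
      isCompact_univ_pi fun _ => isCompact_Icc
    have hc : Continuous fun y => g (x + s y) := hg.continuous.comp (continuous_const.add hsc)
    obtain ⟨C, hC⟩ := hK.exists_bound_of_continuousOn hc.continuousOn
    refine ⟨C, fun y => ?_⟩
    have h1 : y = (fun i => Int.fract (y i)) + fun i => ((⌊y i⌋ : ℤ) : ℝ) :=
      funext fun i => (Int.fract_add_floor (y i)).symm
    rw [h1, map_add, ← add_assoc, hper']
    exact hC _ fun i _ => ⟨Int.fract_nonneg _, (Int.fract_lt_one _).le⟩
  -- When `I • s y` is again in the real span, the complex line through `z` in the direction `s y`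
  -- stays in a translate of that span, where `g` is bounded; Liouville's theorem applies.
  have hH : ∀ y y' : d → ℝ, Complex.I • s y = s y' → ∀ (z : E) (r : ℝ), g (z + r • s y) = g z :=
    fun y y' hyy' z r => by
    have hd : Differentiable ℂ fun w : ℂ => g (z + w • s y) := by fun_prop
    have hb : Bornology.IsBounded (Set.range fun w : ℂ => g (z + w • s y)) := by
      obtain ⟨C, hC⟩ := hbdd z
      refine isBounded_iff_forall_norm_le.2 ⟨C, ?_⟩
      rintro _ ⟨w, rfl⟩
      have : w • s y = s (w.re • y + w.im • y') := by
        rw [map_add, map_smul, map_smul, ← hyy', ← Complex.coe_smul, ← Complex.coe_smul w.im,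
          smul_smul, ← add_smul, Complex.re_add_im]
      simp only [this]
      exact hC _
    have := hd.apply_eq_apply_of_bounded hb r 0
    rwa [Complex.coe_smul, zero_smul, add_zero] at this
  -- In real coordinates `g` is a function on a torus, invariant under directions not killed by any
  -- given integral form.
  have hT : ∀ y, g (s y) = g 0 := fun y => by
    have := eq_of_periodic (g := fun y => g (s y)) (hg.continuous.comp hsc)
      (fun y n => by rw [map_add, hper']) (fun n hn => by
        obtain ⟨y, y', h1, h2⟩ := h n hn
        refine ⟨y, h1, fun r x => ?_⟩
        rw [map_add, map_smul]
        rw [← hs, ← hs] at h2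
        exact hH y y' h2 _ r) y 0
    rwa [map_zero] at this
  obtain ⟨y, y', rfl⟩ := hspan x
  rw [← hs, ← hs]
  -- This entire function is constant for real `w` by `hT`, hence everywhere; its value at `w = i`
  -- is the one sought.
  have hd : Differentiable ℂ fun w : ℂ => g (s y + w • s y') := by fun_prop
  have ha : AnalyticOnNhd ℂ (fun w : ℂ => g (s y + w • s y')) Set.univ := fun w _ =>
    hd.analyticAt w
  have hfr : ∃ᶠ w in nhdsWithin (0 : ℂ) {0}ᶜ, g (s y + w • s y') = g 0 := by
    have ht : Filter.Tendsto (fun r : ℝ => (r : ℂ)) (nhdsWithin 0 {0}ᶜ) (nhdsWithin 0 {0}ᶜ) := by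
      refine tendsto_nhdsWithin_iff.2 ⟨?_, ?_⟩
      · exact (Complex.continuous_ofReal.tendsto' 0 0 Complex.ofReal_zero).mono_left
          nhdsWithin_le_nhds
      · filter_upwards [self_mem_nhdsWithin] with r hr
        exact Complex.ofReal_ne_zero.2 hr
    refine ht.frequently (Filter.Eventually.frequently (Filter.Eventually.of_forall fun r => ?_))
    rw [Complex.coe_smul, ← map_smul, ← map_add, hT]
  have := ha.eq_of_frequently_eq analyticOnNhd_const hfr
  exact congrFun this Complex.I

end

/-! ### Hodge projections and the Hermitian metric of a polarization -/

namespace RatHodgeStructure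
variable (X : RatHodgeStructure 2)

/-- The projection to a summand of the Hodge decomposition. -/
noncomputable def proj (i : ℕ × ℕ) : ℂ ⊗[ℚ] X.V →ₗ[ℂ] ℂ ⊗[ℚ] X.V :=
  (X.piece i).subtype ∘ₗ DirectSum.component ℂ _ (fun i => X.piece i) i ∘ₗ
    (LinearEquiv.ofBijective (DirectSum.coeLinearMap X.piece) X.isInternal).symm.toLinearMap

theorem proj_mem (i : ℕ × ℕ) (x : ℂ ⊗[ℚ] X.V) : X.proj i x ∈ X.piece i := Subtype.coe_prop _

theorem eq_sum_proj (x : ℂ ⊗[ℚ] X.V) :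
    x = X.proj (2, 0) x + X.proj (1, 1) x + X.proj (0, 2) x := by
  have h := sum_eq_three X.piece_eq_bot
    ((LinearEquiv.ofBijective (DirectSum.coeLinearMap X.piece) X.isInternal).symm x)
  have h' := (LinearEquiv.ofBijective
      (DirectSum.coeLinearMap X.piece) X.isInternal).apply_symm_apply x
  exact h'.symm.trans h

variable {X}

theorem proj_eq {x a b d : ℂ ⊗[ℚ] X.V} (h : x = a + b + d) (ha : a ∈ X.piece (2, 0))
    (hb : b ∈ X.piece (1, 1)) (hd : d ∈ X.piece (0, 2)) :
    X.proj (2, 0) x = a ∧ X.proj (1, 1) x = b ∧ X.proj (0, 2) x = d := by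
  have h1 := X.eq_sum_proj x
  obtain ⟨h2, h3, h4⟩ := X.eq_zero_of_sum_eq_zero (sub_mem (X.proj_mem _ x) ha)
    (sub_mem (X.proj_mem _ x) hb) (sub_mem (X.proj_mem _ x) hd) (by
      rw [sub_add_sub_comm, sub_add_sub_comm, ← h1, ← h, sub_self])
  exact ⟨sub_eq_zero.1 h2, sub_eq_zero.1 h3, sub_eq_zero.1 h4⟩

theorem proj_of_mem_20 {x : ℂ ⊗[ℚ] X.V} (hx : x ∈ X.piece (2, 0)) :
    X.proj (2, 0) x = x ∧ X.proj (1, 1) x = 0 ∧ X.proj (0, 2) x = 0 :=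
  proj_eq (by rw [add_zero, add_zero]) hx (zero_mem _) (zero_mem _)

theorem proj_of_mem_11 {x : ℂ ⊗[ℚ] X.V} (hx : x ∈ X.piece (1, 1)) :
    X.proj (2, 0) x = 0 ∧ X.proj (1, 1) x = x ∧ X.proj (0, 2) x = 0 :=
  proj_eq (by rw [add_zero, zero_add]) (zero_mem _) hx (zero_mem _)

theorem proj_of_mem_02 {x : ℂ ⊗[ℚ] X.V} (hx : x ∈ X.piece (0, 2)) :
    X.proj (2, 0) x = 0 ∧ X.proj (1, 1) x = 0 ∧ X.proj (0, 2) x = x :=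
  proj_eq (by rw [zero_add, zero_add]) (zero_mem _) (zero_mem _) hx

theorem proj_conj {x : ℂ ⊗[ℚ] X.V} (hx : complexConj X.V x = x) :
    complexConj X.V (X.proj (2, 0) x) = X.proj (0, 2) x ∧
      complexConj X.V (X.proj (1, 1) x) = X.proj (1, 1) x := by
  have h := congrArg (complexConj X.V) (X.eq_sum_proj x)
  rw [map_add, map_add, hx] at h
  have := proj_eq (h.trans (by abel : _ = complexConj X.V (X.proj (0, 2) x) +
    complexConj X.V (X.proj (1, 1) x) + complexConj X.V (X.proj (2, 0) x)))
    (X.conj_mem _ _ _ (X.proj_mem _ _)) (X.conj_mem _ _ _ (X.proj_mem _ _))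
    (X.conj_mem _ _ _ (X.proj_mem _ _))
  exact ⟨this.2.2.symm, this.2.1.symm⟩

/-- Being real, the element equals its conjugate, of bidegree `(2, 0)`, and the two summands are
independent. -/
theorem eq_zero_of_real_02 {x : ℂ ⊗[ℚ] X.V} (hx : complexConj X.V x = x)
    (h : x ∈ X.piece (0, 2)) : x = 0 := by
  have h1 := X.conj_mem _ _ _ h
  rw [hx] at h1
  rw [← (proj_of_mem_20 h1).1, (proj_of_mem_02 h).1]

end RatHodgeStructure

namespace PolHodgeStructure
variable (P : PolHodgeStructure 2)

local notation "c" => complexConj P.V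
local notation "QC" => LinearMap.BilinForm.baseChange ℂ P.Q

theorem baseChange_comm (x y : ℂ ⊗[ℚ] P.V) : QC x y = QC y x :=
  baseChange_symm (fun u v => by have := P.symm v u; simpa using this) x y

theorem pos_20 {u : ℂ ⊗[ℚ] P.V} (hu : u ∈ P.piece (2, 0)) (h0 : u ≠ 0) : 0 < -QC (c u) u := by
  have := P.pos 2 0 u hu h0
  rw [show Complex.I ^ (((2 : ℕ) : ℤ) - ((0 : ℕ) : ℤ)) = -1 by simp [zpow_ofNat],
    neg_one_mul, baseChange_comm] at this
  exact this

theorem pos_11 {u : ℂ ⊗[ℚ] P.V} (hu : u ∈ P.piece (1, 1)) (h0 : u ≠ 0) : 0 < QC (c u) u := by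
  have := P.pos 1 1 u hu h0
  rw [show Complex.I ^ (((1 : ℕ) : ℤ) - ((1 : ℕ) : ℤ)) = 1 by simp, one_mul,
      baseChange_comm] at this
  exact this

theorem conj_baseChange (x y : ℂ ⊗[ℚ] P.V) : starRingEnd ℂ (QC (c x) y) = QC (c y) x := by
  rw [← baseChange_complexConj, complexConj_complexConj, baseChange_comm]

variable {P} {E : Type} [AddCommGroup E] [Module ℂ E] {φ : ℂ ⊗[ℚ] P.V →ₗ[ℂ] E}

/-- The Hermitian inner product on `V_ℂ / V^{0,2}` defined by a polarization. -/
theorem exists_core (hφ : Function.Surjective φ) (hker : ∀ x, φ x = 0 ↔ x ∈ P.piece (0, 2)) :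
    ∃ h : InnerProductSpace.Core ℂ E, ∀ x y, h.inner (φ x) (φ y) =
      -2 * QC (c (P.proj (2, 0) x)) (P.proj (2, 0) y) + QC (c (P.proj (1, 1) x)) (P.proj (1,
          1) y) := by
  obtain ⟨s, hs⟩ := φ.exists_rightInverse_of_surjective (LinearMap.range_eq_top.2 hφ)
  have hs' : ∀ x, φ (s x) = x := fun x => LinearMap.congr_fun hs x
  have h20 : ∀ x : E, 0 ≤ -QC (c (P.proj (2, 0) (s x))) (P.proj (2, 0) (s x)) := fun x => by
    by_cases h0 : P.proj (2, 0) (s x) = 0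
    · rw [h0, map_zero, neg_zero]
    · exact (P.pos_20 (P.proj_mem _ _) h0).le
  have h11 : ∀ x : E, 0 ≤ QC (c (P.proj (1, 1) (s x))) (P.proj (1, 1) (s x)) := fun x => by
    by_cases h0 : P.proj (1, 1) (s x) = 0
    · rw [h0, map_zero]
    · exact (P.pos_11 (P.proj_mem _ _) h0).le
  refine ⟨{
    -- A real vector with components `a, b, c a` satisfies `Q(x, x) = 2 Q(c a, a) + Q(b, b)`, while
    -- the CR form is minus the real part of the metric on `H`; this dictates the factor `-2`.
    inner x y := -2 * QC (c (P.proj (2, 0) (s x))) (P.proj (2, 0) (s y)) +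
      QC (c (P.proj (1, 1) (s x))) (P.proj (1, 1) (s y))
    conj_inner_symm x y := by
      rw [map_add, map_mul, conj_baseChange, conj_baseChange, map_neg, Complex.conj_ofNat]
    re_inner_nonneg x := by
      have h1 := (Complex.nonneg_iff.1 (h20 x)).1
      have h2 := (Complex.nonneg_iff.1 (h11 x)).1
      rw [Complex.neg_re] at h1
      have : (-2 * QC (c (P.proj (2, 0) (s x))) (P.proj (2, 0) (s x)) +
        QC (c (P.proj (1, 1) (s x))) (P.proj (1, 1) (s x))).re =
        -2 * (QC (c (P.proj (2, 0) (s x))) (P.proj (2, 0) (s x))).re +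
        (QC (c (P.proj (1, 1) (s x))) (P.proj (1, 1) (s x))).re := by simp
      exact (by linarith : (0 : ℝ) ≤ _).trans_eq this.symm
    add_left x y z := by
      simp only [map_add, LinearMap.add_apply]
      ring
    smul_left x y r := by
      simp only [map_smul, complexConj_smul, LinearMap.smul_apply, smul_eq_mul]
      ring
    definite x hx := by
      have h1 := h20 x
      have h2 := h11 x
      have h3 : QC (c (P.proj (1, 1) (s x))) (P.proj (1, 1) (s x)) = 0 := by
        refine le_antisymm ?_ h2
        have : QC (c (P.proj (1, 1) (s x))) (P.proj (1, 1) (s x)) =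
          -(2 * -QC (c (P.proj (2, 0) (s x))) (P.proj (2, 0) (s x))) := by linear_combination hx
        rw [this]
        exact neg_nonpos.2 (mul_nonneg (by norm_num) h1)
      have h4 : QC (c (P.proj (2, 0) (s x))) (P.proj (2, 0) (s x)) = 0 := by
        linear_combination (-1 / 2) * hx + h3 / 2
      have h5 : P.proj (2, 0) (s x) = 0 := by
        by_contra hne
        have := P.pos_20 (P.proj_mem _ _) hne
        rw [h4, neg_zero] at this
        exact lt_irrefl _ this
      have h6 : P.proj (1, 1) (s x) = 0 := by
        by_contra hne
        have := P.pos_11 (P.proj_mem _ _) hne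
        rw [h3] at this
        exact lt_irrefl _ this
      have h7 := P.eq_sum_proj (s x)
      rw [h5, h6, zero_add, zero_add] at h7
      rw [← hs' x, hker, h7]
      exact P.proj_mem _ _ }, fun x y => ?_⟩
  have key : ∀ x, P.proj (2, 0) (s (φ x)) = P.proj (2, 0) x ∧
      P.proj (1, 1) (s (φ x)) = P.proj (1, 1) x := fun x => by
    have h1 : s (φ x) - x ∈ P.piece (0, 2) := by
      rw [← hker, map_sub, hs', sub_self]
    have h2 := RatHodgeStructure.proj_of_mem_02 h1
    rw [map_sub, map_sub, sub_eq_zero, sub_eq_zero] at h2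
    exact ⟨h2.1, h2.2.1⟩
  change -2 * QC (c (P.proj (2, 0) (s (φ x)))) (P.proj (2, 0) (s (φ y))) +
      QC (c (P.proj (1, 1) (s (φ x)))) (P.proj (1, 1) (s (φ y))) = _
  rw [(key x).1, (key x).2, (key y).1, (key y).2]

/-- Modulo `V^{0,2}` the element `a` is congruent to the real element `a + c a`, and the same holds
for `I • a`. -/
theorem apply_mem_crComplex (hker : ∀ x, φ x = 0 ↔ x ∈ P.piece (0, 2))
    {T : Submodule ℝ E}
    (hT : ∀ y, y ∈ T ↔ ∃ x, c x = x ∧ φ x = y)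
    {a : ℂ ⊗[ℚ] P.V} (ha : a ∈ P.piece (2, 0)) : φ a ∈ crComplex T := by
  have key : ∀ a ∈ P.piece (2, 0), φ a ∈ T := fun a ha => by
    refine (hT _).2 ⟨a + c a, conj_add_conj a, ?_⟩
    rw [map_add, (hker _).2 (P.conj_mem _ _ _ ha), add_zero]
  rw [mem_crComplex, ← map_smul]
  exact ⟨key a ha, key _ (Submodule.smul_mem _ _ ha)⟩

/-- An element of `H` is `φ x` with `x` real and `I • x - x'` in `V^{0,2}` for some real `x'`.
Conjugating puts `-I • x - x'` in `V^{2,0}`, so `x` has no `(1, 1)` component and the product with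
`φ b` vanishes. -/
theorem apply_mem_crCocomplex (hker : ∀ x, φ x = 0 ↔ x ∈ P.piece (0, 2))
    {T : Submodule ℝ E}
    (hT : ∀ y, y ∈ T ↔ ∃ x, c x = x ∧ φ x = y)
    {h : InnerProductSpace.Core ℂ E} (hh : ∀ x y, h.inner (φ x) (φ y) =
      -2 * QC (c (P.proj (2, 0) x)) (P.proj (2, 0) y) +
        QC (c (P.proj (1, 1) x)) (P.proj (1, 1) y))
    {b : ℂ ⊗[ℚ] P.V} (hb : b ∈ P.piece (1, 1)) (hbc : c b = b) :
    φ b ∈ crCocomplex h T := by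
  refine mem_crCocomplex.2 ⟨(hT _).2 ⟨b, hbc, rfl⟩, fun y hy => ?_⟩
  rw [mem_crComplex] at hy
  obtain ⟨x, hx, rfl⟩ := (hT _).1 hy.1
  obtain ⟨x', hx', hxx'⟩ := (hT _).1 hy.2
  have h1 : Complex.I • x - x' ∈ P.piece (0, 2) := by
    rw [← hker, map_sub, map_smul, hxx', sub_self]
  have h2 := P.conj_mem _ _ _ h1
  have h3 : c (Complex.I • x - x') = -(Complex.I • x) - x' := by
    rw [map_sub, complexConj_smul, hx, hx', Complex.conj_I, neg_smul]
  rw [h3] at h2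
  have h4 : P.proj (1, 1) x = 0 := by
    have e1 := (RatHodgeStructure.proj_of_mem_02 h1).2.1
    have e2 := (RatHodgeStructure.proj_of_mem_20 h2).2.1
    rw [map_sub, map_smul] at e1
    rw [map_sub, map_neg, map_smul] at e2
    have e3 : (2 * Complex.I) • P.proj (1, 1) x = 0 := by
      have := congrArg₂ (fun a b => a - b) e1 e2
      simp only [sub_zero] at this
      rw [← this]
      module
    exact (smul_eq_zero.1 e3).resolve_left (mul_ne_zero two_ne_zero Complex.I_ne_zero)
  rw [reForm_apply, hh, (RatHodgeStructure.proj_of_mem_11 hb).1, h4]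
  simp

/-- The decomposition of a real vector maps to `T = H ⊕ F`. In `Q(x, y)` the orthogonality relations
leave the `(1, 1)` term and two mutually conjugate terms, whose sum is twice a real part. -/
theorem crForm_apply_real [FiniteDimensional ℂ E] (hker : ∀ x, φ x = 0 ↔ x ∈ P.piece (0, 2))
    {T : Submodule ℝ E}
    (hT : ∀ y, y ∈ T ↔ ∃ x, c x = x ∧ φ x = y)
    {h : InnerProductSpace.Core ℂ E} (hh : ∀ x y, h.inner (φ x) (φ y) =
      -2 * QC (c (P.proj (2, 0) x)) (P.proj (2, 0) y) +
        QC (c (P.proj (1, 1) x)) (P.proj (1, 1) y))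
    {x y : ℂ ⊗[ℚ] P.V} (hx : c x = x) (hy : c y = y) :
    ((crForm h T (φ x) (φ y) : ℝ) : ℂ) = QC x y := by
  have hsum : ∀ x, φ x = φ (P.proj (2, 0) x) + φ (P.proj (1, 1) x) := fun x => by
    conv_lhs => rw [P.eq_sum_proj x, map_add, (hker _).2 (P.proj_mem _ _), add_zero, map_add]
  have hx' := RatHodgeStructure.proj_conj hx
  have hy' := RatHodgeStructure.proj_conj hy
  rw [hsum x, hsum y, crForm_add (apply_mem_crComplex hker hT (P.proj_mem _ _))
    (apply_mem_crCocomplex hker hT hh (P.proj_mem _ _) hx'.2)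
    (apply_mem_crComplex hker hT (P.proj_mem _ _))
    (apply_mem_crCocomplex hker hT hh (P.proj_mem _ _) hy'.2), reForm_apply, reForm_apply, hh, hh]
  have a := P.proj_mem (2, 0) x
  have b := P.proj_mem (1, 1) x
  have d := P.proj_mem (0, 2) x
  have a' := P.proj_mem (2, 0) y
  have b' := P.proj_mem (1, 1) y
  have d' := P.proj_mem (0, 2) y
  have hxs := P.eq_sum_proj x
  have hys := P.eq_sum_proj y
  have r1 := P.conj_baseChange (P.proj (1, 1) x) (P.proj (1, 1) y)
  have r2 := P.conj_baseChange (P.proj (2, 0) x) (P.proj (2, 0) y)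
  rw [hx'.2, hy'.2, P.baseChange_comm (P.proj (1, 1) y), Complex.conj_eq_iff_re] at r1
  rw [hx'.1, hy'.1] at r2
  rw [(RatHodgeStructure.proj_of_mem_20 a).1, (RatHodgeStructure.proj_of_mem_20 a).2.1,
    (RatHodgeStructure.proj_of_mem_20 a').1, (RatHodgeStructure.proj_of_mem_20 a').2.1,
    (RatHodgeStructure.proj_of_mem_11 b).1, (RatHodgeStructure.proj_of_mem_11 b).2.1,
    (RatHodgeStructure.proj_of_mem_11 b').1, (RatHodgeStructure.proj_of_mem_11 b').2.1,
    hx'.1, hx'.2]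
  have e : QC x y = QC (P.proj (2, 0) x) (P.proj (0, 2) y) +
      QC (P.proj (1, 1) x) (P.proj (1, 1) y) + QC (P.proj (0, 2) x) (P.proj (2, 0) y) := by
    conv_lhs => rw [hxs, hys]
    simp only [map_add, LinearMap.add_apply]
    rw [P.orthogonal 2 0 2 0 (by simp) _ a _ a', P.orthogonal 2 0 1 1 (by simp) _ a _ b',
      P.orthogonal 1 1 2 0 (by simp) _ b _ a', P.orthogonal 1 1 0 2 (by simp) _ b _ d',
      P.orthogonal 0 2 1 1 (by simp) _ d _ b', P.orthogonal 0 2 0 2 (by simp) _ d _ d']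
    ring
  rw [e, P.baseChange_comm (P.proj (2, 0) x), ← r2]
  generalize QC (P.proj (0, 2) x) (P.proj (2, 0) y) = w at *
  generalize QC (P.proj (1, 1) x) (P.proj (1, 1) y) = v at *
  have := Complex.add_conj w
  simp only [map_zero, mul_zero, zero_add, add_zero]
  rw [Complex.ofReal_sub, r1]
  have h3 : (-2 * w).re = -2 * w.re := by simp
  rw [h3]
  push_cast
  push_cast at this
  linear_combination -this

end PolHodgeStructure

/-! ### Recognizing the Hodge structure of an abelian Cousin group -/

namespace AbelianCousinGroup

/-- A criterion for the Hodge structure of an abelian Cousin group to be isomorphic to a given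
one. -/
theorem exists_iso (P : PolHodgeStructure 2) (X : AbelianCousinGroup)
    (φ : ℂ ⊗[ℚ] P.V →ₗ[ℂ] X.E) (hker : ∀ x, φ x = 0 ↔ x ∈ P.piece (0, 2))
    (hsurj : ∀ x ∈ X.lattice, ∃ v : P.V, φ (1 ⊗ₜ v) = x)
    {ι : Type} (b : Module.Basis ι ℚ P.V) (hb : ∀ i, φ (1 ⊗ₜ b i) ∈ X.lattice)
    (h11 : ∀ b ∈ P.piece (1, 1), complexConj P.V b = b → φ b ∈ crCocomplex X.metric X.T)
    (hQ : ∀ u v : P.V, crForm X.metric X.T (φ (1 ⊗ₜ u)) (φ (1 ⊗ₜ v)) = P.Q u v) :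
    ∃ e : hodge.obj X ≅ P, PolHodgeStructure.orthogonalMaps 2 e.hom ∧
      PolHodgeStructure.orthogonalMaps 2 e.inv := by
  let f₀ : P.V →ₗ[ℚ] X.E := φ.restrictScalars ℚ ∘ₗ TensorProduct.mk ℚ ℂ P.V 1
  have hmem : ∀ v, f₀ v ∈ ratSpan X.lattice := fun v => by
    suffices ⊤ ≤ (ratSpan X.lattice).comap f₀ from this (Submodule.mem_top (x := v))
    rw [← b.span_eq, Submodule.span_le]
    rintro _ ⟨i, rfl⟩
    exact Submodule.subset_span (hb i)
  let f : P.V →ₗ[ℚ] ratSpan X.lattice :=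
    f₀.codRestrict _ hmem
  have hf : ∀ v, (f v : X.E) = φ (1 ⊗ₜ v) := fun v => rfl
  have key : ∀ x, X.datum.φ (f.baseChange ℂ x) = φ x := fun x => by
    induction x with
    | zero => rw [map_zero, map_zero, map_zero]
    | add x y hx hy => rw [map_add, map_add, map_add, hx, hy]
    | tmul z v =>
      rw [LinearMap.baseChange_tmul]
      rw [← mul_one z, ← smul_eq_mul, ← TensorProduct.smul_tmul', ← TensorProduct.smul_tmul',
        map_smul, map_smul, datum_apply, hf]
  have hf11 : ∀ x ∈ P.piece (1, 1), f.baseChange ℂ x ∈ X.datum.P11 := fun x hx => by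
    have hc := P.conj_mem _ _ _ hx
    refine X.datum.mem_P11.2 ?_
    rw [complexConj_baseChange, ← map_add, ← map_sub, ← map_smul, key, key]
    exact ⟨h11 _ (add_mem hx hc) (conj_add_conj x),
      h11 _ (Submodule.smul_mem _ _ (sub_mem hx hc)) (conj_I_sub_conj x)⟩
  have hf02 : ∀ x ∈ P.piece (0, 2), f.baseChange ℂ x ∈ X.datum.P02 := fun x hx =>
    X.datum.mem_P02.2 ((key x).trans ((hker x).2 hx))
  have hf20 : ∀ x ∈ P.piece (2, 0), f.baseChange ℂ x ∈ X.datum.P20 := fun x hx => by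
    refine X.datum.mem_P20.2 ?_
    rw [complexConj_baseChange, key]
    exact (hker _).2 (P.conj_mem _ _ _ hx)
  have hfp : ∀ p q : ℕ, ∀ x ∈ P.piece (p, q),
      f.baseChange ℂ x ∈ threePiece X.datum.P20 X.datum.P11 X.datum.P02 (p, q) := by
    intro p q x hx
    by_cases hpq : p + q = 2
    · obtain ⟨rfl, rfl⟩ | ⟨rfl, rfl⟩ | ⟨rfl, rfl⟩ :
        (p = 2 ∧ q = 0) ∨ (p = 1 ∧ q = 1) ∨ (p = 0 ∧ q = 2) := by omega
      · exact hf20 x hx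
      · exact hf11 x hx
      · exact hf02 x hx
    · rw [P.piece_eq_bot p q hpq, Submodule.mem_bot] at hx
      rw [hx, map_zero]
      exact zero_mem _
  -- A rational vector killed by `φ` is a real element of `V^{0,2}`.
  have hinj : Function.Injective f := by
    refine (injective_iff_map_eq_zero f).2 fun v hv => ?_
    have h1 : φ (1 ⊗ₜ v) = 0 := by rw [← hf, hv]; rfl
    have h2 := RatHodgeStructure.eq_zero_of_real_02 (X := P.toRatHodgeStructure)
      (by rw [complexConj_tmul, map_one]) ((hker _).1 h1)
    exact Module.FaithfullyFlat.tensorProduct_mk_injective (A := ℚ) (B := ℂ) P.V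
      (h2.trans (TensorProduct.tmul_zero _ _).symm)
  have hsur : Function.Surjective f := by
    rintro ⟨x, hx⟩
    obtain ⟨N, hN, h⟩ := exists_smul_mem_of_mem_ratSpan hx
    obtain ⟨v, hv⟩ := hsurj _ h
    refine ⟨(N : ℚ)⁻¹ • v, Subtype.ext ?_⟩
    rw [map_smul, Submodule.coe_smul, hf, hv, ← Nat.cast_smul_eq_nsmul ℚ, smul_smul,
      inv_mul_cancel₀ (Nat.cast_ne_zero.2 hN), one_smul]
  let F : P ⟶ hodge.obj X := ⟨f, hfp⟩
  obtain ⟨g, hg, hg'⟩ := RatHodgeStructure.Hom.exists_inverse (X := P.toRatHodgeStructure)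
    (Y := (hodge.obj X).toRatHodgeStructure) F ⟨hinj, hsur⟩
  have hF : PolHodgeStructure.orthogonalMaps 2 F := fun u v => by
    have : (((hodge.obj X).Q (f u) (f v) : ℚ) : ℝ) = P.Q u v := by
      rw [hodge_Q, hf, hf, hQ]
    exact_mod_cast this
  have h1 : F ≫ (g : hodge.obj X ⟶ P) = 𝟙 P := RatHodgeStructure.Hom.ext hg
  have h2 : (g : hodge.obj X ⟶ P) ≫ F = 𝟙 _ := RatHodgeStructure.Hom.ext hg'
  exact ⟨⟨g, F, h2, h1⟩, orthogonal_of_comp_eq hF h2, hF⟩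

end AbelianCousinGroup

/-! ### Coordinates on a complexification and discrete spans -/

section
variable {V : Type} [AddCommGroup V] [Module ℚ V] {ι : Type} [Fintype ι] (b : Module.Basis ι ℚ V)

theorem complexConj_sum_ofReal {y : ι → ℝ} :
    complexConj V (∑ i, (y i : ℂ) ⊗ₜ b i) = ∑ i, (y i : ℂ) ⊗ₜ b i := by
  rw [map_sum]
  exact Finset.sum_congr rfl fun i _ => by rw [complexConj_tmul, Complex.conj_ofReal]

theorem sum_tmul_basis_injective {z w : ι → ℂ}
    (h : ∑ i, z i ⊗ₜ[ℚ] b i = ∑ i, w i ⊗ₜ[ℚ] b i) : z = w := by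
  have key : ∀ z : ι → ℂ, ∑ i, z i ⊗ₜ[ℚ] b i = (Algebra.TensorProduct.basis ℂ b).equivFun.symm z :=
      by
    intro z
    rw [Module.Basis.equivFun_symm_apply]
    exact Finset.sum_congr rfl fun i _ => (Algebra.TensorProduct.basis_repr_symm_apply' b
        (z i) i).symm
  rw [key, key] at h
  exact (Algebra.TensorProduct.basis ℂ b).equivFun.symm.injective h

theorem exists_sum_tmul_basis (x : ℂ ⊗[ℚ] V) : ∃ z : ι → ℂ, x = ∑ i, z i ⊗ₜ[ℚ] b i := by
  refine ⟨(Algebra.TensorProduct.basis ℂ b).equivFun x, ?_⟩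
  conv_lhs => rw [← (Algebra.TensorProduct.basis ℂ b).sum_equivFun x]
  exact Finset.sum_congr rfl fun i _ => Algebra.TensorProduct.basis_repr_symm_apply' b _ i

theorem exists_real_sum_tmul_basis {x : ℂ ⊗[ℚ] V} (hx : complexConj V x = x) :
    ∃ y : ι → ℝ, x = ∑ i, (y i : ℂ) ⊗ₜ[ℚ] b i := by
  obtain ⟨z, rfl⟩ := exists_sum_tmul_basis b x
  rw [map_sum] at hx
  simp only [complexConj_tmul] at hx
  have h := sum_tmul_basis_injective b (z := fun i => starRingEnd ℂ (z i)) hx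
  refine ⟨fun i => (z i).re, Finset.sum_congr rfl fun i _ => ?_⟩
  rw [Complex.conj_eq_iff_re.1 (congrFun h i)]

end

/-- Extend the family to a real basis, whose integral span is a lattice. -/
theorem LinearIndependent.discreteTopology_span {E : Type} [NormedAddCommGroup E] [NormedSpace ℝ E]
    [FiniteDimensional ℝ E] {ι : Type} {B : ι → E} (hB : LinearIndependent ℝ B) :
    DiscreteTopology (Submodule.span ℤ (Set.range B)) := by
  have h := hB.linearIndepOn_id
  let e := Module.Basis.extend h
  have : Finite (h.extend (Set.subset_univ (Set.range B))) := Module.Finite.finite_basis e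
  refine DiscreteTopology.of_subset (s := (Submodule.span ℤ (Set.range e) : Set E)) ?_ ?_
  · exact inferInstanceAs (DiscreteTopology (Submodule.span ℤ (Set.range e)))
  · refine Submodule.span_mono ?_
    rw [Module.Basis.range_extend]
    exact h.subset_extend _

/-! ### The lattice of a Hodge structure and its integral forms -/

namespace RatHodgeStructure
variable (X : RatHodgeStructure 2)

/-- The quotient by `V^{0,2}` will be the tangent space of a Lie group; coordinates provide it with
a norm. -/
theorem exists_quotient_map : ∃ (n : ℕ) (φ : ℂ ⊗[ℚ] X.V →ₗ[ℂ] EuclideanSpace ℂ (Fin n)),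
    Function.Surjective φ ∧ ∀ x, φ x = 0 ↔ x ∈ X.piece (0, 2) := by
  let e : ((ℂ ⊗[ℚ] X.V) ⧸ X.piece (0, 2)) ≃ₗ[ℂ] EuclideanSpace ℂ
      (Fin (Module.finrank ℂ ((ℂ ⊗[ℚ] X.V) ⧸ X.piece (0, 2)))) :=
    LinearEquiv.ofFinrankEq _ _ (by rw [finrank_euclideanSpace_fin])
  refine ⟨_, e.toLinearMap ∘ₗ (X.piece (0, 2)).mkQ,
    e.surjective.comp (Submodule.mkQ_surjective _), fun x => ?_⟩
  rw [LinearMap.comp_apply, LinearEquiv.coe_coe, LinearEquiv.map_eq_zero_iff,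
    Submodule.mkQ_apply, Submodule.Quotient.mk_eq_zero]

/-- The trivial Hodge structure of weight `0`. -/
noncomputable def trivial : RatHodgeStructure 0 where
  V := ℚ
  piece i := if i = (0, 0) then ⊤ else ⊥
  piece_eq_bot p q h := if_neg fun h' => h (by simp only [Prod.mk.injEq] at h'; omega)
  isInternal := by
    rw [DirectSum.isInternal_submodule_iff_iSupIndep_and_iSup_eq_top]
    refine ⟨fun i => ?_, ?_⟩
    · by_cases hi : i = (0, 0)
      · have : ⨆ j, ⨆ (_ : j ≠ i), (if j = (0, 0) then ⊤ else ⊥ : Submodule ℂ (ℂ ⊗[ℚ] ℚ)) = ⊥ := by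
          refine iSup₂_eq_bot.2 fun j hj => if_neg (hi ▸ hj)
        rw [this]
        exact disjoint_bot_right
      · refine Disjoint.mono_left ?_ disjoint_bot_left
        exact (if_neg hi).le
    · exact eq_top_iff.2 (le_iSup_of_le (0, 0) (by rw [if_pos rfl]))
  conj_mem p q x hx := by
    by_cases h : (p, q) = (0, 0)
    · simp only [Prod.mk.injEq] at h
      rw [h.1, h.2, if_pos rfl]
      trivial
    · rw [if_neg h, Submodule.mem_bot] at hx
      rw [hx, map_zero]
      exact zero_mem _

variable {X}

/-- Without quotients of weight `0`, there are no nonzero rational forms of bidegree `(1, 1)`. -/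
theorem NoWeightZeroQuotient.eq_zero (hX : X.NoWeightZeroQuotient) {l : X.V →ₗ[ℚ] ℚ}
    (h : ∀ x ∈ X.piece (0, 2), l.baseChange ℂ x = 0) : l = 0 := by
  by_contra hl
  -- A rational form commutes with conjugation, so it kills `V^{2,0}` as well and is a morphism to
  -- the twist of the trivial structure.
  have h20 : ∀ x ∈ X.piece (2, 0), l.baseChange ℂ x = 0 := fun x hx => by
    have h1 := h _ (X.conj_mem _ _ _ hx)
    have h2 := congrArg (complexConj ℚ) h1
    rwa [complexConj_baseChange, complexConj_complexConj, map_zero] at h2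
  let f : Hom X trivial.tateTwist := ⟨l, fun p q x hx => by
    by_cases hpq : p + q = 2
    · obtain ⟨rfl, rfl⟩ | ⟨rfl, rfl⟩ | ⟨rfl, rfl⟩ :
        (p = 2 ∧ q = 0) ∨ (p = 1 ∧ q = 1) ∨ (p = 0 ∧ q = 2) := by omega
      · change l.baseChange ℂ x ∈ (⊥ : Submodule ℂ (ℂ ⊗[ℚ] ℚ))
        rw [h20 x hx]
        exact zero_mem _
      · change l.baseChange ℂ x ∈ (if ((0, 0) : ℕ × ℕ) = (0, 0) then ⊤ else ⊥ : Submodule ℂ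
          (ℂ ⊗[ℚ] ℚ))
        rw [if_pos rfl]
        exact Submodule.mem_top
      · change l.baseChange ℂ x ∈ (⊥ : Submodule ℂ (ℂ ⊗[ℚ] ℚ))
        rw [h x hx]
        exact zero_mem _
    · rw [X.piece_eq_bot p q hpq, Submodule.mem_bot] at hx
      rw [hx, map_zero]
      exact zero_mem _⟩
  have := hX trivial f (LinearMap.surjective hl)
  exact not_subsingleton ℚ this

end RatHodgeStructure

namespace RatHodgeStructure
variable {X : RatHodgeStructure 2} {ι : Type} [Fintype ι] (b : Module.Basis ι ℚ X.V)
  {E : Type} [AddCommGroup E] [Module ℂ E] {φ : ℂ ⊗[ℚ] X.V →ₗ[ℂ] E}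

theorem apply_sum_ofReal (φ : ℂ ⊗[ℚ] X.V →ₗ[ℂ] E) (y : ι → ℝ) :
    φ (∑ i, (y i : ℂ) ⊗ₜ b i) = ∑ i, y i • φ (1 ⊗ₜ b i) := by
  rw [map_sum]
  refine Finset.sum_congr rfl fun i _ => ?_
  rw [← Complex.coe_smul, ← map_smul, TensorProduct.smul_tmul', smul_eq_mul, mul_one]

/-- A real relation between these images is a real element of `V^{0,2}`, hence zero. -/
theorem linearIndependent_apply (hker : ∀ x, φ x = 0 ↔ x ∈ X.piece (0, 2)) :
    LinearIndependent ℝ fun i => φ (1 ⊗ₜ b i) := by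
  rw [Fintype.linearIndependent_iff]
  intro y hy i
  rw [← apply_sum_ofReal, hker] at hy
  have h1 := eq_zero_of_real_02 (complexConj_sum_ofReal b) hy
  have h2 := sum_tmul_basis_injective b (z := fun i => (y i : ℂ)) (w := fun _ => 0)
    (by rw [h1]; simp)
  exact Complex.ofReal_eq_zero.1 (congrFun h2 i)

theorem exists_apply_eq (hφ : Function.Surjective φ) (x : E) : ∃ y y' : ι → ℝ,
    x = ∑ i, y i • φ (1 ⊗ₜ b i) + Complex.I • ∑ i, y' i • φ (1 ⊗ₜ b i) := by
  obtain ⟨t, rfl⟩ := hφ x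
  obtain ⟨z, rfl⟩ := exists_sum_tmul_basis b t
  refine ⟨fun i => (z i).re, fun i => (z i).im, ?_⟩
  rw [← apply_sum_ofReal, ← apply_sum_ofReal, ← map_smul, ← map_add, Finset.smul_sum,
    ← Finset.sum_add_distrib]
  refine congrArg φ (Finset.sum_congr rfl fun i _ => ?_)
  rw [TensorProduct.smul_tmul', ← TensorProduct.add_tmul, smul_eq_mul, mul_comm, Complex.re_add_im]

/-- Otherwise the integral form `n` vanishes on `H`. The real and imaginary parts of an element of
`V^{0,2}` have images in `H`, so the complexified form kills `V^{0,2}` and must be zero by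
`NoWeightZeroQuotient.eq_zero`. -/
theorem NoWeightZeroQuotient.exists_sum_ne_zero (hX : X.NoWeightZeroQuotient)
    (hker : ∀ x, φ x = 0 ↔ x ∈ X.piece (0, 2)) {n : ι → ℤ} (hn : n ≠ 0) : ∃ y y' : ι → ℝ,
      ∑ i, n i * y i ≠ 0 ∧
        Complex.I • ∑ i, y i • φ (1 ⊗ₜ b i) = ∑ i, y' i • φ (1 ⊗ₜ b i) := by
  by_contra! hcon
  let l : X.V →ₗ[ℚ] ℚ := b.constr ℚ fun i => (n i : ℚ)
  have hl : ∀ i, l (b i) = n i := fun i => b.constr_basis ℚ _ i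
  have key : ∀ r s : ℂ ⊗[ℚ] X.V, complexConj X.V r = r → complexConj X.V s = s →
      Complex.I • φ r = φ s → l.baseChange ℂ r = 0 := fun r s hr hs hrs => by
    obtain ⟨y, rfl⟩ := exists_real_sum_tmul_basis b hr
    obtain ⟨y', rfl⟩ := exists_real_sum_tmul_basis b hs
    rw [apply_sum_ofReal, apply_sum_ofReal] at hrs
    have h1 : ∑ i, n i * y i = 0 := by
      by_contra hne
      exact hcon y y' hne hrs
    have h2 : l.baseChange ℂ (∑ i, (y i : ℂ) ⊗ₜ b i) = ((∑ i, n i * y i : ℝ) : ℂ) ⊗ₜ 1 := by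
      rw [map_sum, Complex.ofReal_sum, TensorProduct.sum_tmul]
      refine Finset.sum_congr rfl fun i _ => ?_
      rw [LinearMap.baseChange_tmul, hl, ← mul_one (n i : ℚ), ← smul_eq_mul,
          TensorProduct.tmul_smul,
        TensorProduct.smul_tmul', Rat.smul_def]
      push_cast
      rfl
    rw [h2, h1, Complex.ofReal_zero, TensorProduct.zero_tmul]
  have hl0 : l = 0 := hX.eq_zero fun x hx => by
    have h0 := (hker x).2 hx
    have h1 := key _ _ (conj_add_conj x)
      (by rw [map_neg, conj_I_sub_conj x] : complexConj X.V (-(Complex.I •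
          (x - complexConj X.V x))) = _)
      (by rw [map_neg, map_smul, map_sub, map_add, h0, zero_add, zero_sub, smul_neg, neg_neg])
    have h2 := key _ _ (conj_I_sub_conj x) (conj_add_conj x)
      (by rw [map_smul, map_sub, map_add, h0, zero_add, zero_sub, smul_smul, Complex.I_mul_I,
        neg_smul, one_smul, neg_neg])
    have h3 := congrArg (l.baseChange ℂ) (eq_re_add_im x)
    rw [map_sub, map_smul _ Complex.I, h1, h2, smul_zero, sub_zero, map_smul] at h3
    exact (smul_eq_zero.1 h3).resolve_left two_ne_zero
  refine hn (funext fun i => ?_)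
  have := hl i
  rw [hl0, LinearMap.zero_apply] at this
  exact_mod_cast this.symm

end RatHodgeStructure

/-! ### Essential surjectivity and the conclusion -/

namespace PolHodgeStructure

open AbelianCousinGroup in
/-- Every polarized Hodge structure of weight 2 without nontrivial quotients of weight 0 comes from
an abelian Cousin group. -/
theorem exists_abelianCousinGroup (P : PolHodgeStructure 2)
    (hP : P.toRatHodgeStructure.NoWeightZeroQuotient) :
    ∃ (X : AbelianCousinGroup) (e : hodge.obj X ≅ P),
      PolHodgeStructure.orthogonalMaps 2 e.hom ∧ PolHodgeStructure.orthogonalMaps 2 e.inv := by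
  obtain ⟨n, φ, hφ, hker⟩ := P.toRatHodgeStructure.exists_quotient_map
  let b := Module.finBasis ℚ P.V
  have hB := RatHodgeStructure.linearIndependent_apply b hker
  set B : Fin (Module.finrank ℚ P.V) → EuclideanSpace ℂ (Fin n) := fun i => φ (1 ⊗ₜ b i)
  have : FiniteDimensional ℝ (EuclideanSpace ℂ (Fin n)) := FiniteDimensional.complexToReal _
  -- Any lattice in `V` would serve; the integral span of a rational basis is taken.
  let Λ : AddSubgroup (EuclideanSpace ℂ (Fin n)) := (Submodule.span ℤ (Set.range B)).toAddSubgroup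
  have : DiscreteTopology Λ := hB.discreteTopology_span
  let T : Submodule ℝ (EuclideanSpace ℂ (Fin n)) := Submodule.span ℝ (Λ : Set _)
  have hT : ∀ y, y ∈ T ↔ ∃ x, complexConj P.V x = x ∧ φ x = y := fun y => by
    have h1 : T = Submodule.span ℝ (Set.range B) := Submodule.span_span_of_tower ℤ ℝ _
    rw [h1, Submodule.mem_span_range_iff_exists_fun]
    constructor
    · rintro ⟨y, rfl⟩
      exact ⟨_, complexConj_sum_ofReal b, RatHodgeStructure.apply_sum_ofReal b φ y⟩
    · rintro ⟨x, hx, rfl⟩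
      obtain ⟨y, rfl⟩ := exists_real_sum_tmul_basis b hx
      exact ⟨y, (RatHodgeStructure.apply_sum_ofReal b φ y).symm⟩
  obtain ⟨h, hh⟩ := exists_core hφ hker
  have hsurj : ∀ x ∈ Λ, ∃ v : P.V, φ (1 ⊗ₜ v) = x := fun x hx => by
    have hx' : x ∈ Submodule.span ℤ (Set.range B) := hx
    rw [Submodule.mem_span_range_iff_exists_fun] at hx'
    obtain ⟨m, rfl⟩ := hx'
    refine ⟨∑ i, m i • b i, ?_⟩
    rw [TensorProduct.tmul_sum, map_sum]
    refine Finset.sum_congr rfl fun i _ => ?_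
    rw [← Int.cast_smul_eq_zsmul ℚ, TensorProduct.tmul_smul, Int.cast_smul_eq_zsmul, map_zsmul]
  have hform : ∀ u v : P.V, crForm h T (φ (1 ⊗ₜ u)) (φ (1 ⊗ₜ v)) = P.Q u v := fun u v => by
    have hr : ∀ u : P.V, complexConj P.V (1 ⊗ₜ u) = 1 ⊗ₜ u := fun u => by
      rw [complexConj_tmul, map_one]
    have h1 := crForm_apply_real hker hT hh (hr u) (hr v)
    rw [LinearMap.BilinForm.baseChange_tmul] at h1
    have h2 : ((crForm h T (φ (1 ⊗ₜ u)) (φ (1 ⊗ₜ v)) : ℝ) : ℂ) = ((P.Q u v : ℚ) : ℝ) := by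
      rw [h1]
      simp
    exact_mod_cast h2
  have hexp : IsExp (LatticeQuotient.mk Λ) := LatticeQuotient.isExp_mk
  have hkernel : hexp.kernel = Λ := AddSubgroup.ext fun x => LatticeQuotient.mk_eq_one Λ
  have hspan : hexp.latticeSpan = T := by
    rw [IsExp.latticeSpan, hkernel]
  let X : AbelianCousinGroup :=
    { E := EuclideanSpace ℂ (Fin n)
      G := LatticeQuotient Λ
      holomorphicConstant := fun f hf => by
        refine ⟨f (LatticeQuotient.mk Λ 0), fun q => ?_⟩
        obtain ⟨x, rfl⟩ := LatticeQuotient.mk_surjective Λ q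
        have hd : Differentiable ℂ fun x => f (LatticeQuotient.mk Λ x) :=
          (hf.comp (LatticeQuotient.contMDiff_mk.mdifferentiable (by simp))).differentiable
        refine eq_of_differentiable_of_periodic (b := B) hd (fun x i => ?_)
          (RatHodgeStructure.exists_apply_eq b hφ)
          (fun n hn => hP.exists_sum_ne_zero b hker hn) x
        have : LatticeQuotient.mk Λ (B i) = 1 :=
          (LatticeQuotient.mk_eq_one Λ).2 (Submodule.subset_span ⟨i, rfl⟩)
        change f (LatticeQuotient.mk Λ (x + B i)) = f (LatticeQuotient.mk Λ x)
        rw [LatticeQuotient.mk_add, this, mul_one]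
      K := hexp.core
      maximal_compact := hexp.maximal_core
      metric := h
      polarized := by
        rw [hexp.tangentAtOne_core, hspan, hexp.isPolarizedIn_core _ crForm_comm]
        intro x hx
        rw [hkernel] at hx
        obtain ⟨v, rfl⟩ := hsurj x hx
        exact ⟨_, hform v v⟩ }
  have hlat : X.lattice = Λ := by
    have h1 : X.exp = LatticeQuotient.mk Λ := IsExp.unique X.isExp hexp
    refine AddSubgroup.ext fun x => ?_
    rw [mem_lattice, h1]
    exact LatticeQuotient.mk_eq_one Λ
  have hXT : X.T = T := by
    rw [T_eq, hlat]
  have hb : ∀ i, φ (1 ⊗ₜ b i) ∈ X.lattice := fun i => by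
    rw [hlat]
    exact Submodule.subset_span ⟨i, rfl⟩
  refine ⟨X, exists_iso P X φ hker (fun x hx => hsurj x (hlat ▸ hx)) b hb (fun x hx hc => ?_)
    fun u v => ?_⟩
  · rw [hXT]
    exact apply_mem_crCocomplex hker hT hh hx hc
  · rw [hXT]
    exact hform u v

end PolHodgeStructure

theorem mainTheorem2 :
    Nonempty
      ((PolHodgeStructure.noWeightZeroQuotient.inverseImage
          (wideSubcategoryInclusion (PolHodgeStructure.orthogonalMaps 2))).FullSubcategory ≌
        (AbelianCousinGroup.isogeny.inverseImage
          (wideSubcategoryInclusion AbelianCousinGroup.isometric)).Localization) ∧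
    Nonempty
      (PolHodgeStructure.noWeightZeroQuotient.FullSubcategory ≌
        AbelianCousinGroup.isogeny.Localization) :=
  nonempty_equivalences_of_exists PolHodgeStructure.exists_abelianCousinGroup
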